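/- Let $F$ be a field of characteristic $0$ and $n\ge 0$. Let $S=\{s_1,\dots,s_{n-1}\}\subset S_n$, $s_i=(i,i+1)$, and let $\ell$ be the Coxeter length. **Minimal AY representations.** For a finite $\mathcal K\subseteq S_n$ let $V_{\mathcal K}$ be the $F$-vector space with basis $\{C_w : w\in\mathcal K\}$. A pair $(\rho,\mathcal K)$, with $\rho$ a representation of $S_n$ on $V_{\mathcal K}$, is an *AY pair* if for all $s\in S$, $w\in\mathcal K$ there are $a_s(w),b_s(w)\in F$ with $\rho_s(C_w)=a_s(w)C_w+b_s(w)C_{ws}$, where $b_s(w)=0$ if $ws\notin\mathcal K$. It is *minimal* if $\mathcal K\neq\emptyset$ and $V_{\mathcal K'}$ is not $\rho$-invariant for any $\emptyset\subset\mathcal K'\subset\mathcal K$ (strict inclusions). A *minimal AY representation* is a representation isomorphic to the $\rho$ of a minimal AY pair. **Skew Specht modules.** For Young diagrams $\mu\subseteq\lambda$ with $|\lambda/\mu|=n$, $S^{\lambda/\mu}$ is the span of the polytabloids $e_T=\sum_{g\in C_T}\operatorname{sgn}(g)\{gT\}$ ($T$ a bijective filling of $\lambda/\mu$ by $1,\dots,n$,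 $C_T$ its column group, $\{\cdot\}$ row tabloids). **The representations $\rho^f_{id}$.** For $f\in\mathbb Z^n$ and a transposition $t=(i,j)$, $i<j$, put $\langle f,\alpha_t\rangle=f_j-f_i$. Let $A_f=\{t:\langle f,\alpha_t\rangle=\pm1\}$, $\mathrm{Des}_{A_f}(v)=\{t\in A_f:\ell(tv)<\ell(v)\}$, $\mathcal K^f_{id}=\{v\in S_n:\mathrm{Des}_{A_f}(v)=\mathrm{Des}_{A_f}(id)\}$. For $\mathcal K\subseteq S_n$ let $T_{\mathcal K}$ (resp. $T_{\partial\mathcal K}$) be the set of $wsw^{-1}$ with $s\in S$, $w\in\mathcal K$ and $ws\in\mathcal K$ (resp. $ws\notin\mathcal K$). Call $f$ *$\mathcal K$-generic* if $\mathcal K$ contains $id$ and is convex in the right weak order, $\langle f,\alpha_t\rangle\notin\{0,1,-1\}$ for $t\in T_{\mathcal K}$, $\langle f,\alpha_t\rangle\in\{1,-1\}$ for $t\in T_{\partial\mathcal K}$, and $\langle f,\alpha_{wsw^{-1}}\rangle=\langle f,\alpha_{wtw^{-1}}\rangle$ whenever $w\in\mathcal K$, $s,t\in S$, $st$ has order $3$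 and $ws,wt\notin\mathcal K$. Let $\dot a_t=1/\langle f,\alpha_t\rangle$ and choose scalars $\dot b_t,\ddot b_t\in F$ with $\dot b_t\ddot b_t=(1-\dot a_t)(1+\dot a_t)$ for all $t\in T_{\mathcal K^f_{id}}$ (for instance the symmetric normalization $\dot b_t=\ddot b_t=\sqrt{1-\dot a_t^2}$ if these roots lie in $F$). Then $\rho^f_{id}$ denotes the representation on $V_{\mathcal K^f_{id}}$ with, for $t=wsw^{-1}$ and $C_{ws}:=0$ if $ws\notin\mathcal K^f_{id}$, $$\rho_s(C_w)=\begin{cases}\dot a_tC_w+\dot b_tC_{ws},&\ell(w)<\ell(ws),\\-\dot a_tC_w+\ddot b_tC_{ws},&\ell(w)>\ell(ws).\end{cases}$$ **Theorem.** 1. A representation of $S_n$ over $F$ is a minimal AY representation if and only if it is isomorphic to $S^{\lambda/\mu}$ for some Young diagrams $\mu\subseteq\lambda$ ($\mu$ possibly empty) with $|\lambda/\mu|=n$. 2. Let $Q_0$ be a standard tableau of skew shape $\lambda/\mu$, $|\lambda/\mu|=n$, let $c(k)=(\text{column})-(\text{row})$ of the box of $k$ in $Q_0$, and let $f\in\mathbb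 Z^n$ satisfy $f_{k+1}-f_k=c(k+1)-c(k)$ for $1\le k<n$. Then $f$ is $\mathcal K^f_{id}$-generic, and for every choice of $\dot b,\ddot b$ as above there is exactly one representation $\rho^f_{id}$ given by the formulas above; $(\rho^f_{id},\mathcal K^f_{id})$ is a minimal AY pair, and $\rho^f_{id}\cong S^{\lambda/\mu}$. 3. In particular, every irreducible representation of $S_n$ over $F$ is a minimal AY representation. -/

import Mathlib

namespace AbstractYoung

open Equiv

/-! ### The symmetric group as a Coxeter group -/

/-- `s` is one of the Coxeter generators of `S_n`, i.e. an adjacent transposition `(i, i+1)`. -/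
def IsSimple {n : ℕ} (s : Perm (Fin n)) : Prop :=
  ∃ i j : Fin n, (j : ℕ) = (i : ℕ) + 1 ∧ s = swap i j

/-- The Coxeter length of a permutation: its number of inversions. -/
def length {n : ℕ} (w : Perm (Fin n)) : ℕ :=
  (Finset.univ.filter (fun p : Fin n × Fin n => p.1 < p.2 ∧ w p.2 < w p.1)).card

/-- `K` is convex in the Hasse diagram of the right weak order (the right Cayley graph, whose
distance is `ℓ(u⁻¹ v)`): it contains every element lying on a shortest path between two of its
elements. -/
def IsConvexCell {n : ℕ} (K : Finset (Perm (Fin n))) : Prop :=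
  ∀ u ∈ K, ∀ v ∈ K, ∀ w : Perm (Fin n),
    length (u⁻¹ * w) + length (w⁻¹ * v) = length (u⁻¹ * v) → w ∈ K

/-! ### Abstract Young pairs -/

section Pairs

variable {F : Type*} [Field F] {n : ℕ}

/-- The vector `C_g` of `V_K = span {C_w | w ∈ K}`, with the convention `C_g = 0` for `g ∉ K`. -/
noncomputable def cellVec (F : Type*) [Field F] {n : ℕ} (K : Finset (Perm (Fin n)))
    (g : Perm (Fin n)) : K →₀ F :=
  if h : g ∈ K then Finsupp.single ⟨g, h⟩ 1 else 0

/-- Axiom (A): `(ρ, K)` is an abstract Young pair. -/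
def IsAYPair (K : Finset (Perm (Fin n))) (ρ : Representation F (Perm (Fin n)) (K →₀ F)) : Prop :=
  ∀ s : Perm (Fin n), IsSimple s → ∀ w ∈ K, ∃ a b : F, (w * s ∉ K → b = 0) ∧
    ρ s (cellVec F K w) = a • cellVec F K w + b • cellVec F K (w * s)

/-- The coordinate subspace `V_{K'}` of `V_K` spanned by the `C_w` with `w ∈ K'`. -/
noncomputable def coordSubspace (F : Type*) [Field F] {n : ℕ} (K K' : Finset (Perm (Fin n))) :
    Submodule F (K →₀ F) :=
  Submodule.span F ((fun w => cellVec F K w) '' (K' : Set (Perm (Fin n))))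

/-- `(ρ, K)` is a minimal abstract Young pair: `K` is nonempty and `V_{K'}` is not `ρ`-invariant
for any `∅ ⊂ K' ⊂ K`. -/
def IsMinimalAYPair (K : Finset (Perm (Fin n)))
    (ρ : Representation F (Perm (Fin n)) (K →₀ F)) : Prop :=
  IsAYPair K ρ ∧ K.Nonempty ∧
    ∀ K' : Finset (Perm (Fin n)), K'.Nonempty → K' ⊂ K →
      ¬ ∀ g : Perm (Fin n), ∀ v ∈ coordSubspace F K K', ρ g v ∈ coordSubspace F K K'

/-- A representation of `S_n` is a minimal AY representation (up to isomorphism) if it is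
isomorphic to the representation of some minimal AY pair. -/
def IsMinimalAYRep {V : Type*} [AddCommGroup V] [Module F V]
    (ρ : Representation F (Perm (Fin n)) V) : Prop :=
  ∃ (K : Finset (Perm (Fin n))) (σ : Representation F (Perm (Fin n)) (K →₀ F)),
    IsMinimalAYPair K σ ∧ Nonempty (ρ.Equiv σ)

end Pairs

/-! ### The representation attached to a linear functional -/

section Functional

variable {F : Type*} [Field F] {n : ℕ}

/-- The positive root of the transposition `t = (i, j)`, `i < j`, as a vector: `ε_j - ε_i`. -/
def posRoot (F : Type*) [Field F] {n : ℕ} (t : Perm (Fin n)) : Fin n → F :=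
  fun k => if t k < k then 1 else if k < t k then -1 else 0

/-- The pairing `⟨f, α_t⟩`; it equals `f_j - f_i` for `t = (i, j)`, `i < j`. -/
def pairing (f : Fin n → F) (t : Perm (Fin n)) : F :=
  ∑ k, f k * posRoot F t k

theorem pairing_swap (f : Fin n → F) {i j : Fin n} (hij : i < j) :
    pairing f (swap i j) = f j - f i := by
  have h : ∀ k, f k * posRoot F (swap i j) k =
      (if k = j then f j else 0) + (if k = i then - f i else 0) := by
    intro k
    unfold posRoot
    by_cases hki : k = i
    · subst hki
      simp [hij, hij.ne, not_lt.2 hij.le]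
    · by_cases hkj : k = j
      · subst hkj
        simp [hij, hij.ne']
      · simp [swap_apply_of_ne_of_ne hki hkj, hki, hkj]
  unfold pairing
  rw [Finset.sum_congr rfl (fun k _ => h k), Finset.sum_add_distrib]
  simp [sub_eq_add_neg]

/-- `A_f`, the set of reflections `t` with `⟨f, α_t⟩ = ± 1`. -/
def unitReflections (f : Fin n → F) : Set (Perm (Fin n)) :=
  {t | t.IsSwap ∧ (pairing f t = 1 ∨ pairing f t = -1)}

/-- The left `A`-descent set `Des_A(w) = {t ∈ A | ℓ(tw) < ℓ(w)}`. -/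
def descents (A : Set (Perm (Fin n))) (w : Perm (Fin n)) : Set (Perm (Fin n)) :=
  {t | t ∈ A ∧ length (t * w) < length w}

open Classical in
/-- The cell `K^f_w = {v | Des_A(v) = Des_A(w)}`, where `A = A_f`. -/
noncomputable def cell (f : Fin n → F) (w : Perm (Fin n)) : Finset (Perm (Fin n)) :=
  Finset.univ.filter
    (fun v => descents (unitReflections f) v = descents (unitReflections f) w)

/-- `T_K = {w s w⁻¹ | s ∈ S, w ∈ K, w s ∈ K}`. -/
def innerReflections (K : Finset (Perm (Fin n))) : Set (Perm (Fin n)) :=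
  {t | ∃ s w, IsSimple s ∧ w ∈ K ∧ w * s ∈ K ∧ t = w * s * w⁻¹}

/-- `T_∂K = {w s w⁻¹ | s ∈ S, w ∈ K, w s ∉ K}`. -/
def boundaryReflections (K : Finset (Perm (Fin n))) : Set (Perm (Fin n)) :=
  {t | ∃ s w, IsSimple s ∧ w ∈ K ∧ w * s ∉ K ∧ t = w * s * w⁻¹}

/-- `f` is `K`-generic (`K` being convex and containing the identity). For generators `s`, `t`,
the condition `m(s, t) = 3` says that `s t` has order `3`. -/
structure IsGeneric (K : Finset (Perm (Fin n))) (f : Fin n → F) : Prop where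
  one_mem : 1 ∈ K
  convex : IsConvexCell K
  inner : ∀ t ∈ innerReflections K,
    pairing f t ≠ 0 ∧ pairing f t ≠ 1 ∧ pairing f t ≠ -1
  boundary : ∀ t ∈ boundaryReflections K, pairing f t = 1 ∨ pairing f t = -1
  braid : ∀ w ∈ K, ∀ s t : Perm (Fin n), IsSimple s → IsSimple t → orderOf (s * t) = 3 →
    w * s ∉ K → w * t ∉ K → pairing f (w * s * w⁻¹) = pairing f (w * t * w⁻¹)

/-- `bUp`, `bDown` (the scalars `ḃ_t`, `b̈_t`) are a normalization for `f` on `K`: for `t ∈ T_K`,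
`ḃ_t b̈_t = (1 - ȧ_t) (1 - ä_t)` with `ȧ_t = 1 / ⟨f, α_t⟩` and `ä_t = - ȧ_t`.
The symmetric normalization is the case `ḃ = b̈`. -/
def IsNormalization (K : Finset (Perm (Fin n))) (f : Fin n → F)
    (bUp bDown : Perm (Fin n) → F) : Prop :=
  ∀ t ∈ innerReflections K,
    bUp t * bDown t = (1 - (pairing f t)⁻¹) * (1 - (-(pairing f t)⁻¹))

/-- `ρ` is the representation on `V_K` attached to `f` and to the normalization `bUp`, `bDown`:
with `t = w s w⁻¹` and `ȧ_t = 1 / ⟨f, α_t⟩`, it satisfies `ρ_s C_w = ȧ_t C_w + ḃ_t C_{ws}` if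
`ℓ(w) < ℓ(ws)` and `ρ_s C_w = - ȧ_t C_w + b̈_t C_{ws}` if `ℓ(w) > ℓ(ws)`. -/
def IsFunctionalRep (K : Finset (Perm (Fin n))) (f : Fin n → F) (bUp bDown : Perm (Fin n) → F)
    (ρ : Representation F (Perm (Fin n)) (K →₀ F)) : Prop :=
  ∀ s : Perm (Fin n), IsSimple s → ∀ w ∈ K,
    (length w < length (w * s) →
      ρ s (cellVec F K w) = (pairing f (w * s * w⁻¹))⁻¹ • cellVec F K w
        + bUp (w * s * w⁻¹) • cellVec F K (w * s)) ∧
    (length (w * s) < length w →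
      ρ s (cellVec F K w) = (-(pairing f (w * s * w⁻¹))⁻¹) • cellVec F K w
        + bDown (w * s * w⁻¹) • cellVec F K (w * s))

end Functional

/-! ### Skew tableaux and skew Specht modules -/

/-- The boxes `(row, column)` of the skew shape `lam / mu`. -/
def skewCells (lam mu : YoungDiagram) : Finset (ℕ × ℕ) := lam.cells \ mu.cells

/-- A tableau of shape `lam / mu`: a bijective filling of the boxes with the `n` letters. -/
abbrev SkewTableau (lam mu : YoungDiagram) (n : ℕ) := skewCells lam mu ≃ Fin n

section Tableaux

variable {lam mu : YoungDiagram} {n : ℕ}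

/-- The row of the box containing the letter `k`. -/
def SkewTableau.row (T : SkewTableau lam mu n) (k : Fin n) : ℕ := (T.symm k).1.1

/-- The column of the box containing the letter `k`. -/
def SkewTableau.col (T : SkewTableau lam mu n) (k : Fin n) : ℕ := (T.symm k).1.2

/-- Entries increase along rows and down columns. -/
def SkewTableau.IsStandard (T : SkewTableau lam mu n) : Prop :=
  (∀ c d : skewCells lam mu, c.1.1 = d.1.1 → c.1.2 < d.1.2 → T c < T d) ∧
  (∀ c d : skewCells lam mu, c.1.2 = d.1.2 → c.1.1 < d.1.1 → T c < T d)

/-- The content vector: column minus row of the box containing `k`. -/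
def SkewTableau.content (T : SkewTableau lam mu n) (k : Fin n) : ℤ :=
  (SkewTableau.col T k : ℤ) - (SkewTableau.row T k : ℤ)

end Tableaux

/-- `Δ v = Δ v'`, where `Δ v = (v_2 - v_1, …, v_n - v_{n-1})`. -/
def SameDerived {n : ℕ} (v v' : Fin n → ℤ) : Prop :=
  ∀ i j : Fin n, (j : ℕ) = (i : ℕ) + 1 → v j - v i = v' j - v' i

section Specht

variable (F : Type*) [Field F] (n : ℕ)

/-- The permutation representation of `S_n` on the free module over all row assignments
`r : {1, …, n} → ℕ`, via `(g r)(k) = r (g⁻¹ k)`. A tabloid (a tableau up to permuting entries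
within rows) is the same thing as the assignment of a row to every letter. -/
noncomputable def tabloidRep : Representation F (Perm (Fin n)) ((Fin n → ℕ) →₀ F) where
  toFun g := Finsupp.lmapDomain F F (fun r : Fin n → ℕ => fun k => r (g⁻¹ k))
  map_one' := by
    ext r : 2
    simp
  map_mul' g h := by
    ext r : 2
    simp [Finsupp.lmapDomain_apply, Finsupp.mapDomain_single]

variable {n} {lam mu : YoungDiagram}

open Classical in
/-- The column group `C_T`: the permutations preserving every column of `T`. -/
noncomputable def columnGroup (T : SkewTableau lam mu n) : Finset (Perm (Fin n)) :=
  Finset.univ.filter (fun g => ∀ k, SkewTableau.col T (g k) = SkewTableau.col T k)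

/-- The polytabloid `e_T = ∑_{g ∈ C_T} sgn(g) {g T}`, where `g T` has the letter `g k` in the box
in which `T` has the letter `k`. -/
noncomputable def polytabloid (T : SkewTableau lam mu n) : (Fin n → ℕ) →₀ F :=
  ∑ g ∈ columnGroup T,
    Finsupp.single (SkewTableau.row (T.trans g)) (((Perm.sign g : ℤˣ) : ℤ) : F)

theorem tabloidRep_polytabloid (h : Perm (Fin n)) (T : SkewTableau lam mu n) :
    tabloidRep F n h (polytabloid F T) = polytabloid F (T.trans h : SkewTableau lam mu n) := by
  classical
  unfold polytabloid
  rw [map_sum]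
  refine Finset.sum_bij (fun g _ => h * g * h⁻¹) ?_ ?_ ?_ ?_
  · intro g hg
    simp only [columnGroup, Finset.mem_filter, Finset.mem_univ, true_and] at hg ⊢
    intro k
    have := hg (h⁻¹ k)
    simpa [SkewTableau.col] using this
  · intro a _ b _ hab
    simpa using hab
  · intro b hb
    refine ⟨h⁻¹ * b * h, ?_, by group⟩
    simp only [columnGroup, Finset.mem_filter, Finset.mem_univ, true_and] at hb ⊢
    intro k
    have := hb (h k)
    simpa [SkewTableau.col] using this
  · intro g _
    simp only [tabloidRep, MonoidHom.coe_mk, OneHom.coe_mk, Finsupp.lmapDomain_apply,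
      Finsupp.mapDomain_single]
    congr 1
    · funext k
      change ((T.symm (g⁻¹ (h⁻¹ k))).1).1 = ((T.symm (h⁻¹ ((h * g * h⁻¹)⁻¹ k))).1).1
      simp
    · have hs : Perm.sign (h * g * h⁻¹) = Perm.sign g := by
        rw [map_mul, map_mul, Perm.sign_inv, mul_comm (Perm.sign h), mul_assoc,
          Int.units_mul_self, mul_one]
      rw [hs]

/-- The skew Specht module `S^{lam/mu}` as the span of all polytabloids. -/
noncomputable def spechtSub (n : ℕ) (lam mu : YoungDiagram) :
    Subrepresentation (tabloidRep F n) where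
  toSubmodule := Submodule.span F (Set.range (fun T : SkewTableau lam mu n => polytabloid F T))
  apply_mem_toSubmodule := by
    intro g v hv
    induction hv using Submodule.span_induction with
    | mem x hx =>
      obtain ⟨T, rfl⟩ := hx
      exact Submodule.subset_span ⟨T.trans g, (tabloidRep_polytabloid F g T).symm⟩
    | zero => simp
    | add x y _ _ hx hy => rw [map_add]; exact Submodule.add_mem _ hx hy
    | smul a x _ hx => rw [map_smul]; exact Submodule.smul_mem _ a hx

/-- The skew Specht module `S^{lam/mu}`, a representation of `S_n` (for `n = |lam/mu|`). -/
noncomputable def skewSpecht (n : ℕ) (lam mu : YoungDiagram) :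
    Representation F (Perm (Fin n)) (spechtSub F n lam mu).toSubmodule :=
  (spechtSub F n lam mu).toRepresentation

end Specht

end AbstractYoung

/-! A permutation `w` is read as a word, and right multiplication by an adjacent transposition
exchanges neighbours in it. If `f` comes from the contents of a standard tableau `Q`, letters with
`f`-values one apart sit on adjacent diagonals, where boxes are comparable. Hence the cell of the
identity consists of the `w` for which `Q.trans w⁻¹` is standard (`mem_cell_iff`), and the formulas
for the representation are Young's seminormal form in an arbitrary normalization.

The seminormal operators satisfy the Coxeter relations (`IsContentCell.satisfiesCoxeter`); the braid
relation comes down to `1/(x y) = (1/x + 1/y)/(x + y)`. The resulting pair is minimal because all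
edges inside the cell have nonzero coefficients and the cell is connected. To recognize the skew
Specht module, straightening shows that it is the universal module for the column and Garnir
relations, with the standard polytabloids as a basis. In a seminormal representation the vector of
the column reading tableau satisfies these relations (`garnir_columnReading`) and generates, so
comparing dimensions gives an isomorphism (`nonempty_equiv_skewSpecht`).

Conversely, minimality of a pair forces the leading coefficient of `g⁻¹` from `C_w` to `C_{wg}` to
be nonzero (`coord_inv_ne_zero`). So neighbours in one word that appear in the opposite order in
another word of `K` can be exchanged within `K`. Comparing coefficients in the Coxeter relations
then leaves equations for the diagonal coefficients alone (`IsYoungCell`). They force these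
coefficients to be inverse differences of values attached to the letters, or zero for letters of
different classes (`exists_values`). The values can be replaced by integers without changing where
the coefficients are `±1` (`exists_nat_values`). The resulting sequence is interlaced, which is what
makes it the content vector of a standard skew tableau (`exists_isStandard_content`), and the given
pair is seminormal for that shape.

For an irreducible representation, take a nonzero vector that alternates along a colouring of the
letters with lexicographically largest class sizes. Maximality sorts the classes into the columns of
a straight shape and yields the Garnir relations (`IsMaximalColouring.garnir`), hence a nonzero map
from a Specht module. The latter is irreducible because its contents are Jucys-Murphy eigenvalues
that separate the standard tableaux (`eq_top_of_invariant`). -/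

namespace AbstractYoung

open Equiv

/-! ### Length of permutations -/

section Length

variable {n : ℕ}

/-- The set of inversions, as pairs of positions. -/
def inversions (w : Perm (Fin n)) : Finset (Fin n × Fin n) :=
  Finset.univ.filter (fun p : Fin n × Fin n => p.1 < p.2 ∧ w p.2 < w p.1)

theorem mem_inversions {w : Perm (Fin n)} {p : Fin n × Fin n} :
    p ∈ inversions w ↔ p.1 < p.2 ∧ w p.2 < w p.1 := by
  simp [inversions]

theorem length_eq_card (w : Perm (Fin n)) : length w = (inversions w).card := rfl

theorem length_one : length (1 : Perm (Fin n)) = 0 := by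
  rw [length_eq_card, Finset.card_eq_zero, Finset.eq_empty_iff_forall_notMem]
  intro p hp
  rw [mem_inversions] at hp
  exact lt_asymm hp.1 hp.2

theorem length_inv (w : Perm (Fin n)) : length w⁻¹ = length w := by
  rw [length_eq_card, length_eq_card]
  refine Finset.card_bij' (fun p _ => (w⁻¹ p.2, w⁻¹ p.1)) (fun p _ => (w p.2, w p.1)) ?_ ?_ ?_ ?_
  · intro p hp
    rw [mem_inversions] at hp ⊢
    simpa using ⟨hp.2, hp.1⟩
  · intro p hp
    rw [mem_inversions] at hp ⊢
    simpa using ⟨hp.2, hp.1⟩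
  · intro p _
    simp
  · intro p _
    simp

/-- The inversions of `u` inject into those of `u * swap i j` without meeting the new inversion `(i,
j)`. -/
theorem length_lt_mul_swap {u : Perm (Fin n)} {i j : Fin n} (hij : i < j) (hu : u i < u j) :
    length u < length (u * swap i j) := by
  rw [length_eq_card, length_eq_card]
  set t : Perm (Fin n) := swap i j with ht
  have hti : t i = j := by simp [ht]
  have htj : t j = i := by simp [ht]
  have hto : ∀ k, k ≠ i → k ≠ j → t k = k := fun k h1 h2 => swap_apply_of_ne_of_ne h1 h2
  have htt : ∀ k, t (t k) = k := by simp [ht]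
  -- A pair of positions is moved by `t` when that keeps it increasing; otherwise it remains an
  -- inversion where it is.
  let φ : Fin n × Fin n → Fin n × Fin n := fun p => if t p.1 < t p.2 then (t p.1, t p.2) else p
  have hmaps : ∀ p ∈ inversions u, φ p ∈ (inversions (u * t)).erase (i, j) := by
    rintro ⟨p, q⟩ hp
    rw [mem_inversions] at hp
    obtain ⟨hpq, hinv⟩ := hp
    simp only at hpq hinv
    have hne : ¬ (p = i ∧ q = j) := by
      rintro ⟨rfl, rfl⟩
      exact lt_asymm hinv hu
    rw [Finset.mem_erase, mem_inversions]
    by_cases hlt : t p < t q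
    · simp only [φ, hlt, if_true, Perm.mul_apply, htt]
      refine ⟨?_, trivial, hinv⟩
      intro h
      rw [Prod.mk.injEq] at h
      have hp : p = j := by rw [← htt p, h.1, hti]
      have hq : q = i := by rw [← htt q, h.2, htj]
      subst hp hq
      exact lt_asymm hpq hij
    · simp only [φ, hlt, if_false, Perm.mul_apply]
      refine ⟨by simpa [Prod.ext_iff] using hne, hpq, ?_⟩
      by_cases hpi : p = i
      · subst hpi
        by_cases hqj : q = j
        · exact absurd ⟨rfl, hqj⟩ hne
        · rw [hto q hpq.ne' hqj, hti]
          exact hinv.trans hu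
      · by_cases hqj : q = j
        · subst hqj
          rw [htj, hto p hpi hpq.ne]
          exact hu.trans hinv
        · by_cases hpj : p = j
          · subst hpj
            rw [htj, hto q (hij.trans hpq).ne' hqj] at hlt
            exact absurd (hij.trans hpq) hlt
          · by_cases hqi : q = i
            · subst hqi
              rw [hti, hto p hpi hpj] at hlt
              exact absurd (hpq.trans hij) hlt
            · rw [hto p hpi hpj, hto q hqi hqj] at hlt
              exact absurd hpq hlt
  have hinj : Set.InjOn φ (inversions u : Set (Fin n × Fin n)) := by
    rintro ⟨p, q⟩ hp ⟨p', q'⟩ hp' h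
    rw [Finset.mem_coe, mem_inversions] at hp hp'
    simp only at hp hp'
    simp only [φ] at h
    split_ifs at h with h1 h2 h2
    · simpa using h
    · rw [Prod.mk.injEq] at h
      rw [← h.1, ← h.2, htt, htt] at h2
      exact absurd hp.1 h2
    · rw [Prod.mk.injEq] at h
      rw [h.1, h.2, htt, htt] at h1
      exact absurd hp'.1 h1
    · exact h
  have hmem : (i, j) ∈ inversions (u * t) := by
    rw [mem_inversions]
    simpa [hti, htj] using ⟨hij, hu⟩
  calc (inversions u).card ≤ ((inversions (u * t)).erase (i, j)).card :=
        Finset.card_le_card_of_injOn φ hmaps hinj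
    _ < (inversions (u * t)).card := Finset.card_erase_lt_of_mem hmem

theorem length_mul_swap_lt {u : Perm (Fin n)} {i j : Fin n} (hij : i < j) (hu : u j < u i) :
    length (u * swap i j) < length u := by
  have h := length_lt_mul_swap (u := u * swap i j) hij (by simpa using hu)
  simpa [mul_assoc] using h

theorem length_lt_mul_swap_iff {u : Perm (Fin n)} {i j : Fin n} (hij : i < j) :
    length u < length (u * swap i j) ↔ u i < u j := by
  refine ⟨fun h => ?_, length_lt_mul_swap hij⟩
  by_contra hu
  exact lt_asymm h (length_mul_swap_lt hij
    (lt_of_le_of_ne (not_lt.1 hu) (fun h => hij.ne' (u.injective h))))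

theorem length_mul_swap_lt_iff {u : Perm (Fin n)} {i j : Fin n} (hij : i < j) :
    length (u * swap i j) < length u ↔ u j < u i := by
  refine ⟨fun h => ?_, length_mul_swap_lt hij⟩
  by_contra hu
  exact lt_asymm h (length_lt_mul_swap hij
    (lt_of_le_of_ne (not_lt.1 hu) (fun h => hij.ne (u.injective h))))

/-- Left multiplication by a transposition shortens `v` iff it exchanges two values that occur in
the wrong order in the word of `v`. -/
theorem length_swap_mul_lt_iff {v : Perm (Fin n)} {i j : Fin n} (hij : i < j) :
    length (swap i j * v) < length v ↔ v⁻¹ j < v⁻¹ i := by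
  rw [← length_inv (swap i j * v), ← length_inv v, mul_inv_rev, swap_inv,
    length_mul_swap_lt_iff hij]

/-- An adjacent transposition preserves the order of every pair of positions but `(i, j)`, so after
erasing that pair the inversions inject back into those of `u`. -/
theorem length_mul_swap_adjacent {u : Perm (Fin n)} {i j : Fin n} (hij : (j : ℕ) = i + 1)
    (hu : u i < u j) : length (u * swap i j) = length u + 1 := by
  have hlt : i < j := by rw [Fin.lt_def]; omega
  refine le_antisymm ?_ (length_lt_mul_swap hlt hu)
  rw [length_eq_card, length_eq_card]
  set t : Perm (Fin n) := swap i j with ht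
  have hti : t i = j := by simp [ht]
  have htj : t j = i := by simp [ht]
  have hto : ∀ k, k ≠ i → k ≠ j → t k = k := fun k h1 h2 => swap_apply_of_ne_of_ne h1 h2
  have hle : ((inversions (u * t)).erase (i, j)).card ≤ (inversions u).card := by
    refine Finset.card_le_card_of_injOn (fun p => (t p.1, t p.2)) ?_ ?_
    · rintro ⟨p, q⟩ hp
      rw [Finset.mem_coe, Finset.mem_erase, mem_inversions] at hp
      obtain ⟨hne, hpq, hinv⟩ := hp
      rw [Finset.mem_coe, mem_inversions]
      refine ⟨?_, hinv⟩
      simp only at hpq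
      change t p < t q
      have hne' : ¬ (p = i ∧ q = j) := by simpa [Prod.ext_iff] using hne
      by_cases hpi : p = i
      · have hqj : q ≠ j := fun h => hne' ⟨hpi, h⟩
        have hqi : q ≠ i := by rw [← hpi]; exact hpq.ne'
        rw [hpi, hti, hto q hqi hqj]
        rw [Fin.lt_def] at *
        have : (q : ℕ) ≠ j := fun h => hqj (Fin.ext h)
        subst hpi
        omega
      · by_cases hpj : p = j
        · have hqj : q ≠ j := by rw [← hpj]; exact hpq.ne'
          have hqi : q ≠ i := by
            intro h
            subst h hpj
            exact lt_asymm hpq hlt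
          rw [hpj, htj, hto q hqi hqj]
          subst hpj
          exact hlt.trans hpq
        · rw [hto p hpi hpj]
          by_cases hqi : q = i
          · subst hqi
            rw [hti]
            exact hpq.trans hlt
          · by_cases hqj : q = j
            · subst hqj
              rw [htj]
              have : (p : ℕ) ≠ i := fun h => hpi (Fin.ext h)
              rw [Fin.lt_def] at *
              omega
            · rwa [hto q hqi hqj]
    · intro a _ b _ h
      simpa [Prod.ext_iff] using h
  have := Finset.pred_card_le_card_erase (s := inversions (u * t)) (a := (i, j))
  omega

theorem length_mul_swap_adjacent_of_gt {u : Perm (Fin n)} {i j : Fin n} (hij : (j : ℕ) = i + 1)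
    (hu : u j < u i) : length u = length (u * swap i j) + 1 := by
  have h := length_mul_swap_adjacent (u := u * swap i j) hij (by simpa using hu)
  simpa [mul_assoc] using h

/-- A map that increases at every step of `Fin n` is strictly monotone. -/
theorem strictMono_of_adjacent {α : Type*} [Preorder α] {f : Fin n → α}
    (h : ∀ i j : Fin n, (j : ℕ) = i + 1 → f i < f j) : StrictMono f := by
  have key : ∀ (d : ℕ) (i j : Fin n), (j : ℕ) = i + d + 1 → f i < f j := by
    intro d
    induction d with
    | zero => intro i j hij; exact h i j hij
    | succ d ih =>
      intro i j hij
      have hk : (i : ℕ) + d + 1 < n := by omega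
      exact (ih i ⟨i + d + 1, hk⟩ rfl).trans (h ⟨i + d + 1, hk⟩ j (by simp; omega))
  intro i j hij
  rw [Fin.lt_def] at hij
  exact key (j - i - 1) i j (by omega)

theorem perm_eq_one_of_strictMono {u : Perm (Fin n)} (h : StrictMono u) : u = 1 := by
  have hid : (u : Fin n → Fin n) = id := by
    -- A finite linear order has only one order automorphism.
    have h1 := Subsingleton.elim (StrictMono.orderIsoOfSurjective u h u.surjective)
      (OrderIso.refl (Fin n))
    funext k
    exact congrArg (fun e : Fin n ≃o Fin n => e k) h1
  ext k
  simp [hid]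

theorem exists_descent {u : Perm (Fin n)} (hu : u ≠ 1) :
    ∃ i j : Fin n, (j : ℕ) = i + 1 ∧ u j < u i := by
  by_contra hcon
  push Not at hcon
  refine hu (perm_eq_one_of_strictMono (strictMono_of_adjacent ?_))
  intro i j hij
  refine lt_of_le_of_ne (hcon i j hij) (fun h => ?_)
  have := u.injective h
  subst this
  omega

/-- Induction on permutations along right descents. -/
@[elab_as_elim]
theorem descent_induction {motive : Perm (Fin n) → Prop} (u : Perm (Fin n)) (one : motive 1)
    (step : ∀ (u : Perm (Fin n)) (i j : Fin n), (j : ℕ) = i + 1 → u j < u i →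
      motive (u * swap i j) → motive u) : motive u := by
  induction hl : length u using Nat.strong_induction_on generalizing u with
  | _ l ih =>
    by_cases hu : u = 1
    · rwa [hu]
    · obtain ⟨i, j, hij, hd⟩ := exists_descent hu
      have hlt := length_mul_swap_adjacent_of_gt hij hd
      exact step u i j hij hd (ih _ (by omega) _ rfl)

theorem isSimple_swap {i j : Fin n} (hij : (j : ℕ) = i + 1) : IsSimple (swap i j) :=
  ⟨i, j, hij, rfl⟩

/-- Every permutation is a product of adjacent transpositions. -/
@[elab_as_elim]
theorem simple_induction {motive : Perm (Fin n) → Prop} (u : Perm (Fin n)) (one : motive 1)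
    (step : ∀ (u : Perm (Fin n)) (i j : Fin n), (j : ℕ) = i + 1 →
      motive u → motive (u * swap i j)) : motive u := by
  refine descent_induction u one ?_
  intro u i j hij _ h
  simpa [mul_assoc] using step _ i j hij h

/-- The ordered pairs of values that occur in this order in the word of `w` and in the other order
in the word of `u`. -/
def discordant (u w : Perm (Fin n)) : Finset (Fin n × Fin n) :=
  Finset.univ.filter (fun p : Fin n × Fin n => w⁻¹ p.1 < w⁻¹ p.2 ∧ u⁻¹ p.2 < u⁻¹ p.1)

/-- The distance of two words counts the pairs of letters on whose order they disagree, so geodesics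
become statements about order. -/
theorem length_inv_mul (u w : Perm (Fin n)) : length (u⁻¹ * w) = (discordant u w).card := by
  rw [length_eq_card]
  refine Finset.card_bij' (fun p _ => (w p.1, w p.2)) (fun p _ => (w⁻¹ p.1, w⁻¹ p.2)) ?_ ?_ ?_ ?_
  · intro p hp
    rw [mem_inversions] at hp
    simpa [discordant] using hp
  · intro p hp
    rw [mem_inversions]
    simpa [discordant] using hp
  · intro p _
    simp
  · intro p _
    simp

/-- If `w` lies on a geodesic from `u` to `v`, then a pair of values on whose order `u` and `v`
agree occurs in the same order in `w`. -/
theorem inv_lt_of_geodesic {u v w : Perm (Fin n)}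
    (h : length (u⁻¹ * w) + length (w⁻¹ * v) = length (u⁻¹ * v)) {x y : Fin n}
    (hu : u⁻¹ x < u⁻¹ y) (hv : v⁻¹ x < v⁻¹ y) : w⁻¹ x < w⁻¹ y := by
  rw [length_inv_mul, length_inv_mul, length_inv_mul] at h
  by_contra hw
  have hne : x ≠ y := fun h => by subst h; exact lt_irrefl _ hu
  have hw' : w⁻¹ y < w⁻¹ x :=
    lt_of_le_of_ne (not_lt.1 hw) (fun h => hne (w⁻¹.injective h).symm)
  -- The disagreements of `u` and `v` are covered by those of `u`, `w` and of `w`, `v`. The pair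
  -- `(y, x)` lies in the cover without being needed, so the triangle inequality is strict, against
  -- `h`.
  have hsub : discordant u v ⊆ ((discordant u w) ∪ (discordant w v)).erase (y, x) := by
    rintro ⟨a, b⟩ hp
    simp only [discordant, Finset.mem_filter, Finset.mem_univ, true_and, Finset.mem_union,
      Finset.mem_erase] at hp ⊢
    refine ⟨?_, ?_⟩
    · rintro h
      rw [Prod.mk.injEq] at h
      obtain ⟨rfl, rfl⟩ := h
      exact lt_asymm hv hp.1
    · rcases lt_trichotomy (w⁻¹ a) (w⁻¹ b) with hab | hab | hab
      · exact Or.inl ⟨hab, hp.2⟩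
      · have := w⁻¹.injective hab
        subst this
        exact absurd hp.1 (lt_irrefl _)
      · exact Or.inr ⟨hp.1, hab⟩
  have hmem : (y, x) ∈ (discordant u w) ∪ (discordant w v) := by
    exact Finset.mem_union_left _ (Finset.mem_filter.2 ⟨Finset.mem_univ _, hw', hu⟩)
  have h1 := Finset.card_le_card hsub
  rw [Finset.card_erase_of_mem hmem] at h1
  have h2 := Finset.card_union_le (discordant u w) (discordant w v)
  have h3 : 0 < ((discordant u w) ∪ (discordant w v)).card := Finset.card_pos.2 ⟨_, hmem⟩
  omega

end Length

end AbstractYoung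

namespace AbstractYoung

open Equiv

/-! ### Combinatorics of skew tableaux -/

section TableauCombinatorics

variable {lam mu : YoungDiagram} {n : ℕ}

theorem mem_skewCells {x : ℕ × ℕ} : x ∈ skewCells lam mu ↔ x ∈ lam ∧ x ∉ mu := by
  simp [skewCells]

/-- Skew shapes are convex for the componentwise order. -/
theorem mem_skewCells_of_between {p q x : ℕ × ℕ} (hp : p ∈ skewCells lam mu)
    (hq : q ∈ skewCells lam mu) (h1 : p ≤ x) (h2 : x ≤ q) : x ∈ skewCells lam mu := by
  rw [mem_skewCells] at *
  exact ⟨lam.isLowerSet h2 hq.1, fun hx => hp.2 (mu.isLowerSet h1 hx)⟩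

namespace SkewTableau

variable (T : SkewTableau lam mu n)

theorem row_trans (g : Perm (Fin n)) (k : Fin n) :
    row (T.trans g : SkewTableau lam mu n) k = row T (g⁻¹ k) := rfl

theorem col_trans (g : Perm (Fin n)) (k : Fin n) :
    col (T.trans g : SkewTableau lam mu n) k = col T (g⁻¹ k) := rfl

theorem trans_trans (g h : Perm (Fin n)) :
    ((T.trans g : SkewTableau lam mu n).trans h : SkewTableau lam mu n) = T.trans (h * g) := rfl

theorem trans_one : (T.trans (1 : Perm (Fin n)) : SkewTableau lam mu n) = T := rfl

theorem trans_cancel (T' : SkewTableau lam mu n) :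
    (T.trans (T.symm.trans T' : Perm (Fin n)) : SkewTableau lam mu n) = T' := by
  ext x
  simp

theorem box_mem (k : Fin n) : (row T k, col T k) ∈ skewCells lam mu := (T.symm k).2

variable {T}

theorem box_injective {k l : Fin n} (hr : row T k = row T l) (hc : col T k = col T l) :
    k = l := by
  apply T.symm.injective
  apply Subtype.ext
  exact Prod.ext hr hc

variable (T) in
theorem exists_letter {r c : ℕ} (h : (r, c) ∈ skewCells lam mu) :
    ∃ k, row T k = r ∧ col T k = c :=
  ⟨T ⟨(r, c), h⟩, by simp [row], by simp [col]⟩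

theorem ext_of_box {T' : SkewTableau lam mu n} (hr : ∀ k, row T k = row T' k)
    (hc : ∀ k, col T k = col T' k) : T = T' := by
  have : T.symm = T'.symm := by
    ext k : 1
    exact Subtype.ext (Prod.ext (hr k) (hc k))
  rw [← T.symm_symm, this, T'.symm_symm]

theorem isStandard_iff : IsStandard T ↔
    (∀ k l, row T k = row T l → col T k < col T l → k < l) ∧
    (∀ k l, col T k = col T l → row T k < row T l → k < l) := by
  constructor
  · rintro ⟨h1, h2⟩
    exact ⟨fun k l hr hc => by simpa using h1 (T.symm k) (T.symm l) hr hc,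
      fun k l hr hc => by simpa using h2 (T.symm k) (T.symm l) hr hc⟩
  · rintro ⟨h1, h2⟩
    exact ⟨fun c d hr hc => h1 (T c) (T d) (by simpa [row] using hr) (by simpa [col] using hc),
      fun c d hr hc => h2 (T c) (T d) (by simpa [col] using hr) (by simpa [row] using hc)⟩

/-- Skew shapes are convex, so rows and columns have no gaps and comparisons of neighbouring boxes
chain up. -/
theorem isStandard_of_adjacent
    (h1 : ∀ k l, row T k = row T l → col T l = col T k + 1 → k < l)
    (h2 : ∀ k l, col T k = col T l → row T l = row T k + 1 → k < l) : IsStandard T := by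
  rw [isStandard_iff]
  constructor
  · have key : ∀ (d : ℕ) (k l : Fin n), row T k = row T l → col T l = col T k + d + 1 → k < l := by
      intro d
      induction d with
      | zero => exact fun k l hr hc => h1 k l hr hc
      | succ d ih =>
        intro k l hr hc
        have hm : (row T k, col T k + d + 1) ∈ skewCells lam mu :=
          mem_skewCells_of_between (box_mem T k) (box_mem T l)
            ⟨le_rfl, by simp; omega⟩ ⟨hr.le, by simp; omega⟩
        obtain ⟨m, hmr, hmc⟩ := exists_letter T hm
        exact (ih k m hmr.symm hmc).trans (h1 m l (hmr.trans hr) (by omega))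
    intro k l hr hc
    exact key (col T l - col T k - 1) k l hr (by omega)
  · have key : ∀ (d : ℕ) (k l : Fin n), col T k = col T l → row T l = row T k + d + 1 → k < l := by
      intro d
      induction d with
      | zero => exact fun k l hr hc => h2 k l hr hc
      | succ d ih =>
        intro k l hr hc
        have hm : (row T k + d + 1, col T k) ∈ skewCells lam mu :=
          mem_skewCells_of_between (box_mem T k) (box_mem T l)
            ⟨by simp; omega, le_rfl⟩ ⟨by simp; omega, hr.le⟩
        obtain ⟨m, hmr, hmc⟩ := exists_letter T hm
        exact (ih k m hmc.symm hmr).trans (h2 m l (hmc.trans hr) (by omega))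
    intro k l hr hc
    exact key (row T l - row T k - 1) k l hr (by omega)

/-- In a standard tableau entries increase weakly to the south-east. -/
theorem IsStandard.lt_of_box_le (hT : IsStandard T) {k l : Fin n} (hr : row T k ≤ row T l)
    (hc : col T k ≤ col T l) (hne : k ≠ l) : k < l := by
  rw [isStandard_iff] at hT
  obtain ⟨m, hmr, hmc⟩ := exists_letter T (r := row T k) (c := col T l)
    (mem_skewCells_of_between (box_mem T k) (box_mem T l) ⟨le_rfl, hc⟩ ⟨hr, le_rfl⟩)
  have h1 : k ≤ m := by
    rcases hc.eq_or_lt with h | h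
    · exact (box_injective hmr.symm (h.trans hmc.symm)).le
    · exact (hT.1 k m hmr.symm (by omega)).le
  have h2 : m ≤ l := by
    rcases hr.eq_or_lt with h | h
    · exact (box_injective (hmr.trans h) hmc).le
    · exact (hT.2 m l hmc (by omega)).le
  exact lt_of_le_of_ne (h1.trans h2) hne

/-- A box strictly between those of two consecutive letters of a row would need a letter strictly
between them. -/
theorem IsStandard.col_succ (hT : IsStandard T) {i j : Fin n} (hij : (j : ℕ) = i + 1)
    (hr : row T i = row T j) : col T j = col T i + 1 := by
  have hlt : i < j := by rw [Fin.lt_def]; omega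
  have hc : col T i < col T j := by
    by_contra hc
    exact lt_asymm hlt (hT.lt_of_box_le hr.ge (not_lt.1 hc) hlt.ne')
  by_contra hne
  obtain ⟨m, hmr, hmc⟩ := exists_letter T (r := row T i) (c := col T i + 1)
    (mem_skewCells_of_between (box_mem T i) (box_mem T j) ⟨le_rfl, by simp⟩ ⟨hr.le, hc⟩)
  rw [isStandard_iff] at hT
  have h1 := hT.1 i m hmr.symm (by omega)
  have h2 := hT.1 m j (hmr.trans hr) (by omega)
  rw [Fin.lt_def] at h1 h2
  omega

theorem IsStandard.row_succ (hT : IsStandard T) {i j : Fin n} (hij : (j : ℕ) = i + 1)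
    (hc : col T i = col T j) : row T j = row T i + 1 := by
  have hlt : i < j := by rw [Fin.lt_def]; omega
  have hr : row T i < row T j := by
    by_contra hr
    exact lt_asymm hlt (hT.lt_of_box_le (not_lt.1 hr) hc.ge hlt.ne')
  by_contra hne
  obtain ⟨m, hmr, hmc⟩ := exists_letter T (r := row T i + 1) (c := col T i)
    (mem_skewCells_of_between (box_mem T i) (box_mem T j) ⟨by simp, le_rfl⟩ ⟨hr, hc.le⟩)
  rw [isStandard_iff] at hT
  have h1 := hT.2 i m hmc.symm (by omega)
  have h2 := hT.2 m j (hmc.trans hc) (by omega)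
  rw [Fin.lt_def] at h1 h2
  omega

/-- An adjacent transposition preserves the order of all pairs but one. -/
theorem _root_.AbstractYoung.swap_lt_swap_of_adjacent {i j k l : Fin n} (hij : (j : ℕ) = i + 1)
    (hkl : k < l) (hne : ¬ (k = i ∧ l = j)) : swap i j k < swap i j l := by
  rw [Fin.lt_def] at *
  have e1 : ∀ m : Fin n, m ≠ i → (m : ℕ) ≠ i := fun m h h' => h (Fin.ext h')
  have e2 : ∀ m : Fin n, m ≠ j → (m : ℕ) ≠ j := fun m h h' => h (Fin.ext h')
  by_cases hki : k = i
  · subst hki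
    have hlj : l ≠ j := fun h => hne ⟨rfl, h⟩
    have hlk : l ≠ k := fun h => by subst h; omega
    rw [swap_apply_left, swap_apply_of_ne_of_ne hlk hlj]
    have := e2 l hlj
    omega
  · by_cases hkj : k = j
    · subst hkj
      have hlk : l ≠ k := fun h => by subst h; omega
      have hli : l ≠ i := fun h => by subst h; omega
      rw [swap_apply_right, swap_apply_of_ne_of_ne hli hlk]
      omega
    · rw [swap_apply_of_ne_of_ne hki hkj]
      by_cases hli : l = i
      · subst hli
        rw [swap_apply_left]
        omega
      · by_cases hlj : l = j
        · subst hlj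
          rw [swap_apply_right]
          have := e1 k hki
          omega
        · rwa [swap_apply_of_ne_of_ne hli hlj]

/-- The exchange alters only the comparison of `i` with `j`, and standardness does not compare boxes
in different rows and columns. -/
theorem IsStandard.trans_swap (hT : IsStandard T) {i j : Fin n} (hij : (j : ℕ) = i + 1)
    (hr : row T i ≠ row T j) (hc : col T i ≠ col T j) :
    IsStandard (T.trans (swap i j) : SkewTableau lam mu n) := by
  rw [isStandard_iff] at hT ⊢
  simp only [row_trans, col_trans, swap_inv]
  constructor
  · intro k l h1 h2
    have := swap_lt_swap_of_adjacent hij (hT.1 _ _ h1 h2) (by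
      rintro ⟨e1, e2⟩
      rw [e1, e2] at h1
      exact hr h1)
    simpa using this
  · intro k l h1 h2
    have := swap_lt_swap_of_adjacent hij (hT.2 _ _ h1 h2) (by
      rintro ⟨e1, e2⟩
      rw [e1, e2] at h1
      exact hc h1)
    simpa using this

theorem IsStandard.ne_of_trans_swap (hT : IsStandard T) {i j : Fin n} (hij : (j : ℕ) = i + 1)
    (hT' : IsStandard (T.trans (swap i j) : SkewTableau lam mu n)) :
    row T i ≠ row T j ∧ col T i ≠ col T j := by
  have hlt : i < j := by rw [Fin.lt_def]; omega
  constructor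
  · intro h
    have h2 := hT'.col_succ hij (by simpa [row_trans] using h.symm)
    have h1 := hT.col_succ hij h
    simp only [col_trans, swap_inv, swap_apply_left, swap_apply_right] at h2
    omega
  · intro h
    have h2 := hT'.row_succ hij (by simpa [col_trans] using h.symm)
    have h1 := hT.row_succ hij h
    simp only [row_trans, swap_inv, swap_apply_left, swap_apply_right] at h2
    omega

/-- A standard tableau is determined by its rows. -/
theorem IsStandard.eq_of_row_eq {T' : SkewTableau lam mu n} (hT : IsStandard T)
    (hT' : IsStandard T') (h : ∀ k, row T k = row T' k) : T = T' := by
  refine ext_of_box h ?_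
  -- If the columns first differ at `k`, the box of `k` in the tableau with the smaller column holds
  -- a smaller letter of the other tableau. By induction that letter occupies the same box in both,
  -- which collides with `k`.
  have aux : ∀ (T T' : SkewTableau lam mu n), IsStandard T' → (∀ k, row T k = row T' k) →
      ∀ k, (∀ l, l < k → col T l = col T' l) → ¬ col T k < col T' k := by
    intro T T' hT' h k ih hlt
    obtain ⟨l, hlr, hlc⟩ := exists_letter T' (r := row T k) (c := col T k) (box_mem T k)
    rw [isStandard_iff] at hT'
    have hlk := hT'.1 l k (by rw [hlr, h]) (by omega)
    exact hlk.ne (box_injective (T := T) (by rw [h, hlr]) (by rw [ih l hlk, hlc]))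
  intro k
  induction k using WellFoundedLT.induction with
  | _ k ih =>
    exact le_antisymm
      (not_lt.1 (aux T' T hT (fun k => (h k).symm) k (fun l hl => (ih l hl).symm)))
      (not_lt.1 (aux T T' hT' h k ih))

/-- There is a tableau whose letters are read column by column. -/
theorem exists_columnReading (h : (skewCells lam mu).card = n) :
    ∃ T : SkewTableau lam mu n, ∀ i j, i < j →
      col T i < col T j ∨ (col T i = col T j ∧ row T i < row T j) := by
  let key : skewCells lam mu → ℕ ×ₗ ℕ := fun x => toLex (x.1.2, x.1.1)
  have hkey : Function.Injective key := by
    intro x y hxy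
    have := toLex.injective hxy
    rw [Prod.mk.injEq] at this
    exact Subtype.ext (Prod.ext this.2 this.1)
  have hs : (Finset.univ.image key).card = n := by
    rw [Finset.card_image_of_injective _ hkey, Finset.card_univ, Fintype.card_coe, h]
  let e := (Finset.univ.image key).orderEmbOfFin hs
  have hmem : ∀ i, ∃ x, key x = e i := by
    intro i
    obtain ⟨x, _, hx⟩ := Finset.mem_image.1 (Finset.orderEmbOfFin_mem (Finset.univ.image key) hs i)
    exact ⟨x, hx⟩
  choose b hb using hmem
  have hinj : Function.Injective b := by
    intro i j hij
    apply e.injective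
    rw [← hb, ← hb, hij]
  have hbij : Function.Bijective b := by
    rw [Fintype.bijective_iff_injective_and_card]
    exact ⟨hinj, by rw [Fintype.card_fin, Fintype.card_coe, h]⟩
  refine ⟨(Equiv.ofBijective b hbij).symm, fun i j hij => ?_⟩
  have h1 : key (b i) < key (b j) := by
    rw [hb, hb]
    exact e.strictMono hij
  exact Prod.Lex.lt_iff.1 h1

theorem isStandard_of_columnReading
    (h : ∀ i j, i < j → col T i < col T j ∨ (col T i = col T j ∧ row T i < row T j)) :
    IsStandard T := by
  rw [isStandard_iff]
  constructor
  · intro k l hr hc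
    rcases lt_trichotomy k l with h1 | h1 | h1
    · exact h1
    · subst h1; omega
    · have := h _ _ h1; omega
  · intro k l hr hc
    rcases lt_trichotomy k l with h1 | h1 | h1
    · exact h1
    · subst h1; omega
    · have := h _ _ h1; omega

end SkewTableau

open SkewTableau

theorem mem_columnGroup {T : SkewTableau lam mu n} {g : Perm (Fin n)} :
    g ∈ columnGroup T ↔ ∀ k, col T (g k) = col T k := by
  simp [columnGroup]

theorem col_inv_of_mem_columnGroup {T : SkewTableau lam mu n} {g : Perm (Fin n)}
    (hg : g ∈ columnGroup T) (k : Fin n) : col T (g⁻¹ k) = col T k := by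
  rw [mem_columnGroup] at hg
  simpa using (hg (g⁻¹ k)).symm

theorem one_mem_columnGroup (T : SkewTableau lam mu n) : 1 ∈ columnGroup T := by
  simp [mem_columnGroup]

/-- The effect of a transposition on a pairing of two sequences. -/
theorem sum_mul_swap (A B : Fin n → ℤ) {k l : Fin n} (hkl : k ≠ l) :
    ∑ m, A m * B (swap k l m) = ∑ m, A m * B m + (A k - A l) * (B l - B k) := by
  have h : ∑ m, (A m * B (swap k l m) - A m * B m) = (A k - A l) * (B l - B k) := by
    rw [Finset.sum_eq_add k l hkl]
    · rw [swap_apply_left, swap_apply_right]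
      ring
    · intro m _ hm
      rw [swap_apply_of_ne_of_ne hm.1 hm.2, sub_self]
    · simp
    · simp
  rw [Finset.sum_sub_distrib] at h
  linarith

/-- Entries increase strictly down the columns. -/
def ColumnStrict (T : SkewTableau lam mu n) : Prop :=
  ∀ k l, col T k = col T l → row T k < row T l → k < l

/-- In the orbit of the column group a maximum of `∑ k * row k` is column strict: exchanging two
letters of a column that are in the wrong order would increase the sum. -/
theorem exists_columnStrict (T : SkewTableau lam mu n) :
    ∃ g ∈ columnGroup T, ColumnStrict (T.trans g : SkewTableau lam mu n) := by
  obtain ⟨g, hg, hmax⟩ := Finset.exists_max_image (columnGroup T)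
    (fun g => ∑ k : Fin n, (k : ℤ) * (row (T.trans g : SkewTableau lam mu n) k : ℤ))
    ⟨1, one_mem_columnGroup T⟩
  refine ⟨g, hg, fun k l hc hr => ?_⟩
  by_contra hkl
  have hne : k ≠ l := fun h => by subst h; exact lt_irrefl _ hr
  have hlk : l < k := lt_of_le_of_ne (not_lt.1 hkl) hne.symm
  rw [col_trans, col_trans, col_inv_of_mem_columnGroup hg, col_inv_of_mem_columnGroup hg] at hc
  have hs : swap k l * g ∈ columnGroup T := by
    rw [mem_columnGroup] at hg ⊢
    intro m
    rw [Perm.mul_apply, ← hg m]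
    rcases eq_or_ne (g m) k with h | h
    · rw [h, swap_apply_left, hc]
    · rcases eq_or_ne (g m) l with h' | h'
      · rw [h', swap_apply_right, hc]
      · rw [swap_apply_of_ne_of_ne h h']
  have h := hmax _ hs
  have h2 := sum_mul_swap (fun m : Fin n => (m : ℤ))
    (fun m => (row (T.trans g : SkewTableau lam mu n) m : ℤ)) hne
  have h3 : ∀ m, row (T.trans (swap k l * g) : SkewTableau lam mu n) m =
      row (T.trans g : SkewTableau lam mu n) (swap k l m) := by
    intro m
    rw [row_trans, row_trans, mul_inv_rev, swap_inv, Perm.mul_apply]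
  simp only [h3] at h
  rw [h2] at h
  have h4 : (0 : ℤ) < ((k : ℤ) - (l : ℤ)) * ((row (T.trans g : SkewTableau lam mu n) l : ℤ)
      - (row (T.trans g : SkewTableau lam mu n) k : ℤ)) := by
    rw [Fin.lt_def] at hlk
    exact mul_pos (by omega) (by omega)
  linarith

/-- The letters of the Garnir belt at the boxes `(r, c)`, `(r, c + 1)`: those from row `r` downwards
in column `c` and those up to row `r` in column `c + 1`. -/
def garnirSet (T : SkewTableau lam mu n) (r c : ℕ) : Finset (Fin n) :=
  Finset.univ.filter (fun k => (col T k = c ∧ r ≤ row T k) ∨ (col T k = c + 1 ∧ row T k ≤ r))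

theorem mem_garnirSet {T : SkewTableau lam mu n} {r c : ℕ} {k : Fin n} :
    k ∈ garnirSet T r c ↔ (col T k = c ∧ r ≤ row T k) ∨ (col T k = c + 1 ∧ row T k ≤ r) := by
  simp [garnirSet]

open Classical in
/-- The permutations that fix every letter outside of `G`. -/
noncomputable def permsOf (G : Finset (Fin n)) : Finset (Perm (Fin n)) :=
  Finset.univ.filter (fun g => ∀ k, k ∉ G → g k = k)

theorem mem_permsOf {G : Finset (Fin n)} {g : Perm (Fin n)} :
    g ∈ permsOf G ↔ ∀ k, k ∉ G → g k = k := by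
  simp [permsOf]

theorem inv_apply_of_mem_permsOf {G : Finset (Fin n)} {g : Perm (Fin n)} (hg : g ∈ permsOf G)
    {k : Fin n} (hk : k ∉ G) : g⁻¹ k = k := by
  rw [Perm.inv_eq_iff_eq]
  exact (mem_permsOf.1 hg k hk).symm

theorem mem_of_mem_permsOf {G : Finset (Fin n)} {g : Perm (Fin n)} (hg : g ∈ permsOf G)
    {k : Fin n} (hk : k ∈ G) : g k ∈ G := by
  by_contra h
  have := inv_apply_of_mem_permsOf hg h
  rw [Perm.inv_def, Equiv.symm_apply_apply] at this
  exact h (this ▸ hk)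

theorem one_mem_permsOf (G : Finset (Fin n)) : 1 ∈ permsOf G := by
  simp [mem_permsOf]

theorem mul_mem_permsOf {G : Finset (Fin n)} {g h : Perm (Fin n)} (hg : g ∈ permsOf G)
    (hh : h ∈ permsOf G) : g * h ∈ permsOf G := by
  rw [mem_permsOf] at *
  intro k hk
  rw [Perm.mul_apply, hh k hk, hg k hk]

theorem inv_mem_permsOf {G : Finset (Fin n)} {g : Perm (Fin n)} (hg : g ∈ permsOf G) :
    g⁻¹ ∈ permsOf G :=
  mem_permsOf.2 fun _ hk => inv_apply_of_mem_permsOf hg hk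

theorem swap_mem_permsOf {G : Finset (Fin n)} {k l : Fin n} (hk : k ∈ G) (hl : l ∈ G) :
    swap k l ∈ permsOf G := by
  rw [mem_permsOf]
  intro m hm
  exact swap_apply_of_ne_of_ne (fun h => hm (h ▸ hk)) (fun h => hm (h ▸ hl))

/-- The potential that governs straightening. -/
def columnWeight (T : SkewTableau lam mu n) : ℤ := ∑ k : Fin n, (k : ℤ) * (col T k : ℤ)

theorem columnWeight_trans_of_mem_columnGroup {T : SkewTableau lam mu n} {g : Perm (Fin n)}
    (hg : g ∈ columnGroup T) :
    columnWeight (T.trans g : SkewTableau lam mu n) = columnWeight T := by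
  unfold columnWeight
  refine Finset.sum_congr rfl (fun k _ => ?_)
  rw [col_trans, col_inv_of_mem_columnGroup hg]

theorem columnWeight_trans_swap (T : SkewTableau lam mu n) {i j : Fin n} (hij : (j : ℕ) = i + 1) :
    columnWeight (T.trans (swap i j) : SkewTableau lam mu n) =
      columnWeight T + ((col T i : ℤ) - col T j) := by
  have hne : i ≠ j := fun h => by subst h; omega
  have h := sum_mul_swap (fun m : Fin n => (m : ℤ)) (fun m => (col T m : ℤ)) hne
  unfold columnWeight
  simp only [col_trans, swap_inv]
  rw [h, hij]
  push_cast
  ring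

/-- At a row descent of a column strict tableau, a permutation of the Garnir belt that moves letters
between the two columns increases the potential. -/
theorem columnWeight_lt_of_garnir {T : SkewTableau lam mu n} (hT : ColumnStrict T) {k l : Fin n}
    (hr : row T k = row T l) (hc : col T l = col T k + 1) (hlk : l < k) {g : Perm (Fin n)}
    (hg : g ∈ permsOf (garnirSet T (row T k) (col T k))) (hgc : g ∉ columnGroup T) :
    columnWeight T < columnWeight (T.trans g : SkewTableau lam mu n) := by
  set G := garnirSet T (row T k) (col T k) with hG
  -- Column strictness places the belt letters of the left column at or above `k`, and those of the
  -- right column at or below `l < k`.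
  have hA : ∀ m, col T m = col T k → row T k ≤ row T m → k ≤ m := by
    intro m h1 h2
    rcases h2.eq_or_lt with h | h
    · exact (box_injective h h1.symm).le
    · exact (hT k m h1.symm h).le
  have hB : ∀ m, col T m = col T k + 1 → row T m ≤ row T k → m ≤ l := by
    intro m h1 h2
    rcases h2.eq_or_lt with h | h
    · exact (box_injective (h.trans hr) (h1.trans hc.symm)).le
    · exact (hT m l (h1.trans hc.symm) (by omega)).le
  have hsum : ∑ m, (col T (g⁻¹ m) : ℤ) = ∑ m, (col T m : ℤ) :=
    Equiv.sum_comp g⁻¹ (fun m => (col T m : ℤ))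
  have hGinv : ∀ m ∈ G, g⁻¹ m ∈ G := fun m hm => mem_of_mem_permsOf (inv_mem_permsOf hg) hm
  -- Replacing `m` by `m - l` does not change the total, since a permutation preserves the sum of
  -- the columns. It makes every summand nonnegative: columns can only grow at letters above `l` and
  -- only shrink at letters up to `l`.
  have hterm : ∀ m : Fin n,
      0 ≤ ((m : ℤ) - l) * ((col T (g⁻¹ m) : ℤ) - col T m) := by
    intro m
    by_cases hm : m ∈ G
    · have h1 := mem_garnirSet.1 hm
      have h2 := mem_garnirSet.1 (hGinv m hm)
      rcases h1 with h1 | h1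
      · have h3 := hA m h1.1 h1.2
        rw [Fin.le_def] at h3
        rw [Fin.lt_def] at hlk
        exact mul_nonneg (by omega) (by omega)
      · have h3 := hB m h1.1 h1.2
        rw [Fin.le_def] at h3
        exact mul_nonneg_of_nonpos_of_nonpos (by omega) (by omega)
    · rw [inv_apply_of_mem_permsOf hg hm]
      simp
  -- If no summand is positive, no column grows; the sum being fixed, no letter changes column and
  -- `g` lies in the column group.
  have hex : ∃ m : Fin n, 0 < ((m : ℤ) - l) * ((col T (g⁻¹ m) : ℤ) - col T m) := by
    by_contra hno
    push Not at hno
    have hle : ∀ m ∈ (Finset.univ : Finset (Fin n)), (col T (g⁻¹ m) : ℤ) ≤ (col T m : ℤ) := by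
      intro m _
      by_contra hlt
      push Not at hlt
      have hm : m ∈ G := by
        by_contra hm
        rw [inv_apply_of_mem_permsOf hg hm] at hlt
        exact lt_irrefl _ hlt
      have h1 := mem_garnirSet.1 hm
      have h2 := mem_garnirSet.1 (hGinv m hm)
      rcases h1 with h1 | h1
      · have h3 := hA m h1.1 h1.2
        rw [Fin.le_def] at h3
        rw [Fin.lt_def] at hlk
        exact absurd (hno m) (not_le.2 (mul_pos (by omega) (by omega)))
      · omega
    have heq := (Finset.sum_eq_sum_iff_of_le hle).1 hsum
    apply hgc
    rw [mem_columnGroup]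
    intro m
    have := heq (g m) (Finset.mem_univ _)
    rw [Perm.inv_def, Equiv.symm_apply_apply] at this
    exact_mod_cast this.symm
  obtain ⟨m₀, hm₀⟩ := hex
  have hpos : 0 < ∑ m : Fin n, ((m : ℤ) - l) * ((col T (g⁻¹ m) : ℤ) - col T m) :=
    Finset.sum_pos' (fun m _ => hterm m) ⟨m₀, Finset.mem_univ _, hm₀⟩
  have hexp : ∑ m : Fin n, ((m : ℤ) - l) * ((col T (g⁻¹ m) : ℤ) - col T m) =
      columnWeight (T.trans g : SkewTableau lam mu n) - columnWeight T := by
    have h1 : ∀ m : Fin n, ((m : ℤ) - l) * ((col T (g⁻¹ m) : ℤ) - col T m) =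
        ((m : ℤ) * (col T (g⁻¹ m) : ℤ) - (m : ℤ) * (col T m : ℤ)) -
          (l : ℤ) * ((col T (g⁻¹ m) : ℤ) - col T m) := fun m => by ring
    rw [Finset.sum_congr rfl (fun m _ => h1 m), Finset.sum_sub_distrib, Finset.sum_sub_distrib,
      ← Finset.mul_sum, Finset.sum_sub_distrib, hsum]
    simp [columnWeight, col_trans]
  linarith

end TableauCombinatorics

end AbstractYoung

namespace AbstractYoung

open Equiv SkewTableau

/-! ### Straightening -/

section Straightening

variable {F : Type*} [Field F] {lam mu : YoungDiagram} {n : ℕ}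
  {W : Type*} [AddCommGroup W] [Module F W]

/-- The sign of a permutation as a scalar. -/
def sgn (F : Type*) [Field F] {n : ℕ} (g : Perm (Fin n)) : F := ((Perm.sign g : ℤˣ) : ℤ)

theorem sgn_one : sgn F (1 : Perm (Fin n)) = 1 := by simp [sgn]

theorem sgn_mul (g h : Perm (Fin n)) : sgn F (g * h) = sgn F g * sgn F h := by simp [sgn]

theorem sgn_swap {i j : Fin n} (h : i ≠ j) : sgn F (swap i j) = -1 := by
  simp [sgn, Perm.sign_swap h]

theorem sgn_mul_self (g : Perm (Fin n)) : sgn F g * sgn F g = 1 := by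
  unfold sgn
  rcases Int.units_eq_one_or (Perm.sign g) with h | h <;> simp [h]

theorem sgn_inv (g : Perm (Fin n)) : sgn F g⁻¹ = sgn F g := by simp [sgn]

/-- A function on tableaux is antisymmetric along columns. -/
def IsColumnAlternating (F : Type*) [Field F] {W : Type*} [AddCommGroup W] [Module F W]
    (Φ : SkewTableau lam mu n → W) : Prop :=
  ∀ (T : SkewTableau lam mu n), ∀ g ∈ columnGroup T, Φ (T.trans g) = sgn F g • Φ T

/-- A function on tableaux satisfies the Garnir relations. -/
def SatisfiesGarnir (F : Type*) [Field F] {W : Type*} [AddCommGroup W] [Module F W]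
    (Φ : SkewTableau lam mu n → W) : Prop :=
  ∀ (T : SkewTableau lam mu n) (r c : ℕ), (r, c) ∈ skewCells lam mu →
    (r, c + 1) ∈ skewCells lam mu →
      ∑ g ∈ permsOf (garnirSet T r c), sgn F g • Φ (T.trans g) = 0

/-- The straightening algorithm. -/
theorem straightening [CharZero F] {Φ : SkewTableau lam mu n → W}
    (hcol : IsColumnAlternating F Φ) (hgar : SatisfiesGarnir F Φ) (T : SkewTableau lam mu n) :
    Φ T ∈ Submodule.span F (Φ '' {T' | IsStandard T'}) := by
  classical
  set D := Submodule.span F (Φ '' {T' | IsStandard T'}) with hD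
  by_contra hbad
  -- A counterexample of largest weight: a Garnir relation will express it through tableaux of
  -- larger weight.
  obtain ⟨T, hTbad, hmax⟩ := Finset.exists_max_image
    (Finset.univ.filter fun T : SkewTableau lam mu n => Φ T ∉ D) columnWeight
    ⟨T, Finset.mem_filter.2 ⟨Finset.mem_univ _, hbad⟩⟩
  rw [Finset.mem_filter] at hTbad
  have hgood : ∀ T', columnWeight T < columnWeight T' → Φ T' ∈ D := by
    intro T' hlt
    by_contra h
    exact absurd (hmax T' (Finset.mem_filter.2 ⟨Finset.mem_univ _, h⟩)) (not_le.2 hlt)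
  obtain ⟨g, hg, hstr⟩ := exists_columnStrict T
  set T' : SkewTableau lam mu n := T.trans g with hT'
  have hwt : columnWeight T' = columnWeight T := columnWeight_trans_of_mem_columnGroup hg
  have hΦ : Φ T = sgn F g • Φ T' := by
    rw [hcol T g hg, smul_smul, sgn_mul_self, one_smul]
  have hT'bad : Φ T' ∉ D := fun h => hTbad.2 (hΦ ▸ D.smul_mem _ h)
  have hnstd : ¬ IsStandard T' := fun h =>
    hT'bad (Submodule.subset_span ⟨T', h, rfl⟩)
  obtain ⟨k, l, hr, hc, hlk⟩ : ∃ k l, row T' k = row T' l ∧ col T' l = col T' k + 1 ∧ l < k := by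
    by_contra hcon
    push Not at hcon
    refine hnstd (isStandard_of_adjacent (fun k l hr hc => ?_)
      (fun k l hc hr => hstr k l hc (by omega)))
    refine lt_of_le_of_ne (hcon k l hr hc) ?_
    rintro rfl
    omega
  have hrel := hgar T' (row T' k) (col T' k) (box_mem T' k)
    (by rw [hr, ← hc]; exact box_mem T' l)
  rw [← Finset.sum_filter_add_sum_filter_not _ (fun h => h ∈ columnGroup T')] at hrel
  have h1 : ∑ h ∈ (permsOf (garnirSet T' (row T' k) (col T' k))).filter
      (fun h => h ∈ columnGroup T'), sgn F h • Φ (T'.trans h) =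
      (((permsOf (garnirSet T' (row T' k) (col T' k))).filter
        (fun h => h ∈ columnGroup T')).card : F) • Φ T' := by
    rw [Finset.sum_congr rfl (g := fun _ => Φ T'), Finset.sum_const, Nat.cast_smul_eq_nsmul]
    intro h hh
    rw [hcol T' h (Finset.mem_filter.1 hh).2, smul_smul, sgn_mul_self, one_smul]
  have h2 : ∑ h ∈ (permsOf (garnirSet T' (row T' k) (col T' k))).filter
      (fun h => ¬ h ∈ columnGroup T'), sgn F h • Φ (T'.trans h) ∈ D := by
    refine D.sum_mem fun h hh => D.smul_mem _ (hgood _ ?_)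
    rw [Finset.mem_filter] at hh
    rw [← hwt]
    exact columnWeight_lt_of_garnir hstr hr hc hlk hh.1 hh.2
  rw [h1] at hrel
  have h3 := eq_neg_of_add_eq_zero_left hrel
  -- The column preserving terms of the relation add up to a positive integral multiple of `Φ T'`,
  -- which is invertible in characteristic zero.
  have hne : ((((permsOf (garnirSet T' (row T' k) (col T' k))).filter
        (fun h => h ∈ columnGroup T')).card : ℕ) : F) ≠ 0 := by
    rw [Nat.cast_ne_zero]
    exact (Finset.card_pos.2 ⟨1, Finset.mem_filter.2
      ⟨one_mem_permsOf _, one_mem_columnGroup T'⟩⟩).ne'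
  apply hT'bad
  rw [← one_smul F (Φ T'), ← inv_mul_cancel₀ hne, ← smul_smul, h3]
  exact D.smul_mem _ (D.neg_mem h2)

end Straightening

/-! ### Relations between polytabloids -/

section Polytabloids

variable {F : Type*} [Field F] {lam mu : YoungDiagram} {n : ℕ}

theorem polytabloid_eq (T : SkewTableau lam mu n) :
    polytabloid F T = ∑ g ∈ columnGroup T, sgn F g •
      Finsupp.single (row (T.trans g : SkewTableau lam mu n)) 1 := by
  unfold polytabloid
  refine Finset.sum_congr rfl (fun g _ => ?_)
  rw [Finsupp.smul_single, smul_eq_mul, mul_one]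
  rfl

theorem tabloidRep_single (g : Perm (Fin n)) (r : Fin n → ℕ) (a : F) :
    tabloidRep F n g (Finsupp.single r a) = Finsupp.single (fun k => r (g⁻¹ k)) a := by
  simp [tabloidRep, Finsupp.lmapDomain_apply, Finsupp.mapDomain_single]

theorem columnGroup_trans {T : SkewTableau lam mu n} {h : Perm (Fin n)}
    (hh : h ∈ columnGroup T) :
    columnGroup (T.trans h : SkewTableau lam mu n) = columnGroup T := by
  ext g
  rw [mem_columnGroup, mem_columnGroup]
  simp only [col_trans, col_inv_of_mem_columnGroup hh]

theorem mul_mem_columnGroup {T : SkewTableau lam mu n} {g h : Perm (Fin n)}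
    (hg : g ∈ columnGroup T) (hh : h ∈ columnGroup T) : g * h ∈ columnGroup T := by
  rw [mem_columnGroup] at *
  intro k
  rw [Perm.mul_apply, hg, hh]

theorem inv_mem_columnGroup {T : SkewTableau lam mu n} {g : Perm (Fin n)}
    (hg : g ∈ columnGroup T) : g⁻¹ ∈ columnGroup T :=
  mem_columnGroup.2 (col_inv_of_mem_columnGroup hg)

theorem polytabloid_isColumnAlternating :
    IsColumnAlternating F (fun T : SkewTableau lam mu n => polytabloid F T) := by
  intro T h hh
  simp only
  rw [polytabloid_eq, polytabloid_eq, columnGroup_trans hh, Finset.smul_sum]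
  refine Finset.sum_bij' (fun g _ => g * h) (fun g _ => g * h⁻¹) ?_ ?_ ?_ ?_ ?_
  · exact fun g hg => mul_mem_columnGroup hg hh
  · exact fun g hg => mul_mem_columnGroup hg (inv_mem_columnGroup hh)
  · intro g _; simp
  · intro g _; simp
  · intro g _
    rw [smul_smul, sgn_mul, mul_comm (sgn F g), ← mul_assoc, sgn_mul_self, one_mul]
    rfl

/-- The antisymmetrizer of a set of letters kills every tabloid with two of these letters in the
same row. -/
theorem sum_sgn_tabloid_eq_zero [CharZero F] {G : Finset (Fin n)} {r : Fin n → ℕ} {k l : Fin n}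
    (hk : k ∈ G) (hl : l ∈ G) (hkl : k ≠ l) (hr : r k = r l) :
    ∑ g ∈ permsOf G, sgn F g • tabloidRep F n g (Finsupp.single r 1) = 0 := by
  have hs := swap_mem_permsOf hk hl
  -- Right multiplication by the transposition of two letters in one row reverses the sign and keeps
  -- the tabloid, so the sum is its own negative.
  have h : ∑ g ∈ permsOf G, sgn F g • tabloidRep F n g (Finsupp.single r 1) =
      ∑ g ∈ permsOf G, -(sgn F g • tabloidRep F n g (Finsupp.single r 1)) := by
    refine Finset.sum_bij' (fun g _ => g * swap k l) (fun g _ => g * swap k l) ?_ ?_ ?_ ?_ ?_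
    · exact fun g hg => mul_mem_permsOf hg hs
    · exact fun g hg => mul_mem_permsOf hg hs
    · intro g _; simp [mul_assoc]
    · intro g _; simp [mul_assoc]
    · intro g _
      rw [sgn_mul, sgn_swap hkl, mul_neg_one, neg_smul, neg_neg]
      congr 1
      rw [tabloidRep_single, tabloidRep_single]
      congr 1
      funext m
      rw [mul_inv_rev, swap_inv, Perm.mul_apply]
      rcases eq_or_ne (g⁻¹ m) k with h | h
      · rw [h, swap_apply_left, hr]
      · rcases eq_or_ne (g⁻¹ m) l with h' | h'
        · rw [h', swap_apply_right, hr]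
        · rw [swap_apply_of_ne_of_ne h h']
  rw [Finset.sum_neg_distrib] at h
  exact self_eq_neg.1 h

/-- After a column permutation the belt letters still lie in rows met by the belt of `T`. These rows
are fewer than the letters, since row `r` is met in both columns. So two belt letters share a row,
and the antisymmetrizer kills each tabloid. -/
theorem polytabloid_satisfiesGarnir [CharZero F] :
    SatisfiesGarnir F (fun T : SkewTableau lam mu n => polytabloid F T) := by
  intro T r c hrc hrc'
  have h1 : ∀ g ∈ permsOf (garnirSet T r c), sgn F g • polytabloid F (T.trans g) =
      ∑ h ∈ columnGroup T, sgn F h • (sgn F g • tabloidRep F n g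
        (Finsupp.single (row (T.trans h : SkewTableau lam mu n)) 1)) := by
    intro g _
    rw [← tabloidRep_polytabloid, polytabloid_eq, map_sum, Finset.smul_sum]
    refine Finset.sum_congr rfl (fun h _ => ?_)
    rw [map_smul, smul_comm]
  simp only
  rw [Finset.sum_congr rfl h1, Finset.sum_comm]
  refine Finset.sum_eq_zero (fun h hh => ?_)
  rw [← Finset.smul_sum]
  obtain ⟨x, hxr, hxc⟩ := exists_letter T hrc
  obtain ⟨y, hyr, hyc⟩ := exists_letter T hrc'
  have hx : x ∈ garnirSet T r c := mem_garnirSet.2 (Or.inl ⟨hxc, hxr.ge⟩)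
  have hy : y ∈ garnirSet T r c := mem_garnirSet.2 (Or.inr ⟨hyc, hyr.le⟩)
  have hxy : x ≠ y := fun e => by subst e; omega
  have hcard : ((garnirSet T r c).image (row T)).card < (garnirSet T r c).card := by
    refine lt_of_le_of_ne Finset.card_image_le (fun e => ?_)
    exact hxy (Finset.card_image_iff.1 e hx hy (by rw [hxr, hyr]))
  have hmaps : ∀ m ∈ garnirSet T r c, row (T.trans h : SkewTableau lam mu n) m ∈
      (garnirSet T r c).image (row T) := by
    intro m hm
    have hmc := col_inv_of_mem_columnGroup hh m
    have hb := box_mem T (h⁻¹ m)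
    rw [hmc] at hb
    rw [row_trans, Finset.mem_image]
    rw [mem_skewCells] at hrc hrc'
    rcases mem_garnirSet.1 hm with h2 | h2
    · rcases le_or_gt r (row T (h⁻¹ m)) with h3 | h3
      · exact ⟨h⁻¹ m, mem_garnirSet.2 (Or.inl ⟨by omega, h3⟩), rfl⟩
      -- A left letter moved above row `r` has a box of the shape in the next column: it is in `lam`
      -- as it lies above `(r, c + 1)`, and outside `mu` as it lies to the right of a box outside
      -- `mu`.
      · have hcell : (row T (h⁻¹ m), c + 1) ∈ skewCells lam mu := by
          rw [mem_skewCells] at hb ⊢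
          refine ⟨lam.isLowerSet (show (row T (h⁻¹ m), c + 1) ≤ (r, c + 1) from ⟨h3.le, le_rfl⟩)
            hrc'.1, fun hmu => ?_⟩
          exact hb.2 (mu.isLowerSet (show (row T (h⁻¹ m), col T m) ≤ (row T (h⁻¹ m), c + 1) from
            ⟨le_rfl, show col T m ≤ c + 1 by omega⟩) hmu)
        obtain ⟨z, hzr, hzc⟩ := exists_letter T hcell
        exact ⟨z, mem_garnirSet.2 (Or.inr ⟨hzc, by omega⟩), hzr⟩
    · rcases le_or_gt (row T (h⁻¹ m)) r with h3 | h3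
      · exact ⟨h⁻¹ m, mem_garnirSet.2 (Or.inr ⟨by omega, h3⟩), rfl⟩
      · have hcell : (row T (h⁻¹ m), c) ∈ skewCells lam mu := by
          rw [mem_skewCells] at hb ⊢
          refine ⟨lam.isLowerSet (show (row T (h⁻¹ m), c) ≤ (row T (h⁻¹ m), col T m) from
            ⟨le_rfl, show c ≤ col T m by omega⟩) hb.1, fun hmu => ?_⟩
          exact hrc.2 (mu.isLowerSet (show (r, c) ≤ (row T (h⁻¹ m), c) from ⟨h3.le, le_rfl⟩) hmu)
        obtain ⟨z, hzr, hzc⟩ := exists_letter T hcell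
        exact ⟨z, mem_garnirSet.2 (Or.inl ⟨hzc, by omega⟩), hzr⟩
  obtain ⟨k, hk, l, hl, hkl, hkl'⟩ := Finset.exists_ne_map_eq_of_card_lt_of_maps_to hcard hmaps
  rw [sum_sgn_tabloid_eq_zero hk hl hkl hkl', smul_zero]

end Polytabloids

/-! ### Linear independence of standard polytabloids -/

section Independence

variable {F : Type*} [Field F] {lam mu : YoungDiagram} {n : ℕ}

/-- Row assignments ordered lexicographically from the largest letter downwards. -/
def tabloidKey (r : Fin n → ℕ) : Lex ((Fin n)ᵒᵈ → ℕ) := toLex (fun k => r (OrderDual.ofDual k))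

/-- Letters beyond the largest one moved by `g` keep their rows, while that one receives the row of
a smaller letter of its column, which is higher by column strictness. -/
theorem tabloidKey_trans_lt {T : SkewTableau lam mu n} (hT : ColumnStrict T) {g : Perm (Fin n)}
    (hg : g ∈ columnGroup T) (hg1 : g ≠ 1) :
    tabloidKey (row (T.trans g : SkewTableau lam mu n)) < tabloidKey (row T) := by
  have hne : (Finset.univ.filter fun k => g k ≠ k).Nonempty := by
    by_contra h
    rw [Finset.not_nonempty_iff_eq_empty, Finset.filter_eq_empty_iff] at h
    exact hg1 (Equiv.ext fun k => not_not.1 (h (Finset.mem_univ k)))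
  obtain ⟨k, hk, hmax⟩ := Finset.exists_max_image _ id hne
  rw [Finset.mem_filter] at hk
  have hfix : ∀ l, k < l → g⁻¹ l = l := by
    intro l hl
    rw [Perm.inv_eq_iff_eq]
    by_contra h
    exact absurd (hmax l (Finset.mem_filter.2 ⟨Finset.mem_univ _, fun h' => h h'.symm⟩))
      (not_le.2 hl)
  have hk' : g⁻¹ k ≠ k := fun h => hk.2 (Perm.inv_eq_iff_eq.1 h).symm
  have hlt : g⁻¹ k < k := by
    refine lt_of_le_of_ne (not_lt.1 fun h => ?_) hk'
    exact hk' (g⁻¹.injective (hfix _ h))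
  have hcol := col_inv_of_mem_columnGroup hg k
  refine ⟨OrderDual.toDual k, fun l hl => ?_, ?_⟩
  · change row T (g⁻¹ (OrderDual.ofDual l)) = row T (OrderDual.ofDual l)
    rw [show g⁻¹ (OrderDual.ofDual l) = OrderDual.ofDual l from hfix _ hl]
  · change row T (g⁻¹ k) < row T k
    rcases lt_trichotomy (row T (g⁻¹ k)) (row T k) with h | h | h
    · exact h
    · exact absurd (box_injective h hcol) hk'
    · exact absurd (hT _ _ hcol.symm h) (not_lt.2 hlt.le)

theorem IsStandard_columnStrict {T : SkewTableau lam mu n} (hT : IsStandard T) : ColumnStrict T :=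
  (isStandard_iff.1 hT).2

theorem polytabloid_apply (T : SkewTableau lam mu n) (r : Fin n → ℕ) :
    polytabloid F T r = ∑ g ∈ columnGroup T,
      if row (T.trans g : SkewTableau lam mu n) = r then sgn F g else 0 := by
  rw [polytabloid_eq, Finsupp.finsetSum_apply]
  refine Finset.sum_congr rfl (fun g _ => ?_)
  rw [Finsupp.smul_apply, Finsupp.single_apply, smul_eq_mul, mul_ite, mul_one, mul_zero]

/-- Unitriangularity: `{T}` is the leading tabloid of `e_T` and determines the standard tableau `T`.
In a relation, the leading tabloid with the largest key occurs in one term only. -/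
theorem linearIndependent_polytabloid :
    LinearIndependent F (fun T : {T : SkewTableau lam mu n // IsStandard T} =>
      polytabloid F T.1) := by
  classical
  rw [linearIndependent_iff']
  intro s a hsum
  by_contra hcon
  push Not at hcon
  obtain ⟨T₀, hT₀, ha₀⟩ := hcon
  obtain ⟨T, hT, hmax⟩ := Finset.exists_max_image (s.filter fun T => a T ≠ 0)
    (fun T => tabloidKey (row T.1)) ⟨T₀, Finset.mem_filter.2 ⟨hT₀, ha₀⟩⟩
  rw [Finset.mem_filter] at hT
  have h := congrArg (fun v : (Fin n → ℕ) →₀ F => v (row T.1)) hsum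
  simp only [Finsupp.finsetSum_apply, Finsupp.smul_apply, smul_eq_mul, Finsupp.coe_zero,
    Pi.zero_apply] at h
  rw [Finset.sum_eq_single_of_mem T hT.1] at h
  · rw [polytabloid_apply, Finset.sum_eq_single_of_mem 1 (one_mem_columnGroup _)] at h
    · rw [if_pos (by rfl), sgn_one, mul_one] at h
      exact hT.2 h
    · intro g hg hg1
      rw [if_neg]
      intro he
      have := tabloidKey_trans_lt (IsStandard_columnStrict T.2) hg hg1
      rw [he] at this
      exact lt_irrefl _ this
  · intro T' hT' hne
    by_cases ha : a T' = 0
    · rw [ha, zero_mul]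
    · have hle := hmax T' (Finset.mem_filter.2 ⟨hT', ha⟩)
      rw [polytabloid_apply, Finset.sum_eq_zero, mul_zero]
      intro g hg
      rw [if_neg]
      intro he
      by_cases hg1 : g = 1
      · subst hg1
        exact hne (Subtype.ext (T'.2.eq_of_row_eq T.2 (fun k => congrFun he k)))
      · have := tabloidKey_trans_lt (IsStandard_columnStrict T'.2) hg hg1
        rw [he] at this
        exact absurd hle (not_le.2 this)

end Independence

end AbstractYoung

namespace AbstractYoung

open Equiv SkewTableau

/-! ### Seminormal bases and skew Specht modules -/

section Seminormal

variable {F : Type*} [Field F] {lam mu : YoungDiagram} {n : ℕ}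
  {V : Type*} [AddCommGroup V] [Module F V]

/-- A family of vectors, indexed by the standard tableaux of a skew shape, is a basis of a
representation on which the adjacent transpositions act in the shape of Young's seminormal form. -/
structure IsSeminormal (ρ : Representation F (Perm (Fin n)) V)
    (v : SkewTableau lam mu n → V) : Prop where
  linearIndependent : LinearIndependent F
    (fun T : {T : SkewTableau lam mu n // IsStandard T} => v T.1)
  span : ⊤ ≤ Submodule.span F
    (Set.range (fun T : {T : SkewTableau lam mu n // IsStandard T} => v T.1))
  same_row : ∀ T, IsStandard T → ∀ i j : Fin n, (j : ℕ) = i + 1 → row T i = row T j →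
    ρ (swap i j) (v T) = v T
  same_col : ∀ T, IsStandard T → ∀ i j : Fin n, (j : ℕ) = i + 1 → col T i = col T j →
    ρ (swap i j) (v T) = - v T
  generic : ∀ T, IsStandard T → ∀ i j : Fin n, (j : ℕ) = i + 1 → row T i ≠ row T j →
    col T i ≠ col T j → ∃ a b : F, b ≠ 0 ∧
      ρ (swap i j) (v T) = a • v T + b • v (T.trans (swap i j))

/-- The antisymmetrizer of a set of letters produces alternating vectors. -/
theorem rep_swap_antisymmetrizer (ρ : Representation F (Perm (Fin n)) V) (x : V)
    {G : Finset (Fin n)} {i j : Fin n} (hi : i ∈ G) (hj : j ∈ G) (hne : i ≠ j) :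
    ρ (swap i j) (∑ g ∈ permsOf G, sgn F g • ρ g x) =
      -∑ g ∈ permsOf G, sgn F g • ρ g x := by
  rw [map_sum, ← Finset.sum_neg_distrib]
  have hs := swap_mem_permsOf hi hj
  refine Finset.sum_bij' (fun g _ => swap i j * g) (fun g _ => swap i j * g) ?_ ?_ ?_ ?_ ?_
  · exact fun g hg => mul_mem_permsOf hs hg
  · exact fun g hg => mul_mem_permsOf hs hg
  · intro g _; simp
  · intro g _; simp
  · intro g _
    rw [map_smul, sgn_mul, sgn_swap hne, neg_one_mul, neg_smul, neg_neg, map_mul,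
      Module.End.mul_apply]

/-- A vector negated by the adjacent transpositions of an interval partition transforms by the sign
under the corresponding Young subgroup. -/
theorem rep_eq_sgn_smul {ρ : Representation F (Perm (Fin n)) V} {x : V} {κ : Fin n → ℕ}
    (hκ : Monotone κ)
    (hx : ∀ i j : Fin n, (j : ℕ) = i + 1 → κ i = κ j → ρ (swap i j) x = -x)
    (g : Perm (Fin n)) (hg : ∀ k, κ (g k) = κ k) : ρ g x = sgn F g • x := by
  revert hg
  refine descent_induction g ?_ ?_
  · intro _
    simp [sgn_one]
  · intro u i j hij hd ih hu
    have hlt : i < j := by rw [Fin.lt_def]; omega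
    -- A descent of a permutation that preserves the blocks of a monotone `κ` lies inside one block.
    have hκij : κ i = κ j := by
      refine le_antisymm (hκ hlt.le) ?_
      rw [← hu i, ← hu j]
      exact hκ hd.le
    have h1 := ih (by
      intro k
      rw [Perm.mul_apply, hu]
      rcases eq_or_ne k i with h | h
      · rw [h, swap_apply_left, hκij]
      · rcases eq_or_ne k j with h' | h'
        · rw [h', swap_apply_right, hκij]
        · rw [swap_apply_of_ne_of_ne h h'])
    rw [map_mul, Module.End.mul_apply, hx i j hij hκij, map_neg, sgn_mul, sgn_swap hlt.ne,
      mul_neg_one, neg_smul, neg_inj] at h1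
    exact h1

/-- Induction along the adjacent transpositions inside an order-convex set of letters. -/
theorem permsOf_induction {G : Finset (Fin n)}
    (hG : ∀ k l m, k ∈ G → m ∈ G → k ≤ l → l ≤ m → l ∈ G) {motive : Perm (Fin n) → Prop}
    (one : motive 1)
    (step : ∀ u ∈ permsOf G, ∀ i ∈ G, ∀ j ∈ G, (j : ℕ) = i + 1 →
      motive (u * swap i j) → motive u) (g : Perm (Fin n)) (hg : g ∈ permsOf G) : motive g := by
  revert hg
  refine descent_induction g (fun _ => one) ?_
  intro u i j hij hd ih hu
  have hlt : i < j := by rw [Fin.lt_def]; omega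
  -- A descent cannot leave `G`: letters outside `G` are fixed, and one caught between two members
  -- of `G` would belong to `G` by convexity.
  have hi : i ∈ G := by
    by_contra hi
    have h1 := mem_permsOf.1 hu i hi
    rw [h1] at hd
    by_cases hj : j ∈ G
    · exact hi (hG _ _ _ (mem_of_mem_permsOf hu hj) hj hd.le hlt.le)
    · rw [mem_permsOf.1 hu j hj] at hd
      exact lt_asymm hd hlt
  have hj : j ∈ G := by
    by_contra hj
    have h1 := mem_permsOf.1 hu j hj
    rw [h1] at hd
    exact hj (hG _ _ _ hi (mem_of_mem_permsOf hu hi) hlt.le hd.le)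
  exact step u hu i hi j hj hij (ih (mul_mem_permsOf hu (swap_mem_permsOf hi hj)))

namespace IsSeminormal

variable {ρ : Representation F (Perm (Fin n)) V} {v : SkewTableau lam mu n → V}

/-- The basis of a seminormal family. -/
noncomputable def basis (h : IsSeminormal ρ v) :
    Module.Basis {T : SkewTableau lam mu n // IsStandard T} F V :=
  Module.Basis.mk h.linearIndependent h.span

theorem basis_apply (h : IsSeminormal ρ v) (T : {T : SkewTableau lam mu n // IsStandard T}) :
    h.basis T = v T.1 := by
  simp [basis]

theorem coord_apply (h : IsSeminormal ρ v) {T T' : SkewTableau lam mu n} (hT : IsStandard T)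
    (hT' : IsStandard T') [Decidable (T' = T)] :
    h.basis.coord ⟨T, hT⟩ (v T') = if T' = T then 1 else 0 := by
  classical
  rw [← h.basis_apply ⟨T', hT'⟩, Module.Basis.coord_apply, Module.Basis.repr_self,
    Finsupp.single_apply]
  simp [Subtype.ext_iff]

theorem trans_swap_swap (T : SkewTableau lam mu n) (i j : Fin n) :
    ((T.trans (swap i j) : SkewTableau lam mu n).trans (swap i j) : SkewTableau lam mu n) = T := by
  rw [trans_trans, swap_mul_self, trans_one]

/-- No other basis vector contributes to the coordinate at `T`: an exchange of `i` and `j` that led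
to `T` would start from a tableau with both in one row. -/
theorem coord_rep_of_same_row (h : IsSeminormal ρ v) {T : SkewTableau lam mu n}
    (hT : IsStandard T) {i j : Fin n} (hij : (j : ℕ) = i + 1) (hr : row T i = row T j) (x : V) :
    h.basis.coord ⟨T, hT⟩ (ρ (swap i j) x) = h.basis.coord ⟨T, hT⟩ x := by
  classical
  have : h.basis.coord ⟨T, hT⟩ ∘ₗ ρ (swap i j) = h.basis.coord ⟨T, hT⟩ := by
    refine h.basis.ext ?_
    rintro ⟨T', hT'⟩
    rw [h.basis_apply, LinearMap.comp_apply]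
    by_cases hr' : row T' i = row T' j
    · rw [h.same_row T' hT' i j hij hr']
    · have hne : T' ≠ T := fun e => hr' (e ▸ hr)
      by_cases hc' : col T' i = col T' j
      · rw [h.same_col T' hT' i j hij hc', map_neg, h.coord_apply hT hT', if_neg hne, neg_zero]
      · obtain ⟨a, b, _, hab⟩ := h.generic T' hT' i j hij hr' hc'
        have hstd := hT'.trans_swap hij hr' hc'
        have hne' : (T'.trans (swap i j) : SkewTableau lam mu n) ≠ T := by
          rintro rfl
          rw [row_trans, row_trans] at hr
          simp only [swap_inv, swap_apply_left, swap_apply_right] at hr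
          exact hr' hr.symm
        rw [hab, map_add, map_smul, map_smul, h.coord_apply hT hT', if_neg hne,
          h.coord_apply hT hstd, if_neg hne']
        simp
  exact LinearMap.congr_fun this x

/-- On a vector negated by the transposition, this transports nonvanishing of the coordinate at `T`
to its neighbour, because `b ≠ 0`. -/
theorem coord_rep_of_generic (h : IsSeminormal ρ v) {T : SkewTableau lam mu n}
    (hT : IsStandard T) {i j : Fin n} (hij : (j : ℕ) = i + 1) (hr : row T i ≠ row T j)
    (hc : col T i ≠ col T j) : ∃ a b : F, b ≠ 0 ∧ ∀ x,
      h.basis.coord ⟨_, hT.trans_swap hij hr hc⟩ (ρ (swap i j) x) =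
        b * h.basis.coord ⟨T, hT⟩ x + a * h.basis.coord ⟨_, hT.trans_swap hij hr hc⟩ x := by
  classical
  have hTs := hT.trans_swap hij hr hc
  have hneT : T ≠ T.trans (swap i j) := by
    intro e
    have h1 : row T i = row (T.trans (swap i j) : SkewTableau lam mu n) i := by rw [← e]
    rw [row_trans, swap_inv, swap_apply_left] at h1
    exact hr h1
  obtain ⟨a', b, hb, hab⟩ := h.generic T hT i j hij hr hc
  have hne := hTs.ne_of_trans_swap hij (by rw [trans_swap_swap]; exact hT)
  obtain ⟨a, b', _, hab'⟩ := h.generic _ hTs i j hij hne.1 hne.2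
  rw [trans_swap_swap] at hab'
  refine ⟨a, b, hb, fun x => ?_⟩
  have : h.basis.coord ⟨_, hTs⟩ ∘ₗ ρ (swap i j) =
      b • h.basis.coord ⟨T, hT⟩ + a • h.basis.coord ⟨_, hTs⟩ := by
    refine h.basis.ext ?_
    rintro ⟨T', hT'⟩
    rw [h.basis_apply, LinearMap.comp_apply, LinearMap.add_apply, LinearMap.smul_apply,
      LinearMap.smul_apply, smul_eq_mul, smul_eq_mul]
    by_cases h1 : T' = T
    · subst h1
      rw [hab, map_add, map_smul, map_smul, h.coord_apply hTs hT', h.coord_apply hTs hTs,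
        h.coord_apply hT hT', if_neg hneT]
      simp
    · by_cases h2 : T' = T.trans (swap i j)
      · subst h2
        rw [hab', map_add, map_smul, map_smul, h.coord_apply hTs hTs, h.coord_apply hTs hT,
          h.coord_apply hT hTs, if_neg hneT, if_neg hneT.symm]
        simp
      · rw [h.coord_apply hT hT', h.coord_apply hTs hT', if_neg h1, if_neg h2]
        by_cases hr' : row T' i = row T' j
        · rw [h.same_row T' hT' i j hij hr', h.coord_apply hTs hT', if_neg h2]
          simp
        · by_cases hc' : col T' i = col T' j
          · rw [h.same_col T' hT' i j hij hc', map_neg, h.coord_apply hTs hT', if_neg h2]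
            simp
          · obtain ⟨a'', b'', _, hab''⟩ := h.generic T' hT' i j hij hr' hc'
            have hne' : (T'.trans (swap i j) : SkewTableau lam mu n) ≠ T.trans (swap i j) := by
              intro e
              apply h1
              rw [← trans_swap_swap T' i j, e, trans_swap_swap]
            rw [hab'', map_add, map_smul, map_smul, h.coord_apply hTs hT', if_neg h2,
              h.coord_apply hTs (hT'.trans_swap hij hr' hc'), if_neg hne']
            simp
  exact LinearMap.congr_fun this x

/-- An invariant subspace that contains the vector of the column reading tableau is everything. -/
theorem mem_of_columnReading (h : IsSeminormal ρ v) {Tc : SkewTableau lam mu n}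
    (hTc : ∀ i j, i < j → col Tc i < col Tc j ∨ (col Tc i = col Tc j ∧ row Tc i < row Tc j))
    {D : Submodule F V} (hD : ∀ g, ∀ x ∈ D, ρ g x ∈ D) (hv : v Tc ∈ D)
    (x : V) : x ∈ D := by
  classical
  have key : ∀ T, IsStandard T → v T ∈ D := by
    by_contra hcon
    push Not at hcon
    obtain ⟨T₀, hT₀, hbad₀⟩ := hcon
    obtain ⟨T, hTm, hmax⟩ := Finset.exists_max_image
      (Finset.univ.filter fun T : SkewTableau lam mu n => IsStandard T ∧ v T ∉ D) columnWeight
      ⟨T₀, Finset.mem_filter.2 ⟨Finset.mem_univ _, hT₀, hbad₀⟩⟩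
    obtain ⟨-, hT, hbad⟩ := Finset.mem_filter.1 hTm
    -- If the columns increased weakly along the letters, `T` would be the column reading tableau.
    -- So there is a descent of columns, and undoing it raises the weight.
    have hex : ∃ i j : Fin n, (j : ℕ) = i + 1 ∧ col T j < col T i := by
      by_contra hno
      push Not at hno
      have hmono : StrictMono (fun k : Fin n => Tc (T.symm k)) := by
        refine strictMono_of_adjacent (fun i j hij => ?_)
        have hlt : i < j := by rw [Fin.lt_def]; omega
        have hle := hno i j hij
        by_contra hge
        have hne : Tc (T.symm j) ≠ Tc (T.symm i) := fun e => by
          have := T.symm.injective (Tc.injective e)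
          subst this
          exact lt_irrefl _ hlt
        have h2 := hTc _ _ (lt_of_le_of_ne (not_lt.1 hge) hne)
        have e1 : ∀ k, col Tc (Tc (T.symm k)) = col T k := fun k => by simp [col]
        have e2 : ∀ k, row Tc (Tc (T.symm k)) = row T k := fun k => by simp [row]
        rw [e1, e1, e2, e2] at h2
        have h3 : col T i = col T j := by omega
        have h4 := hT.row_succ hij h3
        omega
      have h1 : (T.symm.trans Tc : Perm (Fin n)) = 1 := perm_eq_one_of_strictMono hmono
      have h2 := trans_cancel (T := T) Tc
      rw [h1, trans_one] at h2
      exact hbad (h2 ▸ hv)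
    obtain ⟨i, j, hij, hcol⟩ := hex
    have hlt : i < j := by rw [Fin.lt_def]; omega
    have hr : row T i ≠ row T j := fun hr => by
      have := hT.col_succ hij hr
      omega
    have hstd := hT.trans_swap hij hr hcol.ne'
    have hwt := columnWeight_trans_swap T hij
    have hin : v (T.trans (swap i j)) ∈ D := by
      by_contra hnot
      have := hmax _ (Finset.mem_filter.2 ⟨Finset.mem_univ _, hstd, hnot⟩)
      omega
    have hne := hstd.ne_of_trans_swap hij (by rw [trans_swap_swap]; exact hT)
    obtain ⟨a, b, hb, hab⟩ := h.generic _ hstd i j hij hne.1 hne.2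
    rw [trans_swap_swap] at hab
    apply hbad
    have h3 : v T = b⁻¹ • (ρ (swap i j) (v (T.trans (swap i j))) - a • v (T.trans (swap i j))) := by
      rw [hab, add_sub_cancel_left, smul_smul, inv_mul_cancel₀ hb, one_smul]
    rw [h3]
    exact D.smul_mem _ (D.sub_mem (hD _ _ hin) (D.smul_mem _ hin))
  have hle : Submodule.span F
      (Set.range (fun T : {T : SkewTableau lam mu n // IsStandard T} => v T.1)) ≤ D := by
    rw [Submodule.span_le]
    rintro _ ⟨T, rfl⟩
    exact key T.1 T.2
  exact hle (h.span Submodule.mem_top)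

/-- The Garnir antisymmetrizer kills the vector of the column reading tableau. -/
theorem garnir_columnReading [CharZero F] (h : IsSeminormal ρ v) {Tc : SkewTableau lam mu n}
    (hTc : ∀ i j, i < j → col Tc i < col Tc j ∨ (col Tc i = col Tc j ∧ row Tc i < row Tc j))
    {r c : ℕ} (hrc : (r, c) ∈ skewCells lam mu) (hrc' : (r, c + 1) ∈ skewCells lam mu) :
    ∑ g ∈ permsOf (garnirSet Tc r c), sgn F g • ρ g (v Tc) = 0 := by
  classical
  have hstdc := isStandard_of_columnReading hTc
  set G := garnirSet Tc r c with hGdef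
  obtain ⟨x, hxr, hxc⟩ := exists_letter Tc hrc
  obtain ⟨y, hyr, hyc⟩ := exists_letter Tc hrc'
  have hxG : x ∈ G := mem_garnirSet.2 (Or.inl ⟨hxc, hxr.ge⟩)
  have hyG : y ∈ G := mem_garnirSet.2 (Or.inr ⟨hyc, hyr.le⟩)
  have hcmp : ∀ k l, k ≤ l → col Tc k < col Tc l ∨ (col Tc k = col Tc l ∧ row Tc k ≤ row Tc l) := by
    intro k l hkl
    rcases hkl.eq_or_lt with e | e
    · subst e; exact Or.inr ⟨rfl, le_rfl⟩
    · have := hTc k l e; omega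
  -- In the column reading the belt is an interval of letters, so its permutations are generated by
  -- adjacent transpositions.
  have hconv : ∀ k l m, k ∈ G → m ∈ G → k ≤ l → l ≤ m → l ∈ G := by
    intro k l m hk hm hkl hlm
    rw [hGdef, mem_garnirSet] at hk hm ⊢
    have h1 := hcmp k l hkl
    have h2 := hcmp l m hlm
    omega
  -- The antisymmetrized vector stays in the span of the standard tableaux that differ from `Tc` by
  -- a belt permutation; in these the belt letters still fill the belt boxes.
  let U : Submodule F V := Submodule.span F
    (v '' {T | IsStandard T ∧ ∃ g ∈ permsOf G, T = Tc.trans g})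
  have hUs : ∀ i ∈ G, ∀ j ∈ G, (j : ℕ) = i + 1 → ∀ x ∈ U, ρ (swap i j) x ∈ U := by
    intro i hi j hj hij x hx
    have hle : U ≤ U.comap (ρ (swap i j)) := by
      rw [Submodule.span_le]
      rintro _ ⟨T, ⟨hT, g, hg, hTg⟩, rfl⟩
      rw [SetLike.mem_coe, Submodule.mem_comap]
      have hvT : v T ∈ U := Submodule.subset_span ⟨T, ⟨hT, g, hg, hTg⟩, rfl⟩
      by_cases hr : row T i = row T j
      · rw [h.same_row T hT i j hij hr]
        exact hvT
      · by_cases hc : col T i = col T j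
        · rw [h.same_col T hT i j hij hc]
          exact U.neg_mem hvT
        · obtain ⟨a, b, _, hab⟩ := h.generic T hT i j hij hr hc
          rw [hab]
          refine U.add_mem (U.smul_mem _ hvT) (U.smul_mem _ (Submodule.subset_span
            ⟨_, ⟨hT.trans_swap hij hr hc, swap i j * g,
              mul_mem_permsOf (swap_mem_permsOf hi hj) hg, ?_⟩, rfl⟩))
          rw [hTg, trans_trans]
    exact hle hx
  have hUg : ∀ g ∈ permsOf G, ∀ x ∈ U, ρ g x ∈ U := by
    intro g hg
    refine permsOf_induction hconv (motive := fun g => ∀ x ∈ U, ρ g x ∈ U) (by simp) ?_ g hg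
    intro u _ i hi j hj hij ih x hx
    have := ih _ (hUs i hi j hj hij x hx)
    rwa [← Module.End.mul_apply, ← map_mul, mul_assoc, swap_mul_self, mul_one] at this
  set u := ∑ g ∈ permsOf G, sgn F g • ρ g (v Tc) with hu
  have huU : u ∈ U := U.sum_mem fun g hg => U.smul_mem _ (hUg g hg _
    (Submodule.subset_span ⟨Tc, ⟨hstdc, 1, one_mem_permsOf G, rfl⟩, rfl⟩))
  have hneg : ∀ i ∈ G, ∀ j ∈ G, i ≠ j → ρ (swap i j) u = -u := fun i hi j hj hne =>
    rep_swap_antisymmetrizer ρ (v Tc) hi hj hne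
  by_contra hne
  have hex : ∃ T : {T : SkewTableau lam mu n // IsStandard T}, h.basis.coord T u ≠ 0 := by
    by_contra hno
    push Not at hno
    exact hne (h.basis.ext_elem (fun T => by simpa using hno T))
  obtain ⟨T₀, hT₀⟩ := hex
  -- A nonzero coordinate of least weight, to be contradicted by one of smaller weight.
  obtain ⟨⟨T, hT⟩, hTm, hmin⟩ := Finset.exists_min_image
    (Finset.univ.filter fun T : {T : SkewTableau lam mu n // IsStandard T} =>
      h.basis.coord T u ≠ 0) (fun T => columnWeight T.1)
    ⟨T₀, Finset.mem_filter.2 ⟨Finset.mem_univ _, hT₀⟩⟩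
  have hTu := (Finset.mem_filter.1 hTm).2
  obtain ⟨g, hg, hTg⟩ : ∃ g ∈ permsOf G, T = Tc.trans g := by
    by_contra hno
    have hle : U ≤ LinearMap.ker (h.basis.coord ⟨T, hT⟩) := by
      rw [Submodule.span_le]
      rintro _ ⟨T', ⟨hT', g, hg, hT'g⟩, rfl⟩
      rw [SetLike.mem_coe, LinearMap.mem_ker, h.coord_apply hT hT', if_neg]
      rintro rfl
      exact hno ⟨g, hg, hT'g⟩
    exact hTu (hle huU)
  have hcolG : ∀ k ∈ G, col T k = c ∨ col T k = c + 1 := by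
    intro k hk
    have := mem_of_mem_permsOf (inv_mem_permsOf hg) hk
    rw [hGdef, mem_garnirSet] at this
    rw [hTg, col_trans]
    omega
  have hp : col T (g x) = c ∧ row T (g x) = r := by
    rw [hTg, col_trans, row_trans]
    simp [hxc, hxr]
  have hq : col T (g y) = c + 1 ∧ row T (g y) = r := by
    rw [hTg, col_trans, row_trans]
    simp [hyc, hyr]
  have hpG := mem_of_mem_permsOf hg hxG
  have hqG := mem_of_mem_permsOf hg hyG
  have hpq : g x < g y := (isStandard_iff.1 hT).1 _ _ (by omega) (by omega)
  -- Between the letters at `(r, c)` and `(r, c + 1)` there is a last letter `i` in column `c`; its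
  -- successor `j` is then in column `c + 1`.
  obtain ⟨i, hi, himax⟩ := Finset.exists_max_image
    (Finset.univ.filter fun k => g x ≤ k ∧ k < g y ∧ col T k = c) id
    ⟨g x, Finset.mem_filter.2 ⟨Finset.mem_univ _, le_rfl, hpq, hp.1⟩⟩
  obtain ⟨-, hi1, hi2, hi3⟩ := Finset.mem_filter.1 hi
  have hjn : (i : ℕ) + 1 < n := by
    rw [Fin.lt_def] at hi2
    omega
  obtain ⟨j, hij⟩ : ∃ j : Fin n, (j : ℕ) = i + 1 := ⟨⟨i + 1, hjn⟩, rfl⟩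
  have hij' : i < j := by rw [Fin.lt_def]; omega
  have hjq : j ≤ g y := by
    rw [Fin.lt_def] at hi2
    rw [Fin.le_def]
    omega
  have hiG : i ∈ G := hconv _ _ _ hpG hqG hi1 hi2.le
  have hjG : j ∈ G := hconv _ _ _ hpG hqG (hi1.trans hij'.le) hjq
  have hj3 : col T j = c + 1 := by
    rcases hcolG j hjG with e | e
    · have hjq' : j < g y := by
        refine lt_of_le_of_ne hjq (fun e' => ?_)
        rw [e', hq.1] at e
        omega
      have := himax j (Finset.mem_filter.2 ⟨Finset.mem_univ _, hi1.trans hij'.le, hjq', e⟩)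
      exact absurd this (not_le.2 hij')
    · exact e
  have hsu := hneg i hiG j hjG hij'.ne
  -- As the transposition negates `u`, equal rows would make the coordinate at `T` zero. In
  -- different rows the exchanged tableau also has a nonzero coordinate, and its weight is smaller
  -- by one.
  by_cases hr : row T i = row T j
  · have h1 := h.coord_rep_of_same_row hT hij hr u
    rw [hsu, map_neg] at h1
    exact hTu (self_eq_neg.1 h1.symm)
  · have hc : col T i ≠ col T j := by omega
    obtain ⟨a, b, hb, hab⟩ := h.coord_rep_of_generic hT hij hr hc
    have h1 := hab u
    rw [hsu, map_neg] at h1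
    have h2 : h.basis.coord ⟨_, hT.trans_swap hij hr hc⟩ u ≠ 0 := by
      intro h0
      rw [h0, neg_zero, mul_zero, add_zero] at h1
      exact hTu ((mul_eq_zero.1 h1.symm).resolve_left hb)
    have h3 := hmin _ (Finset.mem_filter.2 ⟨Finset.mem_univ _, h2⟩)
    have h4 := columnWeight_trans_swap T hij
    simp only at h3
    omega

end IsSeminormal

end Seminormal

end AbstractYoung

namespace AbstractYoung

open Equiv SkewTableau

/-! ### Comparison of seminormal bases with the skew Specht module -/

section SeminormalSpecht

variable {F : Type*} [Field F] [CharZero F] {lam mu : YoungDiagram} {n : ℕ}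
  {V : Type*} [AddCommGroup V] [Module F V]

theorem card_skewCells_of_tableau (T : SkewTableau lam mu n) : (skewCells lam mu).card = n := by
  rw [← Fintype.card_coe, Fintype.card_congr T, Fintype.card_fin]

/-- A polytabloid as an element of the skew Specht module. -/
noncomputable def spechtVec (F : Type*) [Field F] (T : SkewTableau lam mu n) :
    (spechtSub F n lam mu).toSubmodule :=
  ⟨polytabloid F T, Submodule.subset_span ⟨T, rfl⟩⟩

/-- The basis of standard polytabloids. -/
noncomputable def spechtBasis (F : Type*) [Field F] [CharZero F] (n : ℕ) (lam mu : YoungDiagram) :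
    Module.Basis {T : SkewTableau lam mu n // IsStandard T} F
      (spechtSub F n lam mu).toSubmodule :=
  Module.Basis.mk (v := fun T => spechtVec F T.1)
    (LinearIndependent.of_comp (spechtSub F n lam mu).toSubmodule.subtype
      linearIndependent_polytabloid) (by
    have hle : Submodule.span F (Set.range (fun T : SkewTableau lam mu n => polytabloid F T)) ≤
        Submodule.span F ((fun T : SkewTableau lam mu n => polytabloid F T) ''
          {T' | IsStandard T'}) := by
      rw [Submodule.span_le]
      rintro _ ⟨T, rfl⟩
      exact straightening polytabloid_isColumnAlternating polytabloid_satisfiesGarnir T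
    have himg : (fun T : SkewTableau lam mu n => polytabloid F T) '' {T' | IsStandard T'} =
        (spechtSub F n lam mu).toSubmodule.subtype '' Set.range
          (fun T : {T : SkewTableau lam mu n // IsStandard T} =>
            spechtVec F T.1) := by
      ext y
      constructor
      · rintro ⟨T, hT, rfl⟩
        exact ⟨spechtVec F T, ⟨⟨T, hT⟩, rfl⟩, rfl⟩
      · rintro ⟨_, ⟨T, rfl⟩, rfl⟩
        exact ⟨T.1, T.2, rfl⟩
    rw [himg, ← Submodule.map_span] at hle
    rintro ⟨y, hy⟩ _
    obtain ⟨z, hz, hzy⟩ := hle hy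
    have : z = ⟨y, hy⟩ := Subtype.ext hzy
    exact this ▸ hz)

theorem spechtBasis_apply (T : {T : SkewTableau lam mu n // IsStandard T}) :
    spechtBasis F n lam mu T = spechtVec F T.1 := by
  simp [spechtBasis]

variable {ρ : Representation F (Perm (Fin n)) V}

/-- The translates of a vector `x` attached to the tableau `T₀`. -/
noncomputable def translate (ρ : Representation F (Perm (Fin n)) V)
    (T₀ : SkewTableau lam mu n) (x : V) (T : SkewTableau lam mu n) : V :=
  ρ (T₀.symm.trans T : Perm (Fin n)) x

omit [CharZero F] in
theorem translate_trans (T₀ : SkewTableau lam mu n) (x : V) (T : SkewTableau lam mu n)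
    (g : Perm (Fin n)) : translate ρ T₀ x (T.trans g) = ρ g (translate ρ T₀ x T) := by
  unfold translate
  rw [← Module.End.mul_apply, ← map_mul]
  rfl

omit [CharZero F] in
theorem translate_self (T₀ : SkewTableau lam mu n) (x : V) : translate ρ T₀ x T₀ = x := by
  unfold translate
  rw [Equiv.symm_trans_self]
  exact LinearMap.congr_fun (map_one ρ) x

-- The column groups of all tableaux are conjugate and the sign is a class function, so the relation
-- at `T₀` yields it at every translate.
omit [CharZero F] in
theorem isColumnAlternating_translate {T₀ : SkewTableau lam mu n} {x : V}
    (hx : ∀ g ∈ columnGroup T₀, ρ g x = sgn F g • x) :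
    IsColumnAlternating F (translate ρ T₀ x) := by
  intro T g hg
  rw [translate_trans]
  unfold translate
  set k : Perm (Fin n) := T₀.symm.trans T with hk
  have hcolk : ∀ m, col T (k m) = col T₀ m := by
    intro m
    simp [hk, col]
  have h1 := hx (k⁻¹ * g * k) (mem_columnGroup.2 (by
      intro m
      have h3 : k ((k⁻¹ * g * k) m) = g (k m) := by simp
      rw [← hcolk, ← hcolk m, h3, mem_columnGroup.1 hg]))
  have h2 : g * k = k * (k⁻¹ * g * k) := by group
  rw [← Module.End.mul_apply, ← map_mul, h2, map_mul, Module.End.mul_apply, h1, map_smul,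
    sgn_mul, sgn_mul, sgn_inv, mul_right_comm, sgn_mul_self, one_mul]

omit [CharZero F] in
theorem satisfiesGarnir_translate {T₀ : SkewTableau lam mu n} {x : V}
    (hx : ∀ r c, (r, c) ∈ skewCells lam mu → (r, c + 1) ∈ skewCells lam mu →
      ∑ g ∈ permsOf (garnirSet T₀ r c), sgn F g • ρ g x = 0) :
    SatisfiesGarnir F (translate ρ T₀ x) := by
  intro T r c hrc hrc'
  have h0 := hx r c hrc hrc'
  set k : Perm (Fin n) := T₀.symm.trans T with hk
  have hcolk : ∀ m, col T (k m) = col T₀ m := by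
    intro m
    simp [hk, col]
  have hrowk : ∀ m, row T (k m) = row T₀ m := by
    intro m
    simp [hk, row]
  have hmem : ∀ m, k m ∈ garnirSet T r c ↔ m ∈ garnirSet T₀ r c := by
    intro m
    rw [mem_garnirSet, mem_garnirSet, hcolk, hrowk]
  have h1 : ∑ g ∈ permsOf (garnirSet T r c), sgn F g • translate ρ T₀ x (T.trans g) =
      ρ k (∑ g ∈ permsOf (garnirSet T₀ r c), sgn F g • ρ g x) := by
    rw [map_sum]
    refine Finset.sum_bij' (fun g _ => k⁻¹ * g * k) (fun g _ => k * g * k⁻¹) ?_ ?_ ?_ ?_ ?_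
    · intro g hg
      rw [mem_permsOf] at hg ⊢
      intro m hm
      rw [Perm.mul_apply, Perm.mul_apply, hg (k m) (fun h => hm ((hmem m).1 h))]
      simp
    · intro g hg
      rw [mem_permsOf] at hg ⊢
      intro m hm
      rw [Perm.mul_apply, Perm.mul_apply, hg (k⁻¹ m) (fun h => hm (by simpa using (hmem _).2 h))]
      simp
    · intro g _; group
    · intro g _; group
    · intro g _
      rw [translate_trans, map_smul, sgn_mul, sgn_mul, sgn_inv, mul_right_comm, sgn_mul_self,
        one_mul]
      unfold translate
      rw [← Module.End.mul_apply, ← Module.End.mul_apply, ← map_mul, ← map_mul]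
      congr 3
      rw [← hk]
      group
  rw [h1, h0, map_zero]

/-- The skew Specht module maps to every vector satisfying the column and the Garnir relations. -/
theorem exists_linearMap_of_relations {T₀ : SkewTableau lam mu n} {x : V}
    (hcol : IsColumnAlternating F (translate ρ T₀ x))
    (hgar : SatisfiesGarnir F (translate ρ T₀ x)) :
    ∃ L : (spechtSub F n lam mu).toSubmodule →ₗ[F] V,
      (∀ g, L ∘ₗ skewSpecht F n lam mu g = ρ g ∘ₗ L) ∧ x ∈ LinearMap.range L := by
  classical
  let Φ := translate ρ T₀ x
  let B := spechtBasis F n lam mu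
  have hB : ∀ T, B T = spechtVec F T.1 := spechtBasis_apply
  let L : (spechtSub F n lam mu).toSubmodule →ₗ[F] V := B.constr F (fun T => Φ T.1)
  have hLstd : ∀ T, IsStandard T → L (spechtVec F T) = Φ T := by
    intro T hT
    rw [← hB ⟨T, hT⟩]
    exact B.constr_basis F _ _
  have hL : ∀ T, L (spechtVec F T) = Φ T := by
    intro T
    -- Straightening the pair `(e_T, Φ T)` uses the same coefficients in both components. So the map
    -- prescribed on standard polytabloids takes every `e_T` to `Φ T`.
    let Ψ : SkewTableau lam mu n → ((Fin n → ℕ) →₀ F) × V := fun T => (polytabloid F T, Φ T)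
    have h1 : IsColumnAlternating F Ψ := fun T g hg =>
      Prod.ext (polytabloid_isColumnAlternating T g hg)
        (hcol T g hg)
    have h2 : SatisfiesGarnir F Ψ := fun T r c hr hc => by
      refine Prod.ext ?_ ?_
      · rw [Prod.fst_sum]
        exact polytabloid_satisfiesGarnir T r c hr hc
      · rw [Prod.snd_sum]
        exact hgar T r c hr hc
    have h3 := straightening h1 h2 T
    have h4 : Submodule.span F (Ψ '' {T' | IsStandard T'}) ≤
        LinearMap.range ((spechtSub F n lam mu).toSubmodule.subtype.prod L) := by
      rw [Submodule.span_le]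
      rintro _ ⟨T', hT', rfl⟩
      exact ⟨spechtVec F T', Prod.ext rfl (hLstd T' hT')⟩
    obtain ⟨s, hs⟩ := h4 h3
    have hs1 : s = spechtVec F T := Subtype.ext (congrArg Prod.fst hs)
    rw [← hs1]
    exact congrArg Prod.snd hs
  have hequiv : ∀ g, L ∘ₗ skewSpecht F n lam mu g = ρ g ∘ₗ L := by
    intro g
    refine B.ext (fun T => ?_)
    rw [LinearMap.comp_apply, LinearMap.comp_apply, hB]
    have h1 : skewSpecht F n lam mu g (spechtVec F T.1) = spechtVec F (T.1.trans g) :=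
      Subtype.ext (tabloidRep_polytabloid F g T.1)
    rw [h1, hL, hL]
    exact translate_trans T₀ x T.1 g
  refine ⟨L, hequiv, spechtVec F T₀, ?_⟩
  rw [hL]
  exact translate_self T₀ x

namespace IsSeminormal

variable {v : SkewTableau lam mu n → V}

omit [CharZero F] in
theorem rep_columnReading (h : IsSeminormal ρ v) {Tc : SkewTableau lam mu n}
    (hTc : ∀ i j, i < j → col Tc i < col Tc j ∨ (col Tc i = col Tc j ∧ row Tc i < row Tc j))
    {g : Perm (Fin n)} (hg : g ∈ columnGroup Tc) : ρ g (v Tc) = sgn F g • v Tc := by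
  have hmono : Monotone (col Tc) := by
    intro i j hij
    rcases hij.eq_or_lt with e | e
    · rw [e]
    · have := hTc i j e
      omega
  exact rep_eq_sgn_smul hmono
    (fun i j hij hc => h.same_col Tc (isStandard_of_columnReading hTc) i j hij hc) g
    (mem_columnGroup.1 hg)

/-- A representation with a seminormal basis indexed by the standard tableaux of a skew shape is
isomorphic to the corresponding skew Specht module. -/
theorem nonempty_equiv_skewSpecht (h : IsSeminormal ρ v)
    (hcard : (skewCells lam mu).card = n) : Nonempty (ρ.Equiv (skewSpecht F n lam mu)) := by
  classical
  obtain ⟨Tc, hTc⟩ := exists_columnReading hcard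
  obtain ⟨L, hequiv, hx⟩ := exists_linearMap_of_relations (ρ := ρ) (T₀ := Tc) (x := v Tc)
    (isColumnAlternating_translate fun g hg => h.rep_columnReading hTc hg)
    (satisfiesGarnir_translate fun r c hr hc => h.garnir_columnReading hTc hr hc)
  -- The range is invariant and contains the generating vector. Injectivity follows by dimension,
  -- both bases being indexed by the standard tableaux.
  have hsurj : Function.Surjective L := by
    intro x
    have : x ∈ LinearMap.range L := by
      refine h.mem_of_columnReading hTc ?_ hx x
      rintro g _ ⟨s, rfl⟩
      exact ⟨skewSpecht F n lam mu g s, LinearMap.congr_fun (hequiv g) s⟩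
    exact this
  have B := spechtBasis F n lam mu
  have hfin : FiniteDimensional F (spechtSub F n lam mu).toSubmodule := Module.Finite.of_basis B
  have hfinV : FiniteDimensional F V := Module.Finite.of_basis h.basis
  have hrank : Module.finrank F (spechtSub F n lam mu).toSubmodule = Module.finrank F V := by
    rw [Module.finrank_eq_card_basis B, Module.finrank_eq_card_basis h.basis]
  have hiff := @LinearMap.injective_iff_surjective_of_finrank_eq_finrank F
    (spechtSub F n lam mu).toSubmodule _ _ _ V _ _ _ _ hrank L
  have hinj : Function.Injective L := hiff.2 hsurj
  exact ⟨(Representation.Equiv.mk (LinearEquiv.ofBijective L ⟨hinj, hsurj⟩) hequiv).symm⟩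

end IsSeminormal

end SeminormalSpecht

end AbstractYoung

namespace AbstractYoung

open Equiv

/-! ### The Coxeter presentation of the symmetric group -/

section Coxeter

variable {n : ℕ} {M : Type*} [Monoid M]

open Classical in
/-- The product of the values of `R` along a reduced word. -/
noncomputable def wordProd (R : Fin n → M) (u : Perm (Fin n)) : M :=
  if h : u = 1 then 1 else
    wordProd R (u * swap (exists_descent h).choose (exists_descent h).choose_spec.choose) *
      R (exists_descent h).choose
termination_by length u
decreasing_by
  have h1 := (exists_descent h).choose_spec.choose_spec
  have h2 := length_mul_swap_adjacent_of_gt h1.1 h1.2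
  omega

/-- `R` satisfies the Coxeter relations of the adjacent transpositions. -/
structure SatisfiesCoxeter (R : Fin n → M) : Prop where
  mul_self : ∀ i j : Fin n, (j : ℕ) = i + 1 → R i * R i = 1
  braid : ∀ i j k : Fin n, (j : ℕ) = i + 1 → (k : ℕ) = j + 1 →
    R i * R j * R i = R j * R i * R j
  comm : ∀ i i' j j' : Fin n, (i' : ℕ) = i + 1 → (j' : ℕ) = j + 1 → i' < j → R i * R j = R j * R i

theorem swap_mul_swap_comm_of_disjoint {i i' j j' : Fin n} (h1 : i ≠ j) (h2 : i ≠ j') (h3 : i' ≠ j)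
    (h4 : i' ≠ j') : swap i i' * swap j j' = swap j j' * swap i i' := by
  ext k
  simp only [Perm.mul_apply]
  by_cases hi : k = i
  · subst hi
    rw [swap_apply_of_ne_of_ne h1 h2, swap_apply_left, swap_apply_of_ne_of_ne h3 h4]
  · by_cases hi' : k = i'
    · subst hi'
      rw [swap_apply_of_ne_of_ne h3 h4, swap_apply_right, swap_apply_of_ne_of_ne h1 h2]
    · rw [swap_apply_of_ne_of_ne hi hi']
      by_cases hj : k = j
      · subst hj
        rw [swap_apply_left, swap_apply_of_ne_of_ne h2.symm h4.symm]
      · by_cases hj' : k = j'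
        · subst hj'
          rw [swap_apply_right, swap_apply_of_ne_of_ne h1.symm h3.symm]
        · rw [swap_apply_of_ne_of_ne hj hj', swap_apply_of_ne_of_ne hi hi']

theorem swap_braid {i j k : Fin n} (hij : i ≠ j) (hjk : j ≠ k) (hik : i ≠ k) :
    swap i j * swap j k * swap i j = swap j k * swap i j * swap j k := by
  have h1 := swap_mul_swap_mul_swap hjk.symm hik.symm
  have h2 := swap_mul_swap_mul_swap hij hik
  rw [swap_comm j i, swap_comm k j] at h1
  rw [h1, h2, swap_comm]

/-- A diamond argument, by induction on length: any two descents of `u` lead to the same product,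
because the two branches meet again further down through a braid or a commutation relation. Hence
the chosen descent does not matter. -/
theorem wordProd_of_descent {R : Fin n → M} (hR : SatisfiesCoxeter R) (u : Perm (Fin n))
    {i j : Fin n} (hij : (j : ℕ) = i + 1) (hd : u j < u i) :
    wordProd R u = wordProd R (u * swap i j) * R i := by
  induction hl : length u using Nat.strong_induction_on generalizing u i j with
  | _ l ih =>
    have hu : u ≠ 1 := by
      rintro rfl
      rw [Fin.lt_def] at hd
      simp at hd
      omega
    -- two descents of the same permutation give the same product
    have hdiamond : ∀ (i i' j j' : Fin n), (i' : ℕ) = i + 1 → (j' : ℕ) = j + 1 → i < j →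
        u i' < u i → u j' < u j →
        wordProd R (u * swap i i') * R i = wordProd R (u * swap j j') * R j := by
      intro i i' j j' hi hj hlt hdi hdj
      have hli := length_mul_swap_adjacent_of_gt hi hdi
      have hlj := length_mul_swap_adjacent_of_gt hj hdj
      rw [Fin.lt_def] at hlt
      have nij : i ≠ j := fun h => by subst h; omega
      have nij' : i ≠ j' := fun h => by subst h; omega
      have nii' : i ≠ i' := fun h => by subst h; omega
      have njj' : j ≠ j' := fun h => by subst h; omega
      have nij'' : i' ≠ j' := fun h => by subst h; omega
      -- At neighbouring positions `u` has three decreasing letters and the branches meet after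
      -- three steps; at distant positions they meet after two.
      by_cases hadj : i' = j
      · subst hadj
        have h1 := ih _ (by omega) (u * swap i i') hj (by
          simp only [Perm.mul_apply, swap_apply_right]
          rw [swap_apply_of_ne_of_ne nij'.symm nij''.symm]
          exact hdj.trans hdi) rfl
        have hl1 := length_mul_swap_adjacent_of_gt (u := u * swap i i') hj (by
          simp only [Perm.mul_apply, swap_apply_right]
          rw [swap_apply_of_ne_of_ne nij'.symm nij''.symm]
          exact hdj.trans hdi)
        have h2 := ih _ (by omega) (u * swap i i' * swap i' j') hi (by
          simp only [Perm.mul_apply, swap_apply_left]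
          rw [swap_apply_of_ne_of_ne nii' nij', swap_apply_left,
            swap_apply_of_ne_of_ne nij'.symm nij''.symm]
          exact hdj) rfl
        have h3 := ih _ (by omega) (u * swap i' j') hi (by
          simp only [Perm.mul_apply, swap_apply_left]
          rw [swap_apply_of_ne_of_ne nii' nij']
          exact hdj.trans hdi) rfl
        have hl3 := length_mul_swap_adjacent_of_gt (u := u * swap i' j') hi (by
          simp only [Perm.mul_apply, swap_apply_left]
          rw [swap_apply_of_ne_of_ne nii' nij']
          exact hdj.trans hdi)
        have h4 := ih _ (by omega) (u * swap i' j' * swap i i') hj (by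
          simp only [Perm.mul_apply, swap_apply_right]
          rw [swap_apply_of_ne_of_ne nij'.symm nij''.symm, swap_apply_right,
            swap_apply_of_ne_of_ne nii' nij']
          exact hdi) rfl
        have h5 : u * swap i i' * swap i' j' * swap i i' =
            u * swap i' j' * swap i i' * swap i' j' := by
          have := swap_braid nii' nij'' nij'
          rw [mul_assoc, mul_assoc, ← mul_assoc (swap i i'), this]
          group
        rw [h1, h2, h3, h4, h5, mul_assoc, mul_assoc, ← mul_assoc (R i), hR.braid i i' j' hi hj]
        simp only [mul_assoc]
      · have hi'j : i' < j := by
          rw [Fin.lt_def]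
          have : (i' : ℕ) ≠ j := fun h => hadj (Fin.ext h)
          omega
        have h1 := ih _ (by omega) (u * swap i i') hj (by
          simp only [Perm.mul_apply]
          rwa [swap_apply_of_ne_of_ne nij'.symm nij''.symm,
            swap_apply_of_ne_of_ne nij.symm (Ne.symm hadj)]) rfl
        have h2 := ih _ (by omega) (u * swap j j') hi (by
          simp only [Perm.mul_apply]
          rwa [swap_apply_of_ne_of_ne hadj nij'', swap_apply_of_ne_of_ne nij nij']) rfl
        rw [h1, h2, mul_assoc u, swap_mul_swap_comm_of_disjoint nij nij' hadj nij'', ← mul_assoc,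
          mul_assoc (wordProd R _), ← hR.comm i i' j j' hi hj hi'j, ← mul_assoc]
    have key : ∀ p q : Fin n, (q : ℕ) = p + 1 → u q < u p →
        wordProd R (u * swap p q) * R p = wordProd R (u * swap i j) * R i := by
      intro p q h1 h2
      rcases lt_trichotomy p i with h | h | h
      · exact hdiamond p q i j h1 hij h h2 hd
      · subst h
        rw [Fin.ext (h1.trans hij.symm)]
      · exact (hdiamond i j p q hij h1 h hd h2).symm
    rw [wordProd, dif_neg hu]
    obtain ⟨h1, h2⟩ := (exists_descent hu).choose_spec.choose_spec
    exact key _ _ h1 h2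

theorem wordProd_mul_swap {R : Fin n → M} (hR : SatisfiesCoxeter R) (u : Perm (Fin n))
    {i j : Fin n} (hij : (j : ℕ) = i + 1) :
    wordProd R (u * swap i j) = wordProd R u * R i := by
  rcases lt_or_ge (u j) (u i) with h | h
  · rw [wordProd_of_descent hR u hij h, mul_assoc, hR.mul_self i j hij, mul_one]
  · have hne : i ≠ j := fun e => by subst e; omega
    have h' : u i < u j := lt_of_le_of_ne h (fun e => hne (u.injective e))
    rw [wordProd_of_descent hR (u * swap i j) hij (by simpa using h'), mul_assoc u, swap_mul_self,
      mul_one]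

theorem wordProd_one (R : Fin n → M) : wordProd R 1 = 1 := by
  rw [wordProd, dif_pos rfl]

/-- The symmetric group is presented by the Coxeter relations. -/
theorem exists_monoidHom_of_coxeter {R : Fin n → M} (hR : SatisfiesCoxeter R) :
    ∃ φ : Perm (Fin n) →* M, ∀ i j : Fin n, (j : ℕ) = i + 1 → φ (swap i j) = R i := by
  refine ⟨{ toFun := wordProd R, map_one' := wordProd_one R, map_mul' := ?_ }, ?_⟩
  · intro u v
    refine simple_induction v ?_ ?_
    · rw [mul_one, wordProd_one, mul_one]
    · intro w i j hij h
      rw [← mul_assoc, wordProd_mul_swap hR _ hij, h, wordProd_mul_swap hR _ hij, mul_assoc]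
  · intro i j hij
    have := wordProd_mul_swap hR 1 hij
    rw [one_mul, wordProd_one, one_mul] at this
    exact this

end Coxeter

end AbstractYoung

namespace AbstractYoung

open Equiv

/-! ### The representation attached to a functional -/

section FunctionalRep

variable {F : Type*} [Field F] {n : ℕ}

theorem cellVec_of_mem {K : Finset (Perm (Fin n))} {g : Perm (Fin n)} (h : g ∈ K) :
    cellVec F K g = Finsupp.single ⟨g, h⟩ 1 := by
  simp [cellVec, h]

theorem cellVec_of_notMem {K : Finset (Perm (Fin n))} {g : Perm (Fin n)} (h : g ∉ K) :
    cellVec F K g = 0 := by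
  simp [cellVec, h]

theorem cellVec_ext {K : Finset (Perm (Fin n))} {V : Type*} [AddCommGroup V] [Module F V]
    {φ ψ : (K →₀ F) →ₗ[F] V} (h : ∀ w ∈ K, φ (cellVec F K w) = ψ (cellVec F K w)) : φ = ψ := by
  refine Finsupp.lhom_ext' (fun w => LinearMap.ext_ring ?_)
  have := h w.1 w.2
  rwa [cellVec_of_mem w.2] at this

theorem conj_swap (w : Perm (Fin n)) (i j : Fin n) :
    w * swap i j * w⁻¹ = swap (w i) (w j) := by
  rw [swap_apply_apply]

theorem pairing_swap_of_gt (f : Fin n → F) {i j : Fin n} (hij : j < i) :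
    pairing f (swap i j) = f i - f j := by
  rw [swap_comm, pairing_swap f hij]

/-- The combinatorial properties of the set of standard fillings by which the seminormal operators
on it satisfy the Coxeter relations. -/
structure IsContentCell (K : Finset (Perm (Fin n))) (f : Fin n → F) : Prop where
  mul_swap_mem : ∀ w ∈ K, ∀ i j : Fin n, (j : ℕ) = i + 1 →
    f (w j) - f (w i) ≠ 1 → f (w j) - f (w i) ≠ -1 → w * swap i j ∈ K
  inner : ∀ w ∈ K, ∀ i j : Fin n, (j : ℕ) = i + 1 → w * swap i j ∈ K →
    f (w j) - f (w i) ≠ 1 ∧ f (w j) - f (w i) ≠ -1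
  ne : ∀ w ∈ K, ∀ i j : Fin n, (j : ℕ) = i + 1 → f (w i) ≠ f (w j)
  ne_two : ∀ w ∈ K, ∀ i j k : Fin n, (j : ℕ) = i + 1 → (k : ℕ) = j + 1 → f (w i) ≠ f (w k)

open Classical in
/-- The off-diagonal coefficient as a function of the two letters that are exchanged. -/
noncomputable def offDiag (f : Fin n → F) (bUp bDown : Perm (Fin n) → F) (x y : Fin n) : F :=
  if f y - f x = 1 ∨ f y - f x = -1 then 0 else
    if x < y then bUp (swap x y) else bDown (swap x y)

open Classical in
/-- The seminormal operator of the adjacent transposition at position `i`. -/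
noncomputable def seminormalOp (K : Finset (Perm (Fin n))) (f : Fin n → F)
    (bUp bDown : Perm (Fin n) → F) (i : Fin n) : Module.End F (K →₀ F) :=
  if h : (i : ℕ) + 1 < n then
    Finsupp.linearCombination F (fun w : K =>
      (f (w.1 ⟨i + 1, h⟩) - f (w.1 i))⁻¹ • cellVec F K w.1 +
        offDiag f bUp bDown (w.1 i) (w.1 ⟨i + 1, h⟩) • cellVec F K (w.1 * swap i ⟨i + 1, h⟩))
  else 1

variable {K : Finset (Perm (Fin n))} {f : Fin n → F} {bUp bDown : Perm (Fin n) → F}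

theorem seminormalOp_apply {w : Perm (Fin n)} (hw : w ∈ K) {i j : Fin n} (hij : (j : ℕ) = i + 1) :
    seminormalOp K f bUp bDown i (cellVec F K w) =
      (f (w j) - f (w i))⁻¹ • cellVec F K w +
        offDiag f bUp bDown (w i) (w j) • cellVec F K (w * swap i j) := by
  have hlt : (i : ℕ) + 1 < n := by omega
  have hj : j = ⟨i + 1, hlt⟩ := Fin.ext hij
  subst hj
  rw [seminormalOp, dif_pos hlt, cellVec_of_mem hw, Finsupp.linearCombination_single, one_smul,
    ← cellVec_of_mem hw]

/-- The action formula is available only at words of `K`. When `w * swap i j` leaves `K` the factor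
in front vanishes, so the Coxeter relations can be computed without case distinctions. -/
theorem IsContentCell.offDiag_smul_apply (hK : IsContentCell K f) {w : Perm (Fin n)} (hw : w ∈ K)
    {i j : Fin n} (hij : (j : ℕ) = i + 1) {i' j' : Fin n} (hij' : (j' : ℕ) = i' + 1) :
    offDiag f bUp bDown (w i) (w j) •
        seminormalOp K f bUp bDown i' (cellVec F K (w * swap i j)) =
      offDiag f bUp bDown (w i) (w j) •
        ((f ((w * swap i j) j') - f ((w * swap i j) i'))⁻¹ • cellVec F K (w * swap i j) +
          offDiag f bUp bDown ((w * swap i j) i') ((w * swap i j) j') •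
            cellVec F K (w * swap i j * swap i' j')) := by
  by_cases h : f (w j) - f (w i) = 1 ∨ f (w j) - f (w i) = -1
  · have : offDiag f bUp bDown (w i) (w j) = 0 := by rw [offDiag, if_pos h]
    rw [this, zero_smul, zero_smul]
  · rw [not_or] at h
    rw [seminormalOp_apply (hK.mul_swap_mem w hw i j hij h.1 h.2) hij']

theorem IsContentCell.offDiag_smul_smul_apply (hK : IsContentCell K f) {w : Perm (Fin n)}
    (hw : w ∈ K) {i j : Fin n} (hij : (j : ℕ) = i + 1) {i' j' : Fin n} (hij' : (j' : ℕ) = i' + 1)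
    {k l : Fin n} (hkl : (l : ℕ) = k + 1) :
    offDiag f bUp bDown (w i) (w j) •
        offDiag f bUp bDown ((w * swap i j) i') ((w * swap i j) j') •
          seminormalOp K f bUp bDown k (cellVec F K (w * swap i j * swap i' j')) =
      offDiag f bUp bDown (w i) (w j) •
        offDiag f bUp bDown ((w * swap i j) i') ((w * swap i j) j') •
          ((f ((w * swap i j * swap i' j') l) - f ((w * swap i j * swap i' j') k))⁻¹ •
            cellVec F K (w * swap i j * swap i' j') +
          offDiag f bUp bDown ((w * swap i j * swap i' j') k) ((w * swap i j * swap i' j') l) •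
            cellVec F K (w * swap i j * swap i' j' * swap k l)) := by
  by_cases h : f (w j) - f (w i) = 1 ∨ f (w j) - f (w i) = -1
  · have : offDiag f bUp bDown (w i) (w j) = 0 := by rw [offDiag, if_pos h]
    rw [this, zero_smul, zero_smul]
  · rw [not_or] at h
    rw [hK.offDiag_smul_apply (hK.mul_swap_mem w hw i j hij h.1 h.2) hij' hkl]

/-- Where the difference is `±1` both sides vanish; elsewhere this is the normalization. -/
theorem IsContentCell.offDiag_mul_offDiag (hK : IsContentCell K f)
    (hb : IsNormalization K f bUp bDown) {w : Perm (Fin n)} (hw : w ∈ K) {i j : Fin n}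
    (hij : (j : ℕ) = i + 1) :
    offDiag f bUp bDown (w i) (w j) * offDiag f bUp bDown (w j) (w i) =
      1 - ((f (w j) - f (w i))⁻¹) ^ 2 := by
  have hne : i ≠ j := fun e => by subst e; omega
  have hwne : w i ≠ w j := fun e => hne (w.injective e)
  by_cases h : f (w j) - f (w i) = 1 ∨ f (w j) - f (w i) = -1
  · rw [offDiag, if_pos h, zero_mul]
    rcases h with h | h <;> rw [h] <;> norm_num
  · have h' : ¬ (f (w i) - f (w j) = 1 ∨ f (w i) - f (w j) = -1) := by
      intro h'
      apply h
      rcases h' with h' | h'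
      · exact Or.inr (by linear_combination -h')
      · exact Or.inl (by linear_combination -h')
    have hnot := not_or.1 h
    have hmem := hK.mul_swap_mem w hw i j hij hnot.1 hnot.2
    have hin : swap (w i) (w j) ∈ innerReflections K :=
      ⟨swap i j, w, isSimple_swap hij, hw, hmem, (conj_swap w i j).symm⟩
    have hprod := hb _ hin
    rw [offDiag, if_neg h, offDiag, if_neg h', swap_comm (w j) (w i)]
    rcases lt_or_gt_of_ne hwne with hlt | hlt
    · rw [if_pos hlt, if_neg (lt_asymm hlt), hprod, pairing_swap f hlt]
      ring
    · rw [if_neg (lt_asymm hlt), if_pos hlt, mul_comm, hprod, pairing_swap_of_gt f hlt,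
        ← neg_sub (f (w j)), inv_neg]
      ring

/-- The quadratic relation is the product formula for the off-diagonal coefficients. The braid
relation rests on `1/(x y) = (1/x + 1/y)/(x + y)` for successive differences; `ne` and `ne_two` keep
the denominators nonzero. -/
theorem IsContentCell.satisfiesCoxeter (hK : IsContentCell K f)
    (hb : IsNormalization K f bUp bDown) : SatisfiesCoxeter (seminormalOp K f bUp bDown) where
  mul_self i j hij := by
    refine cellVec_ext (fun w hw => ?_)
    rw [Module.End.mul_apply, seminormalOp_apply hw hij, map_add, map_smul, map_smul,
      seminormalOp_apply hw hij, hK.offDiag_smul_apply hw hij hij, mul_assoc, swap_mul_self,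
      mul_one, Module.End.one_apply]
    simp only [Perm.mul_apply, swap_apply_left, swap_apply_right]
    have h := hK.offDiag_mul_offDiag hb hw hij
    have h2 : (f (w i) - f (w j))⁻¹ = - (f (w j) - f (w i))⁻¹ := by
      rw [← neg_sub (f (w j)), inv_neg]
    rw [h2]
    linear_combination (norm := module) h • cellVec F K w
  comm i i' j j' hi hj hlt := by
    refine cellVec_ext (fun w hw => ?_)
    rw [Fin.lt_def] at hlt
    have n1 : i ≠ j := fun h => by subst h; omega
    have n2 : i ≠ j' := fun h => by subst h; omega
    have n3 : i' ≠ j := fun h => by subst h; omega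
    have n4 : i' ≠ j' := fun h => by subst h; omega
    rw [Module.End.mul_apply, Module.End.mul_apply, seminormalOp_apply hw hi,
      seminormalOp_apply hw hj, map_add, map_add, map_smul, map_smul, map_smul, map_smul,
      seminormalOp_apply hw hi, seminormalOp_apply hw hj, hK.offDiag_smul_apply hw hi hj,
      hK.offDiag_smul_apply hw hj hi, mul_assoc w, mul_assoc w,
      swap_mul_swap_comm_of_disjoint n1 n2 n3 n4]
    simp only [Perm.mul_apply, swap_apply_of_ne_of_ne n1 n2, swap_apply_of_ne_of_ne n3 n4,
      swap_apply_of_ne_of_ne n1.symm n3.symm, swap_apply_of_ne_of_ne n2.symm n4.symm]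
    module
  braid i j k hij hjk := by
    refine cellVec_ext (fun w hw => ?_)
    have n1 : i ≠ j := fun h => by subst h; omega
    have n2 : j ≠ k := fun h => by subst h; omega
    have n3 : i ≠ k := fun h => by subst h; omega
    have hbr : w * swap i j * swap j k * swap i j = w * swap j k * swap i j * swap j k := by
      have := swap_braid n1 n2 n3
      rw [mul_assoc, mul_assoc, ← mul_assoc (swap i j), this]
      group
    have e1 := hK.ne w hw i j hij
    have e2 := hK.ne w hw j k hjk
    have e3 := hK.ne_two w hw i j k hij hjk
    have key : (f (w j) - f (w i))⁻¹ * (f (w k) - f (w j))⁻¹ =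
        (f (w k) - f (w i))⁻¹ * ((f (w j) - f (w i))⁻¹ + (f (w k) - f (w j))⁻¹) := by
      have d1 := sub_ne_zero.2 e1.symm
      have d2 := sub_ne_zero.2 e2.symm
      have d3 := sub_ne_zero.2 e3.symm
      field_simp
      ring
    set a := (f (w j) - f (w i))⁻¹ with ha
    set c := (f (w k) - f (w j))⁻¹ with hc
    set d := (f (w k) - f (w i))⁻¹ with hd
    have ha' : (f (w i) - f (w j))⁻¹ = -a := by rw [← neg_sub (f (w j)), inv_neg]
    have hc' : (f (w j) - f (w k))⁻¹ = -c := by rw [← neg_sub (f (w k)), inv_neg]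
    have q1 := hK.offDiag_mul_offDiag hb hw hij
    have q2 := hK.offDiag_mul_offDiag hb hw hjk
    have ki : swap i j k = k := swap_apply_of_ne_of_ne n3.symm n2.symm
    have ik : swap j k i = i := swap_apply_of_ne_of_ne n1 n3
    have H1 := seminormalOp_apply (f := f) (bUp := bUp) (bDown := bDown) hw hij
    have H1' := seminormalOp_apply (f := f) (bUp := bUp) (bDown := bDown) hw hjk
    have H2 := hK.offDiag_smul_apply (bUp := bUp) (bDown := bDown) hw hij hjk
    have H2' := hK.offDiag_smul_apply (bUp := bUp) (bDown := bDown) hw hjk hij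
    have H3 := hK.offDiag_smul_apply (bUp := bUp) (bDown := bDown) hw hij hij
    have H3' := hK.offDiag_smul_apply (bUp := bUp) (bDown := bDown) hw hjk hjk
    have H4 := hK.offDiag_smul_smul_apply (bUp := bUp) (bDown := bDown) hw hij hjk hij
    have H4' := hK.offDiag_smul_smul_apply (bUp := bUp) (bDown := bDown) hw hjk hij hjk
    rw [hbr] at H4
    simp only [Perm.mul_apply, swap_apply_left, swap_apply_right, ki, ik, ha', hc', mul_assoc w,
      swap_mul_self, mul_one] at H2 H2' H3 H3' H4 H4'
    simp only [← ha, ← hc, ← hd] at H1 H1' H2 H2' H3 H3' H4 H4' q1 q2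
    have G2 := congrArg (seminormalOp K f bUp bDown i) H2
    have G2' := congrArg (seminormalOp K f bUp bDown j) H2'
    simp only [map_add, map_smul] at G2 G2'
    simp only [Module.End.mul_apply, H1, H1', map_add, map_smul]
    -- The coefficient of `C_w` needs both product formulas and `key`, those of the two neighbours
    -- need `key` alone, and those of the longer words agree.
    linear_combination (norm := module) a • H2' + G2 + d • H3 + H4 - c • H2 - G2' - d • H3' - H4'
      + (d * q1 - d * q2 + (a - c) * key) • cellVec F K w
      + (offDiag f bUp bDown (w i) (w j) * key) • cellVec F K (w * swap i j)
      - (offDiag f bUp bDown (w j) (w k) * key) • cellVec F K (w * swap j k)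

theorem exists_functionalRep (hK : IsContentCell K f) (hb : IsNormalization K f bUp bDown) :
    ∃ ρ : Representation F (Perm (Fin n)) (K →₀ F), IsFunctionalRep K f bUp bDown ρ := by
  obtain ⟨φ, hφ⟩ := exists_monoidHom_of_coxeter (hK.satisfiesCoxeter hb)
  refine ⟨φ, ?_⟩
  rintro s ⟨i, j, hij, rfl⟩ w hw
  have hlt : i < j := by rw [Fin.lt_def]; omega
  have happ : φ (swap i j) (cellVec F K w) = (f (w j) - f (w i))⁻¹ • cellVec F K w +
      offDiag f bUp bDown (w i) (w j) • cellVec F K (w * swap i j) := by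
    rw [hφ i j hij, seminormalOp_apply hw hij]
  rw [conj_swap, length_lt_mul_swap_iff hlt, length_mul_swap_lt_iff hlt, happ]
  -- Inside `K` the coefficient `offDiag` is the normalization; outside `K` the basis vector is
  -- zero.
  have hoff : offDiag f bUp bDown (w i) (w j) • cellVec F K (w * swap i j) =
      (if w i < w j then bUp (swap (w i) (w j)) else bDown (swap (w i) (w j))) •
        cellVec F K (w * swap i j) := by
    by_cases hmem : w * swap i j ∈ K
    · have := hK.inner w hw i j hij hmem
      rw [offDiag, if_neg (not_or.2 this)]
    · rw [cellVec_of_notMem hmem, smul_zero, smul_zero]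
  rw [hoff]
  constructor
  · intro h
    rw [pairing_swap f h, if_pos h]
  · intro h
    rw [pairing_swap_of_gt f h, if_neg (lt_asymm h), ← inv_neg, neg_sub]

theorem functionalRep_unique {ρ σ : Representation F (Perm (Fin n)) (K →₀ F)}
    (hρ : IsFunctionalRep K f bUp bDown ρ) (hσ : IsFunctionalRep K f bUp bDown σ) : σ = ρ := by
  ext1 g
  refine simple_induction g (by rw [map_one, map_one]) ?_
  intro u i j hij h
  rw [map_mul, map_mul, h]
  congr 1
  refine cellVec_ext (fun w hw => ?_)
  have hlt : i < j := by rw [Fin.lt_def]; omega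
  have h1 := hρ _ (isSimple_swap hij) w hw
  have h2 := hσ _ (isSimple_swap hij) w hw
  rcases lt_trichotomy (w i) (w j) with h | h | h
  · have := length_lt_mul_swap hlt h
    rw [h1.1 this, h2.1 this]
  · exact absurd (w.injective h) hlt.ne
  · have := length_mul_swap_lt hlt h
    rw [h1.2 this, h2.2 this]

/-- The action of a functional representation in terms of the word of `w`. -/
theorem IsFunctionalRep.apply {ρ : Representation F (Perm (Fin n)) (K →₀ F)}
    (hρ : IsFunctionalRep K f bUp bDown ρ) {w : Perm (Fin n)} (hw : w ∈ K) {i j : Fin n}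
    (hij : (j : ℕ) = i + 1) : ρ (swap i j) (cellVec F K w) = (f (w j) - f (w i))⁻¹ • cellVec F K w +
      (if w i < w j then bUp (swap (w i) (w j)) else bDown (swap (w i) (w j))) •
        cellVec F K (w * swap i j) := by
  have hlt : i < j := by rw [Fin.lt_def]; omega
  have h1 := hρ _ (isSimple_swap hij) w hw
  rw [conj_swap, length_lt_mul_swap_iff hlt, length_mul_swap_lt_iff hlt] at h1
  rcases lt_trichotomy (w i) (w j) with h | h | h
  · rw [h1.1 h, pairing_swap f h, if_pos h]
  · exact absurd (w.injective h) hlt.ne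
  · rw [h1.2 h, pairing_swap_of_gt f h, if_neg (lt_asymm h), ← inv_neg, neg_sub]

end FunctionalRep

end AbstractYoung

namespace AbstractYoung

open Equiv SkewTableau

/-! ### Cells of content vectors -/

section Cells

variable {F : Type*} [Field F] {n : ℕ}

/-- The identity has no descents, so membership only asks that certain pairs of letters keep their
natural order. -/
theorem mem_cell_one {f : Fin n → F} {v : Perm (Fin n)} : v ∈ cell f 1 ↔
    ∀ x y, x < y → (f y - f x = 1 ∨ f y - f x = -1) → v⁻¹ x < v⁻¹ y := by
  have h1 : descents (unitReflections f) (1 : Perm (Fin n)) = ∅ := by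
    ext t
    simp [descents, length_one]
  simp only [cell, Finset.mem_filter, Finset.mem_univ, true_and, h1]
  constructor
  · intro h x y hxy hf
    by_contra hv
    have hlt : v⁻¹ y < v⁻¹ x :=
      lt_of_le_of_ne (not_lt.1 hv) (fun e => hxy.ne' (v⁻¹.injective e))
    have : swap x y ∈ descents (unitReflections f) v := by
      refine ⟨⟨⟨x, y, hxy.ne, rfl⟩, ?_⟩, (length_swap_mul_lt_iff hxy).2 hlt⟩
      rwa [pairing_swap f hxy]
    rw [h] at this
    exact this
  · intro h
    rw [Set.eq_empty_iff_forall_notMem]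
    rintro t ⟨⟨⟨x, y, hne, rfl⟩, hf⟩, hl⟩
    rcases lt_or_gt_of_ne hne with hxy | hxy
    · rw [pairing_swap f hxy] at hf
      exact lt_asymm (h x y hxy hf) ((length_swap_mul_lt_iff hxy).1 hl)
    · rw [pairing_swap_of_gt f hxy] at hf
      rw [swap_comm] at hl
      exact lt_asymm (h y x hxy hf) ((length_swap_mul_lt_iff hxy).1 hl)

theorem one_mem_cell (f : Fin n → F) : 1 ∈ cell f 1 := by
  rw [mem_cell_one]
  intro x y hxy _
  simpa using hxy

/-- The cell is cut out by prescribed orders of pairs of letters, and a geodesic preserves every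
order shared by its ends. -/
theorem isConvexCell_cell (f : Fin n → F) : IsConvexCell (cell f 1) := by
  intro u hu v hv w hw
  rw [mem_cell_one] at *
  exact fun x y hxy hf => inv_lt_of_geodesic hw (hu x y hxy hf) (hv x y hxy hf)

theorem mul_swap_mem_cell {f : Fin n → F} {w : Perm (Fin n)} (hw : w ∈ cell f 1) {i j : Fin n}
    (hij : (j : ℕ) = i + 1) (h1 : f (w j) - f (w i) ≠ 1) (h2 : f (w j) - f (w i) ≠ -1) :
    w * swap i j ∈ cell f 1 := by
  rw [mem_cell_one] at *
  intro x y hxy hf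
  rw [mul_inv_rev, swap_inv, Perm.mul_apply, Perm.mul_apply]
  refine swap_lt_swap_of_adjacent hij (hw x y hxy hf) ?_
  rintro ⟨hx, hy⟩
  rw [Perm.inv_eq_iff_eq] at hx hy
  subst hx hy
  exact hf.elim h1 h2

theorem of_mul_swap_mem_cell {f : Fin n → F} {w : Perm (Fin n)} (hw : w ∈ cell f 1) {i j : Fin n}
    (hij : (j : ℕ) = i + 1) (hws : w * swap i j ∈ cell f 1) :
    f (w j) - f (w i) ≠ 1 ∧ f (w j) - f (w i) ≠ -1 := by
  have hlt : i < j := by rw [Fin.lt_def]; omega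
  rw [← not_or]
  intro hf
  rw [mem_cell_one] at hw hws
  rcases lt_trichotomy (w i) (w j) with h | h | h
  · have := hws _ _ h hf
    simp only [mul_inv_rev, swap_inv, Perm.mul_apply] at this
    simp at this
    exact lt_asymm this hlt
  · exact hlt.ne (w.injective h)
  · have := hw _ _ h (by
      rcases hf with hf | hf
      · exact Or.inr (by linear_combination -hf)
      · exact Or.inl (by linear_combination -hf))
    simp at this
    exact lt_asymm this hlt

/-- Going down along a descent does not leave the cell of the identity. -/
theorem mul_swap_mem_cell_of_descent {f : Fin n → F} {w : Perm (Fin n)} (hw : w ∈ cell f 1)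
    {i j : Fin n} (hij : (j : ℕ) = i + 1) (hd : w j < w i) : w * swap i j ∈ cell f 1 := by
  have hlt : i < j := by rw [Fin.lt_def]; omega
  have h : ¬ (f (w j) - f (w i) = 1 ∨ f (w j) - f (w i) = -1) := by
    intro hf
    have := mem_cell_one.1 hw _ _ hd (by
      rcases hf with hf | hf
      · exact Or.inr (by linear_combination -hf)
      · exact Or.inl (by linear_combination -hf))
    simp at this
    exact lt_asymm this hlt
  rw [not_or] at h
  exact mul_swap_mem_cell hw hij h.1 h.2

end Cells

/-! ### Standard fillings as the cell of a content vector -/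

section ContentCells

variable {F : Type*} [Field F] {lam mu : YoungDiagram} {n : ℕ}

namespace SkewTableau

variable {T Q : SkewTableau lam mu n}

theorem content_trans_inv (T : SkewTableau lam mu n) (g : Perm (Fin n)) (k : Fin n) :
    content (T.trans g⁻¹ : SkewTableau lam mu n) k = content T (g k) := rfl

theorem trans_inv_trans_swap (Q : SkewTableau lam mu n) (w : Perm (Fin n)) (i j : Fin n) :
    ((Q.trans w⁻¹ : SkewTableau lam mu n).trans (swap i j) : SkewTableau lam mu n) =
      Q.trans (w * swap i j)⁻¹ := by
  rw [trans_trans, mul_inv_rev, swap_inv]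

/-- Boxes on the same or on adjacent diagonals are comparable. -/
theorem box_le_or_le {k l : Fin n} (h1 : content T l - content T k ≤ 1)
    (h2 : -1 ≤ content T l - content T k) :
    (row T k ≤ row T l ∧ col T k ≤ col T l) ∨ (row T l ≤ row T k ∧ col T l ≤ col T k) := by
  unfold content at h1 h2
  omega

theorem IsStandard.row_eq_or_col_eq (hT : IsStandard T) {i j : Fin n} (hij : (j : ℕ) = i + 1)
    (h1 : content T j - content T i ≤ 1) (h2 : -1 ≤ content T j - content T i) :
    row T i = row T j ∨ col T i = col T j := by
  by_contra hcon
  rw [not_or] at hcon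
  have hlt : i < j := by rw [Fin.lt_def]; omega
  have hs := hT.trans_swap hij hcon.1 hcon.2
  rcases box_le_or_le h1 h2 with h | h
  · exact lt_asymm hlt (hs.lt_of_box_le (k := j) (l := i) (by simpa [row_trans] using h.1)
      (by simpa [col_trans] using h.2) hlt.ne')
  · exact lt_asymm hlt (hT.lt_of_box_le h.1 h.2 hlt.ne')

theorem IsStandard.content_ne (hT : IsStandard T) {i j : Fin n} (hij : (j : ℕ) = i + 1) :
    content T i ≠ content T j := by
  intro h
  rcases hT.row_eq_or_col_eq hij (by omega) (by omega) with hr | hc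
  · have := hT.col_succ hij hr
    unfold content at h
    omega
  · have := hT.row_succ hij hc
    unfold content at h
    omega

/-- Between two letters on the same diagonal there are letters on both adjacent diagonals. -/
theorem IsStandard.exists_between (hT : IsStandard T) {i k : Fin n} (hik : i < k)
    (h : content T i = content T k) :
    (∃ m, i < m ∧ m < k ∧ content T m = content T i + 1) ∧
      (∃ m, i < m ∧ m < k ∧ content T m = content T i - 1) := by
  have hle : row T i < row T k ∧ col T i < col T k := by
    have hne : ¬ (row T i = row T k ∧ col T i = col T k) := fun e =>
      hik.ne (box_injective e.1 e.2)
    rcases box_le_or_le (T := T) (k := i) (l := k) (by omega) (by omega) with h1 | h1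
    · unfold content at h; omega
    · exact absurd (hT.lt_of_box_le h1.1 h1.2 hik.ne') (lt_asymm hik)
  -- The boxes directly right of and directly below that of `i` lie on the two adjacent diagonals
  -- and weakly north-west of the box of `k`.
  constructor
  · obtain ⟨m, hmr, hmc⟩ := exists_letter T (r := row T i) (c := col T i + 1)
      (mem_skewCells_of_between (box_mem T i) (box_mem T k) ⟨le_rfl, by simp⟩ ⟨hle.1.le, hle.2⟩)
    refine ⟨m, hT.lt_of_box_le hmr.ge (by omega) ?_, hT.lt_of_box_le (by omega) (by omega) ?_, ?_⟩
    · rintro rfl; omega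
    · rintro rfl; omega
    · unfold content; omega
  · obtain ⟨m, hmr, hmc⟩ := exists_letter T (r := row T i + 1) (c := col T i)
      (mem_skewCells_of_between (box_mem T i) (box_mem T k) ⟨by simp, le_rfl⟩ ⟨hle.1, hle.2.le⟩)
    refine ⟨m, hT.lt_of_box_le (by omega) hmc.ge ?_, hT.lt_of_box_le (by omega) (by omega) ?_, ?_⟩
    · rintro rfl; omega
    · rintro rfl; omega
    · unfold content; omega

/-- Only `j` lies strictly between `i` and `k`, and it cannot be on both adjacent diagonals. -/
theorem IsStandard.content_ne_two (hT : IsStandard T) {i j k : Fin n} (hij : (j : ℕ) = i + 1)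
    (hjk : (k : ℕ) = j + 1) : content T i ≠ content T k := by
  intro h
  have hik : i < k := by rw [Fin.lt_def]; omega
  obtain ⟨⟨m, h1, h2, h3⟩, ⟨m', h1', h2', h3'⟩⟩ := hT.exists_between hik h
  rw [Fin.lt_def] at *
  have : m = m' := Fin.ext (by omega)
  subst this
  omega

variable {f : Fin n → ℤ}

theorem _root_.AbstractYoung.SameDerived.sub_eq {f c : Fin n → ℤ} (h : SameDerived f c)
    (x y : Fin n) : f y - f x = c y - c x := by
  have key : ∀ (d : ℕ) (i j : Fin n), (j : ℕ) = i + d → f j - f i = c j - c i := by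
    intro d
    induction d with
    | zero =>
      intro i j hij
      have : j = i := Fin.ext hij
      subst this
      simp
    | succ d ih =>
      intro i j hij
      have hk : (i : ℕ) + d < n := by omega
      have h1 := ih i ⟨i + d, hk⟩ rfl
      have h2 := h ⟨i + d, hk⟩ j (by simp; omega)
      omega
  rcases le_total (x : ℕ) y with hxy | hxy
  · exact key (y - x) x y (by omega)
  · have := key (x - y) y x (by omega)
    omega

variable [CharZero F]

theorem cast_sub_eq_one {a b : ℤ} : ((a : F) - (b : F) = 1) ↔ a - b = 1 := by
  rw [← Int.cast_sub]
  exact_mod_cast Iff.rfl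

theorem cast_sub_eq_neg_one {a b : ℤ} : ((a : F) - (b : F) = -1) ↔ a - b = -1 := by
  rw [← Int.cast_sub, ← Int.cast_one, ← Int.cast_neg]
  exact_mod_cast Iff.rfl

/-- The cell of a content vector is the set of standard fillings. -/
theorem mem_cell_iff (hQ : IsStandard Q) (hf : SameDerived f (content Q)) (w : Perm (Fin n)) :
    w ∈ cell (fun i => (f i : F)) 1 ↔ IsStandard (Q.trans w⁻¹ : SkewTableau lam mu n) := by
  rw [mem_cell_one]
  simp only [cast_sub_eq_one, cast_sub_eq_neg_one, hf.sub_eq]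
  constructor
  · intro h
    -- Neighbouring boxes have contents one apart, so membership in the cell already orders their
    -- letters.
    refine isStandard_of_adjacent (fun k l hr hc => ?_) (fun k l hc hr => ?_)
    · have hne : w k ≠ w l := fun e => by
        have := w.injective e
        subst this
        omega
      change row Q (w k) = row Q (w l) at hr
      change col Q (w l) = col Q (w k) + 1 at hc
      have hlt := hQ.lt_of_box_le hr.le (by omega) hne
      simpa using h _ _ hlt (Or.inl (by unfold content; omega))
    · have hne : w k ≠ w l := fun e => by
        have := w.injective e
        subst this
        omega
      change col Q (w k) = col Q (w l) at hc
      change row Q (w l) = row Q (w k) + 1 at hr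
      have hlt := hQ.lt_of_box_le (by omega) hc.le hne
      simpa using h _ _ hlt (Or.inr (by unfold content; omega))
  · intro h x y hxy hc
    have hle : row Q x ≤ row Q y ∧ col Q x ≤ col Q y := by
      rcases box_le_or_le (T := Q) (k := x) (l := y) (by omega) (by omega) with h1 | h1
      · exact h1
      · exact absurd (hQ.lt_of_box_le h1.1 h1.2 hxy.ne') (lt_asymm hxy)
    refine h.lt_of_box_le ?_ ?_ (fun e => hxy.ne (w⁻¹.injective e))
    · change row Q (w (w⁻¹ x)) ≤ row Q (w (w⁻¹ y))
      simpa using hle.1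
    · change col Q (w (w⁻¹ x)) ≤ col Q (w (w⁻¹ y))
      simpa using hle.2

theorem isContentCell (hQ : IsStandard Q) (hf : SameDerived f (content Q)) :
    IsContentCell (cell (fun i => (f i : F)) 1) (fun i => (f i : F)) where
  mul_swap_mem _ hw _ _ hij h1 h2 := mul_swap_mem_cell hw hij h1 h2
  inner _ hw _ _ hij hws := of_mul_swap_mem_cell hw hij hws
  ne w hw i j hij h := by
    have hstd := (mem_cell_iff hQ hf w).1 hw
    have h1 := hf.sub_eq (w i) (w j)
    have h2 : f (w i) = f (w j) := by exact_mod_cast h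
    refine hstd.content_ne hij ?_
    rw [content_trans_inv, content_trans_inv]
    omega
  ne_two w hw i j k hij hjk h := by
    have hstd := (mem_cell_iff hQ hf w).1 hw
    have h1 := hf.sub_eq (w i) (w k)
    have h2 : f (w i) = f (w k) := by exact_mod_cast h
    refine hstd.content_ne_two hij hjk ?_
    rw [content_trans_inv, content_trans_inv]
    omega

end SkewTableau

end ContentCells

/-! ### Genericity and minimality of the cell of the identity -/

section Generic

variable {F : Type*} [Field F] {n : ℕ}

theorem pairing_conj_swap (f : Fin n → F) {w : Perm (Fin n)} {i j : Fin n} (hij : i ≠ j) :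
    pairing f (w * swap i j * w⁻¹) =
      if w i < w j then f (w j) - f (w i) else -(f (w j) - f (w i)) := by
  rw [conj_swap]
  split_ifs with h
  · exact pairing_swap f h
  · rw [pairing_swap_of_gt f (lt_of_le_of_ne (not_lt.1 h) (fun e => hij (w.injective e).symm)),
      neg_sub]

/-- Descents never leave the cell, so a step out of it increases the length; this fixes the sign of
the pairing on the boundary. -/
theorem mul_swap_mem_cell_of_gt {f : Fin n → F} {w : Perm (Fin n)} (hw : w ∈ cell f 1)
    {i j : Fin n} (hij : (j : ℕ) = i + 1) (hws : w * swap i j ∉ cell f 1) : w i < w j := by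
  have hlt : i < j := by rw [Fin.lt_def]; omega
  by_contra h
  exact hws (mul_swap_mem_cell_of_descent hw hij
    (lt_of_le_of_ne (not_lt.1 h) (fun e => hlt.ne' (w.injective e))))

theorem boundary_of_notMem {f : Fin n → F} {w : Perm (Fin n)} (hw : w ∈ cell f 1)
    {i j : Fin n} (hij : (j : ℕ) = i + 1) (hws : w * swap i j ∉ cell f 1) :
    f (w j) - f (w i) = 1 ∨ f (w j) - f (w i) = -1 := by
  by_contra h
  rw [not_or] at h
  exact hws (mul_swap_mem_cell hw hij h.1 h.2)

theorem isGeneric_of_isContentCell {f : Fin n → F} (hK : IsContentCell (cell f 1) f) :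
    IsGeneric (cell f 1) f where
  one_mem := one_mem_cell f
  convex := isConvexCell_cell f
  inner := by
    rintro _ ⟨_, w, ⟨i, j, hij, rfl⟩, hw, hws, rfl⟩
    have hne : i ≠ j := fun e => by subst e; omega
    have h1 := hK.inner w hw i j hij hws
    have h2 := sub_ne_zero.2 (hK.ne w hw i j hij).symm
    rw [pairing_conj_swap f hne]
    split_ifs
    · exact ⟨h2, h1⟩
    · exact ⟨neg_ne_zero.2 h2, fun h => h1.2 (by linear_combination -h),
        fun h => h1.1 (by linear_combination -h)⟩
  boundary := by
    rintro _ ⟨_, w, ⟨i, j, hij, rfl⟩, hw, hws, rfl⟩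
    have hne : i ≠ j := fun e => by subst e; omega
    rw [pairing_conj_swap f hne, if_pos (mul_swap_mem_cell_of_gt hw hij hws)]
    exact boundary_of_notMem hw hij hws
  braid := by
    have key : ∀ w ∈ cell f 1, ∀ i j k : Fin n, (j : ℕ) = i + 1 → (k : ℕ) = j + 1 →
        w * swap i j ∉ cell f 1 → w * swap j k ∉ cell f 1 →
        pairing f (w * swap i j * w⁻¹) = pairing f (w * swap j k * w⁻¹) := by
      intro w hw i j k hij hjk h1 h2
      have n1 : i ≠ j := fun e => by subst e; omega
      have n2 : j ≠ k := fun e => by subst e; omega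
      rw [pairing_conj_swap f n1, pairing_conj_swap f n2,
        if_pos (mul_swap_mem_cell_of_gt hw hij h1), if_pos (mul_swap_mem_cell_of_gt hw hjk h2)]
      -- Both differences are `±1`, and opposite signs would give equal values two places apart.
      have h3 := hK.ne_two w hw i j k hij hjk
      rcases boundary_of_notMem hw hij h1 with e1 | e1 <;>
        rcases boundary_of_notMem hw hjk h2 with e2 | e2
      · rw [e1, e2]
      · exact absurd (by linear_combination -e1 - e2) h3
      · exact absurd (by linear_combination -e1 - e2) h3
      · rw [e1, e2]
    rintro w hw _ _ ⟨i, i', hi, rfl⟩ ⟨j, j', hj, rfl⟩ hord h1 h2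
    by_cases e1 : i = j
    · subst e1
      have : i' = j' := Fin.ext (by omega)
      subst this
      simp at hord
    · by_cases e2 : i' = j
      · subst e2
        exact key w hw i i' j' hi hj h1 h2
      · by_cases e3 : j' = i
        · subst e3
          exact (key w hw j j' i' hj hi h2 h1).symm
        · exfalso
          have e4 : i' ≠ j' := fun e => e1 (Fin.ext (by subst e; omega))
          have hc := swap_mul_swap_comm_of_disjoint e1 (Ne.symm e3) e2 e4
          -- Disjoint transpositions commute, so their product squares to one and cannot have order
          -- three.
          have hsq : (swap i i' * swap j j') ^ 2 = 1 := by
            rw [pow_two]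
            nth_rewrite 2 [hc]
            rw [mul_assoc, ← mul_assoc (swap j j'), swap_mul_self, one_mul, swap_mul_self]
          have := orderOf_dvd_of_pow_eq_one hsq
          rw [hord] at this
          omega

theorem apply_eq_zero_of_mem_coordSubspace {K K' : Finset (Perm (Fin n))} {x : K →₀ F}
    (hx : x ∈ coordSubspace F K K') {g : Perm (Fin n)} (hg : g ∈ K) (hg' : g ∉ K') :
    x ⟨g, hg⟩ = 0 := by
  have hle : coordSubspace F K K' ≤ LinearMap.ker (Finsupp.lapply (R := F) (⟨g, hg⟩ : K)) := by
    unfold coordSubspace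
    rw [Submodule.span_le]
    rintro _ ⟨w, hw, rfl⟩
    rw [SetLike.mem_coe, LinearMap.mem_ker, Finsupp.lapply_apply]
    change cellVec F K w ⟨g, hg⟩ = 0
    by_cases h : w ∈ K
    · rw [cellVec_of_mem h, Finsupp.single_apply, if_neg]
      intro e
      rw [Subtype.mk.injEq] at e
      exact hg' (e ▸ hw)
    · rw [cellVec_of_notMem h, Finsupp.zero_apply]
  exact hle hx

theorem cellVec_apply {K : Finset (Perm (Fin n))} {g h : Perm (Fin n)} (hg : g ∈ K) :
    cellVec F K h ⟨g, hg⟩ = if h = g then 1 else 0 := by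
  classical
  by_cases hh : h ∈ K
  · rw [cellVec_of_mem hh, Finsupp.single_apply]
    simp [Subtype.ext_iff]
  · rw [cellVec_of_notMem hh, Finsupp.zero_apply, if_neg]
    rintro rfl
    exact hh hg

variable {K : Finset (Perm (Fin n))} {f : Fin n → F} {bUp bDown : Perm (Fin n) → F}

/-- The two coefficients of an edge multiply to `1 - a ^ 2`, which is nonzero because the difference
is not `±1` inside `K`. -/
theorem IsFunctionalRep.exists_coeff (hK : IsContentCell K f)
    (hb : IsNormalization K f bUp bDown) {ρ : Representation F (Perm (Fin n)) (K →₀ F)}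
    (hρ : IsFunctionalRep K f bUp bDown ρ) {w : Perm (Fin n)} (hw : w ∈ K) {i j : Fin n}
    (hij : (j : ℕ) = i + 1) : ∃ b : F, (w * swap i j ∈ K → b ≠ 0) ∧
      ρ (swap i j) (cellVec F K w) =
        (f (w j) - f (w i))⁻¹ • cellVec F K w + b • cellVec F K (w * swap i j) := by
  refine ⟨_, fun hws => ?_, hρ.apply hw hij⟩
  have h1 := hK.inner w hw i j hij hws
  have h2 := hK.offDiag_mul_offDiag hb hw hij
  have h3 : offDiag f bUp bDown (w i) (w j) ≠ 0 := by
    intro h0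
    rw [h0, zero_mul] at h2
    have hd := sub_ne_zero.2 (hK.ne w hw i j hij).symm
    have h4 : ((f (w j) - f (w i)) - 1) * ((f (w j) - f (w i)) + 1) = 0 := by
      field_simp at h2
      linear_combination -h2
    rcases mul_eq_zero.1 h4 with h | h
    · exact h1.1 (by linear_combination h)
    · exact h1.2 (by linear_combination h)
  rwa [offDiag, if_neg (not_or.2 h1)] at h3

/-- Edges of the cell carry nonzero coefficients, and every element descends to the identity inside
the cell. So an invariant coordinate subspace contains all the basis vectors or none. -/
theorem IsFunctionalRep.isMinimalAYPair {ρ : Representation F (Perm (Fin n)) (cell f 1 →₀ F)}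
    (hK : IsContentCell (cell f 1) f) (hb : IsNormalization (cell f 1) f bUp bDown)
    (hρ : IsFunctionalRep (cell f 1) f bUp bDown ρ) : IsMinimalAYPair (cell f 1) ρ := by
  refine ⟨?_, ⟨1, one_mem_cell f⟩, ?_⟩
  · rintro s ⟨i, j, hij, rfl⟩ w hw
    obtain ⟨b, _, hb⟩ := hρ.exists_coeff hK hb hw hij
    by_cases hws : w * swap i j ∈ cell f 1
    · exact ⟨_, b, fun h => absurd hws h, hb⟩
    · refine ⟨(f (w j) - f (w i))⁻¹, 0, fun _ => rfl, ?_⟩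
      rw [hb, cellVec_of_notMem hws, smul_zero, smul_zero]
  · intro K' hne hss hinv
    have hedge : ∀ w ∈ K', ∀ i j : Fin n, (j : ℕ) = i + 1 → w * swap i j ∈ cell f 1 →
        w * swap i j ∈ K' := by
      intro w hw i j hij hws
      by_contra hnot
      have hne : i ≠ j := fun e => by subst e; omega
      have hwK := hss.1 hw
      obtain ⟨b, hb0, hb⟩ := hρ.exists_coeff hK hb hwK hij
      have h1 := hinv (swap i j) _ (Submodule.subset_span ⟨w, hw, rfl⟩)
      have h2 := apply_eq_zero_of_mem_coordSubspace h1 hws hnot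
      simp only at h2
      rw [hb, Finsupp.add_apply, Finsupp.smul_apply, Finsupp.smul_apply, cellVec_apply,
        cellVec_apply, if_pos rfl, if_neg] at h2
      · exact hb0 hws (by simpa using h2)
      · intro e
        rw [left_eq_mul] at e
        exact hne (swap_eq_one_iff.1 e)
    have hiff : ∀ w, w ∈ cell f 1 → (w ∈ K' ↔ 1 ∈ K') := by
      intro w
      refine descent_induction w (fun _ => Iff.rfl) ?_
      intro u i j hij hd ih hu
      have hus := mul_swap_mem_cell_of_descent hu hij hd
      rw [← ih hus]
      refine ⟨fun h => hedge u h i j hij hus, fun h => ?_⟩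
      have := hedge _ h i j hij (by rwa [mul_assoc, swap_mul_self, mul_one])
      rwa [mul_assoc, swap_mul_self, mul_one] at this
    obtain ⟨w, hw⟩ := hne
    have h1 := (hiff w (hss.1 hw)).1 hw
    exact hss.2 (fun v hv => (hiff v hv).2 h1)

end Generic

/-! ### Seminormal bases from translated cells -/

section CellSeminormal

variable {F : Type*} [Field F] {lam mu : YoungDiagram} {n : ℕ}

/-- A representation on the span of a translate of the set of standard fillings, by operators in
seminormal shape, is seminormal. -/
theorem isSeminormal_of_cell {Q : SkewTableau lam mu n} {K : Finset (Perm (Fin n))}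
    {ρ : Representation F (Perm (Fin n)) (K →₀ F)} (u : Perm (Fin n))
    (hK : ∀ w, u * w ∈ K ↔ IsStandard (Q.trans w⁻¹ : SkewTableau lam mu n))
    (hact : ∀ w, u * w ∈ K → ∀ i j : Fin n, (j : ℕ) = i + 1 → ∃ a b : F,
      ρ (swap i j) (cellVec F K (u * w)) =
        a • cellVec F K (u * w) + b • cellVec F K (u * w * swap i j) ∧
      (content Q (w j) - content Q (w i) = 1 → a = 1) ∧
      (content Q (w j) - content Q (w i) = -1 → a = -1) ∧
      (u * w * swap i j ∈ K → b ≠ 0)) :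
    IsSeminormal ρ (fun T : SkewTableau lam mu n =>
      cellVec F K (u * (T.symm.trans Q : Perm (Fin n)))) := by
  have hTw : ∀ T : SkewTableau lam mu n,
      (Q.trans (T.symm.trans Q : Perm (Fin n))⁻¹ : SkewTableau lam mu n) = T := by
    intro T
    ext x
    simp
  have hmem : ∀ T : SkewTableau lam mu n, IsStandard T →
      u * (T.symm.trans Q : Perm (Fin n)) ∈ K := fun T hT => by
    rw [hK, hTw]
    exact hT
  have hswap : ∀ (T : SkewTableau lam mu n) (i j : Fin n),
      u * (T.symm.trans Q : Perm (Fin n)) * swap i j =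
        u * ((T.trans (swap i j) : SkewTableau lam mu n).symm.trans Q : Perm (Fin n)) := by
    intro T i j
    ext x
    simp
  let E : {T : SkewTableau lam mu n // IsStandard T} → K := fun T => ⟨_, hmem T.1 T.2⟩
  have hEv : ∀ T, cellVec F K (u * (T.1.symm.trans Q : Perm (Fin n))) = Finsupp.single (E T) 1 :=
    fun T => cellVec_of_mem _
  have hEinj : Function.Injective E := by
    intro T T' h
    have h1 : u * (T.1.symm.trans Q : Perm (Fin n)) = u * (T'.1.symm.trans Q : Perm (Fin n)) :=
      congrArg Subtype.val h
    have h2 := mul_left_cancel h1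
    exact Subtype.ext (by rw [← hTw T.1, ← hTw T'.1, h2])
  have hEsurj : Function.Surjective E := by
    rintro ⟨g, hg⟩
    have hg' : u * (u⁻¹ * g) ∈ K := by rwa [mul_inv_cancel_left]
    refine ⟨⟨_, (hK _).1 hg'⟩, Subtype.ext ?_⟩
    have h : ∀ v : Perm (Fin n),
        ((Q.trans v⁻¹ : SkewTableau lam mu n).symm.trans Q : Perm (Fin n)) = v := by
      intro v
      ext x
      simp
      rfl
    exact (congrArg (u * ·) (h (u⁻¹ * g))).trans (mul_inv_cancel_left u g)
  have hnot : ∀ (T : SkewTableau lam mu n), IsStandard T → ∀ i j : Fin n, (j : ℕ) = i + 1 →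
      (row T i = row T j ∨ col T i = col T j) →
      u * (T.symm.trans Q : Perm (Fin n)) * swap i j ∉ K := by
    intro T hT i j hij h hin
    rw [mul_assoc, hK, ← trans_inv_trans_swap, hTw] at hin
    have := hT.ne_of_trans_swap hij hin
    exact h.elim this.1 this.2
  have hcon : ∀ (T : SkewTableau lam mu n) (k : Fin n),
      content Q ((T.symm.trans Q : Perm (Fin n)) k) = content T k := by
    intro T k
    simp [content, row, col]
  constructor
  · have h1 : LinearIndependent F (fun w : K => (Finsupp.single w 1 : K →₀ F)) :=
      (Finsupp.basisSingleOne (R := F) (ι := K)).linearIndependent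
    have h2 := h1.comp E hEinj
    have h3 : (fun w : K => (Finsupp.single w 1 : K →₀ F)) ∘ E = fun T =>
        cellVec F K (u * (T.1.symm.trans Q : Perm (Fin n))) := funext fun T => (hEv T).symm
    rwa [h3] at h2
  · have h1 := (Finsupp.basisSingleOne (R := F) (ι := K)).span_eq
    refine h1.symm.le.trans (Submodule.span_mono ?_)
    rintro _ ⟨w, rfl⟩
    obtain ⟨T, rfl⟩ := hEsurj w
    exact ⟨T, hEv T⟩
  · intro T hT i j hij hr
    obtain ⟨a, b, hab, h1, _, _⟩ := hact _ (hmem T hT) i j hij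
    have hc := hT.col_succ hij hr
    rw [hab, cellVec_of_notMem (hnot T hT i j hij (Or.inl hr)), smul_zero, add_zero, h1, one_smul]
    rw [hcon, hcon]
    unfold content
    omega
  · intro T hT i j hij hc
    obtain ⟨a, b, hab, _, h1, _⟩ := hact _ (hmem T hT) i j hij
    have hr := hT.row_succ hij hc
    rw [hab, cellVec_of_notMem (hnot T hT i j hij (Or.inr hc)), smul_zero, add_zero, h1,
      neg_one_smul]
    rw [hcon, hcon]
    unfold content
    omega
  · intro T hT i j hij hr hc
    obtain ⟨a, b, hab, _, _, h1⟩ := hact _ (hmem T hT) i j hij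
    refine ⟨a, b, h1 ?_, ?_⟩
    · rw [hswap]
      exact hmem _ (hT.trans_swap hij hr hc)
    · rw [hab, hswap]

end CellSeminormal

end AbstractYoung

namespace AbstractYoung

open Equiv SkewTableau

/-! ### The representation attached to a content vector -/

section ContentRep

variable {F : Type*} [Field F] [CharZero F] {lam mu : YoungDiagram} {n : ℕ}
variable {Q : SkewTableau lam mu n} {f : Fin n → ℤ} {bUp bDown : Perm (Fin n) → F}

theorem isSeminormal_of_isFunctionalRep (hQ : IsStandard Q) (hf : SameDerived f (content Q))
    (hb : IsNormalization (cell (fun i => (f i : F)) 1) (fun i => (f i : F)) bUp bDown)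
    {ρ : Representation F (Perm (Fin n)) (cell (fun i => (f i : F)) 1 →₀ F)}
    (hρ : IsFunctionalRep (cell (fun i => (f i : F)) 1) (fun i => (f i : F)) bUp bDown ρ) :
    IsSeminormal ρ (fun T : SkewTableau lam mu n =>
      cellVec F (cell (fun i => (f i : F)) 1) (1 * (T.symm.trans Q : Perm (Fin n)))) := by
  refine isSeminormal_of_cell 1 (fun w => ?_) (fun w hw i j hij => ?_)
  · rw [one_mul]
    exact mem_cell_iff hQ hf w
  · rw [one_mul] at *
    obtain ⟨b, hb0, hb⟩ := hρ.exists_coeff (isContentCell hQ hf) hb hw hij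
    refine ⟨_, b, hb, fun h => ?_, fun h => ?_, hb0⟩
    · rw [← hf.sub_eq] at h
      rw [cast_sub_eq_one.2 h, inv_one]
    · rw [← hf.sub_eq] at h
      rw [cast_sub_eq_neg_one.2 h, inv_neg, inv_one]

theorem content_rep (hQ : IsStandard Q) (hf : SameDerived f (content Q))
    (hb : IsNormalization (cell (fun i => (f i : F)) 1) (fun i => (f i : F)) bUp bDown) :
    ∃ ρ : Representation F (Perm (Fin n)) (cell (fun i => (f i : F)) 1 →₀ F),
      IsFunctionalRep (cell (fun i => (f i : F)) 1) (fun i => (f i : F)) bUp bDown ρ ∧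
      (∀ σ, IsFunctionalRep (cell (fun i => (f i : F)) 1) (fun i => (f i : F)) bUp bDown σ →
        σ = ρ) ∧
      IsMinimalAYPair (cell (fun i => (f i : F)) 1) ρ ∧
      Nonempty (ρ.Equiv (skewSpecht F n lam mu)) := by
  have hK := isContentCell (F := F) hQ hf
  obtain ⟨ρ, hρ⟩ := exists_functionalRep hK hb
  exact ⟨ρ, hρ, fun σ hσ => functionalRep_unique hρ hσ, hρ.isMinimalAYPair hK hb,
    (isSeminormal_of_isFunctionalRep hQ hf hb hρ).nonempty_equiv_skewSpecht
      (card_skewCells_of_tableau Q)⟩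

theorem isMinimalAYRep_of_equiv_skewSpecht (hcard : (skewCells lam mu).card = n)
    {V : Type*} [AddCommGroup V] [Module F V] {ρ : Representation F (Perm (Fin n)) V}
    (h : Nonempty (ρ.Equiv (skewSpecht F n lam mu))) : IsMinimalAYRep ρ := by
  obtain ⟨Q, hQ⟩ := exists_columnReading hcard
  -- Taking `ḃ = 1` gives a normalization over any field, without square roots.
  have hb : IsNormalization (cell (fun i => (content Q i : F)) 1) (fun i => (content Q i : F))
      (fun _ => 1) (fun t => (1 - (pairing (fun i => (content Q i : F)) t)⁻¹) *
        (1 - (-(pairing (fun i => (content Q i : F)) t)⁻¹))) := fun t _ => one_mul _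
  obtain ⟨σ, _, _, hσ, ⟨e⟩⟩ :=
    content_rep (isStandard_of_columnReading hQ) (fun _ _ _ => rfl) hb
  obtain ⟨e'⟩ := h
  exact ⟨_, σ, hσ, ⟨e'.trans e.symm⟩⟩

end ContentRep

end AbstractYoung

namespace AbstractYoung

open Equiv

/-! ### Minimal abstract Young pairs -/

section Coord

variable {F : Type*} [Field F] {n : ℕ} {K : Finset (Perm (Fin n))}

/-- The coefficient of `C_v`, which is zero for `v ∉ K`. -/
noncomputable def coord (F : Type*) [Field F] {n : ℕ} (K : Finset (Perm (Fin n)))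
    (v : Perm (Fin n)) : (K →₀ F) →ₗ[F] F :=
  if h : v ∈ K then Finsupp.lapply ⟨v, h⟩ else 0

theorem coord_apply {v : Perm (Fin n)} (h : v ∈ K) (x : K →₀ F) : coord F K v x = x ⟨v, h⟩ := by
  rw [coord, dif_pos h, Finsupp.lapply_apply]

theorem coord_of_notMem {v : Perm (Fin n)} (h : v ∉ K) (x : K →₀ F) : coord F K v x = 0 := by
  rw [coord, dif_neg h, LinearMap.zero_apply]

theorem coord_cellVec (v : Perm (Fin n)) {w : Perm (Fin n)} (hw : w ∈ K) :
    coord F K v (cellVec F K w) = if w = v then 1 else 0 := by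
  by_cases h : v ∈ K
  · rw [coord_apply h, cellVec_apply]
  · rw [coord_of_notMem h, if_neg]
    rintro rfl
    exact h hw

/-- The adjacent transpositions act on `V_K` in the shape of an abstract Young pair, with
diagonal coefficients `a` and off-diagonal coefficients `b`. -/
structure HasCoeffs (ρ : Representation F (Perm (Fin n)) (K →₀ F))
    (a b : Perm (Fin n) → Fin n → Fin n → F) : Prop where
  apply : ∀ w ∈ K, ∀ i j : Fin n, (j : ℕ) = i + 1 → ρ (swap i j) (cellVec F K w) =
    a w i j • cellVec F K w + b w i j • cellVec F K (w * swap i j)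
  eq_zero : ∀ w, w ∈ K → ∀ i j, w * swap i j ∉ K → b w i j = 0

theorem IsAYPair.exists_hasCoeffs {ρ : Representation F (Perm (Fin n)) (K →₀ F)}
    (h : IsAYPair K ρ) : ∃ a b, HasCoeffs ρ a b := by
  have h' : ∀ (w : Perm (Fin n)) (i j : Fin n), ∃ a b : F, w ∈ K →
      (w * swap i j ∉ K → b = 0) ∧ ((j : ℕ) = i + 1 → ρ (swap i j) (cellVec F K w) =
        a • cellVec F K w + b • cellVec F K (w * swap i j)) := by
    intro w i j
    by_cases hw : w ∈ K
    · by_cases hij : (j : ℕ) = i + 1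
      · obtain ⟨a, b, h1, h2⟩ := h (swap i j) (isSimple_swap hij) w hw
        exact ⟨a, b, fun _ => ⟨h1, fun _ => h2⟩⟩
      · exact ⟨0, 0, fun _ => ⟨fun _ => rfl, fun h => absurd h hij⟩⟩
    · exact ⟨0, 0, fun h => absurd h hw⟩
  choose a b hab using h'
  exact ⟨a, b, fun w hw i j hij => (hab w i j hw).2 hij, fun w hw i j => (hab w i j hw).1⟩

end Coord

/-! ### Consequences of minimality and of the Coxeter relations -/

section Connected

variable {F : Type*} [Field F] {n : ℕ} {K : Finset (Perm (Fin n))}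
  {ρ : Representation F (Perm (Fin n)) (K →₀ F)} {a b : Perm (Fin n) → Fin n → Fin n → F}

namespace HasCoeffs

/-- The dual form of the action. It holds for every `v`, because edges leaving `K` have coefficient
zero. -/
theorem coord_apply_swap (h : HasCoeffs ρ a b) (v : Perm (Fin n)) {i j : Fin n}
    (hij : (j : ℕ) = i + 1) (x : K →₀ F) : coord F K v (ρ (swap i j) x) =
      a v i j * coord F K v x + b (v * swap i j) i j * coord F K (v * swap i j) x := by
  have hne : i ≠ j := fun e => by subst e; omega
  suffices hl : coord F K v ∘ₗ ρ (swap i j) = a v i j • coord F K v +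
      b (v * swap i j) i j • coord F K (v * swap i j) by
    simpa using LinearMap.congr_fun hl x
  refine cellVec_ext (fun w hw => ?_)
  have hvv : v * swap i j * swap i j = v := by rw [mul_assoc, swap_mul_self, mul_one]
  have hv : v * swap i j ≠ v := fun e => hne (swap_eq_one_iff.1 (by simpa using e))
  simp only [LinearMap.comp_apply, LinearMap.add_apply, LinearMap.smul_apply, smul_eq_mul]
  rw [h.apply w hw i j hij, map_add, map_smul, map_smul, coord_cellVec _ hw, coord_cellVec _ hw]
  simp only [smul_eq_mul]
  by_cases h1 : w = v
  · subst h1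
    rw [if_pos rfl, if_neg hv.symm, mul_zero, add_zero, mul_one]
    by_cases h2 : w * swap i j ∈ K
    · rw [coord_cellVec _ h2, if_neg hv, mul_zero, add_zero]
    · rw [h.eq_zero w hw i j h2, zero_mul, add_zero]
  · rw [if_neg h1, mul_zero, mul_zero, zero_add, zero_add]
    by_cases h2 : w * swap i j ∈ K
    · rw [coord_cellVec _ h2]
      by_cases h3 : w = v * swap i j
      · rw [if_pos h3, if_pos (by rw [h3, hvv]), h3]
      · rw [if_neg h3, if_neg (fun e => h3 (by rw [← e, mul_assoc, swap_mul_self, mul_one])),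
          mul_zero, mul_zero]
    · rw [h.eq_zero w hw i j h2, zero_mul]
      split_ifs with h3
      · rw [← h3, h.eq_zero w hw i j h2, zero_mul]
      · rw [mul_zero]

/-- The operator of `g⁻¹` moves `C_w` to `C_{w g}` up to terms `C_{w h}` with `h` shorter. -/
theorem coord_inv_eq_zero (h : HasCoeffs ρ a b) {w : Perm (Fin n)} (hw : w ∈ K)
    (g : Perm (Fin n)) : ∀ g', g' ≠ g → length g ≤ length g' →
      coord F K (w * g') (ρ g⁻¹ (cellVec F K w)) = 0 := by
  refine descent_induction g ?_ ?_
  · intro g' hg _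
    rw [inv_one, map_one, Module.End.one_apply, coord_cellVec _ hw, if_neg]
    intro e
    exact hg (by simpa using e)
  · intro u i j hij hd ih g' hg' hl
    have hu : u⁻¹ = swap i j * (u * swap i j)⁻¹ := by
      rw [mul_inv_rev, swap_inv, ← mul_assoc, swap_mul_self, one_mul]
    have h1 : length u = length (u * swap i j) + 1 := length_mul_swap_adjacent_of_gt hij hd
    have h2 : length g' ≤ length (g' * swap i j) + 1 := by
      rcases lt_or_gt_of_ne (fun e : g' i = g' j => by
        have := g'.injective e
        subst this
        omega) with h3 | h3
      · have := length_mul_swap_adjacent hij h3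
        omega
      · have := length_mul_swap_adjacent_of_gt hij h3
        omega
    rw [hu, map_mul, Module.End.mul_apply, h.coord_apply_swap _ hij, ih g' ?_ (by omega), mul_assoc,
      ih (g' * swap i j) ?_ (by omega), mul_zero, mul_zero, add_zero]
    · exact fun e => hg' (mul_right_cancel e)
    · rintro rfl
      omega

/-- If all edges of a path from `w` carry nonzero coefficients then so does the leading coefficient
from `w` to the endpoint. -/
theorem coord_inv_step (h : HasCoeffs ρ a b) {w : Perm (Fin n)} (hw : w ∈ K) {g : Perm (Fin n)}
    {i j : Fin n} (hij : (j : ℕ) = i + 1)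
    (hg : coord F K (w * g) (ρ g⁻¹ (cellVec F K w)) ≠ 0) (hb : b (w * g) i j ≠ 0) :
    coord F K (w * (g * swap i j)) (ρ (g * swap i j)⁻¹ (cellVec F K w)) ≠ 0 := by
  have hne : i ≠ j := fun e => by subst e; omega
  have hss : ∀ v : Perm (Fin n), v * swap i j * swap i j = v := fun v => by
    rw [mul_assoc, swap_mul_self, mul_one]
  have hgs : g * swap i j ≠ g := fun e => hne (swap_eq_one_iff.1 (by simpa using e))
  have key : ∀ g' : Perm (Fin n), length g' < length (g' * swap i j) →
      coord F K (w * (g' * swap i j)) (ρ (g' * swap i j)⁻¹ (cellVec F K w)) =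
        b (w * g') i j * coord F K (w * g') (ρ g'⁻¹ (cellVec F K w)) := by
    intro g' hl
    rw [mul_inv_rev, swap_inv, map_mul, Module.End.mul_apply, h.coord_apply_swap _ hij,
      h.coord_inv_eq_zero hw g' _ (by rintro e; rw [e] at hl; omega) hl.le, mul_zero, zero_add,
      ← mul_assoc, hss]
  rcases lt_or_gt_of_ne (fun e : g i = g j => hne (g.injective e)) with h3 | h3
  · rw [key g (by have := length_mul_swap_adjacent hij h3; omega)]
    exact mul_ne_zero hb hg
  -- For a shortening step, the coefficient at `g` already has the one at the shorter element as a
  -- factor.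
  · have := key (g * swap i j)
      (by rw [hss]; have := length_mul_swap_adjacent_of_gt hij h3; omega)
    rw [hss] at this
    rw [this] at hg
    exact right_ne_zero_of_mul hg

/-- By `coord_inv_step` the words with nonzero leading coefficient from `w` span an invariant
subspace. It contains `C_w`, so minimality makes it everything. -/
theorem coord_inv_ne_zero (h : HasCoeffs ρ a b) (hmin : IsMinimalAYPair K ρ) {w : Perm (Fin n)}
    (hw : w ∈ K) {g : Perm (Fin n)} (hg : w * g ∈ K) :
    coord F K (w * g) (ρ g⁻¹ (cellVec F K w)) ≠ 0 := by
  classical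
  let K' := K.filter (fun v => coord F K v (ρ (w⁻¹ * v)⁻¹ (cellVec F K w)) ≠ 0)
  have hK' : ∀ {v}, v ∈ K' ↔ v ∈ K ∧ coord F K v (ρ (w⁻¹ * v)⁻¹ (cellVec F K w)) ≠ 0 :=
    Finset.mem_filter
  have hsub : K' ⊆ K := Finset.filter_subset _ _
  have hinv : ∀ i j : Fin n, (j : ℕ) = i + 1 → ∀ x ∈ coordSubspace F K K',
      ρ (swap i j) x ∈ coordSubspace F K K' := by
    intro i j hij x hx
    have hle : coordSubspace F K K' ≤ (coordSubspace F K K').comap (ρ (swap i j)) := by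
      conv_lhs => unfold coordSubspace
      rw [Submodule.span_le]
      rintro _ ⟨v, hv, rfl⟩
      have hv' := hK'.1 (Finset.mem_coe.1 hv)
      change ρ (swap i j) (cellVec F K v) ∈ coordSubspace F K K'
      rw [h.apply v hv'.1 i j hij]
      refine add_mem (Submodule.smul_mem _ _ (Submodule.subset_span ⟨v, hv, rfl⟩)) ?_
      by_cases hb : b v i j = 0
      · rw [hb, zero_smul]
        exact zero_mem _
      · refine Submodule.smul_mem _ _ (Submodule.subset_span ⟨v * swap i j, ?_, rfl⟩)
        refine Finset.mem_coe.2 (hK'.2 ⟨by_contra fun hn => hb (h.eq_zero v hv'.1 i j hn), ?_⟩)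
        have := h.coord_inv_step hw hij (g := w⁻¹ * v) (by simpa using hv'.2)
          (by rwa [mul_inv_cancel_left])
        rwa [← mul_assoc, mul_inv_cancel_left, mul_assoc] at this
    exact hle hx
  have hall : ∀ g : Perm (Fin n), ∀ x ∈ coordSubspace F K K', ρ g x ∈ coordSubspace F K K' := by
    intro g
    refine simple_induction g (fun x hx => by simpa using hx) ?_
    intro u i j hij ih x hx
    rw [map_mul, Module.End.mul_apply]
    exact ih _ (hinv i j hij x hx)
  have hwK' : w ∈ K' := hK'.2 ⟨hw, by
    rw [inv_mul_cancel, inv_one, map_one, Module.End.one_apply, coord_cellVec _ hw, if_pos rfl]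
    exact one_ne_zero⟩
  have hKK : K' = K := by
    by_contra hne
    exact hmin.2.2 K' ⟨w, hwK'⟩ (lt_of_le_of_ne hsub hne) hall
  have := (hK'.1 (hKK ▸ hg : w * g ∈ K')).2
  rwa [inv_mul_cancel_left] at this

/-- If two neighbours in the word `w` occur in the opposite order in another element of `K`, then
they may be exchanged inside `K`. -/
theorem ne_zero_of_inverted (h : HasCoeffs ρ a b) (hmin : IsMinimalAYPair K ρ) {w w' : Perm (Fin n)}
    (hw : w ∈ K) (hw' : w' ∈ K) {i j : Fin n} (hij : (j : ℕ) = i + 1)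
    (hinv : w'⁻¹ (w j) < w'⁻¹ (w i)) : b w i j ≠ 0 := by
  have hlt : i < j := by rw [Fin.lt_def]; omega
  have hne : i ≠ j := hlt.ne
  have hg := h.coord_inv_ne_zero hmin hw (g := w⁻¹ * w') (by rwa [mul_inv_cancel_left])
  -- If `b` vanished, `C_w` would be an eigenvector of the transposition. Then `ρ g⁻¹ C_w`, for `g =
  -- w⁻¹ * w'`, would be a multiple of the image of `C_w` under a shorter element, which has no
  -- component at `w'`.
  intro hb
  apply hg
  have hl : length (swap i j * (w⁻¹ * w')) < length (w⁻¹ * w') := by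
    rw [length_swap_mul_lt_iff hlt]
    simpa using hinv
  have hgi : (w⁻¹ * w')⁻¹ = (swap i j * (w⁻¹ * w'))⁻¹ * swap i j := by
    rw [mul_inv_rev (swap i j), swap_inv, mul_assoc, swap_mul_self, mul_one]
  rw [hgi, map_mul, Module.End.mul_apply, h.apply w hw i j hij, hb, zero_smul, add_zero, map_smul,
    map_smul, h.coord_inv_eq_zero hw _ _ ?_ hl.le, smul_zero]
  intro e
  rw [← e] at hl
  exact lt_irrefl _ hl

theorem ne_zero (h : HasCoeffs ρ a b) (hmin : IsMinimalAYPair K ρ) {w : Perm (Fin n)}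
    (hw : w ∈ K) {i j : Fin n} (hij : (j : ℕ) = i + 1) (hws : w * swap i j ∈ K) :
    b w i j ≠ 0 := by
  refine h.ne_zero_of_inverted hmin hw hws hij ?_
  rw [Fin.lt_def]
  simp
  omega

theorem apply_of_notMem (h : HasCoeffs ρ a b) {w : Perm (Fin n)}
    (hw : w ∈ K) {i j : Fin n} (hij : (j : ℕ) = i + 1) (hws : w * swap i j ∉ K) :
    ρ (swap i j) (cellVec F K w) = a w i j • cellVec F K w := by
  rw [h.apply w hw i j hij, h.eq_zero w hw i j hws, zero_smul, add_zero]

theorem rep_swap_swap (ρ : Representation F (Perm (Fin n)) (K →₀ F)) (i j : Fin n) (x : K →₀ F) :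
    ρ (swap i j) (ρ (swap i j) x) = x := by
  rw [← Module.End.mul_apply, ← map_mul, swap_mul_self, map_one, Module.End.one_apply]

theorem coord_self (_ : HasCoeffs ρ a b) {w : Perm (Fin n)} (hw : w ∈ K) :
    coord F K w (cellVec F K w) = 1 := by
  rw [coord_cellVec _ hw, if_pos rfl]

/-- The coefficient of `C_w` in `s² C_w = C_w`. -/
theorem sq (h : HasCoeffs ρ a b) {w : Perm (Fin n)} (hw : w ∈ K) {i j : Fin n}
    (hij : (j : ℕ) = i + 1) : a w i j ^ 2 + b (w * swap i j) i j * b w i j = 1 := by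
  have hne : i ≠ j := fun e => by subst e; omega
  have h1 : w ≠ w * swap i j := fun e => hne (swap_eq_one_iff.1 (by simpa using e))
  have h2 := congrArg (coord F K w) (rep_swap_swap ρ i j (cellVec F K w))
  rw [h.coord_apply_swap _ hij, h.coord_apply_swap _ hij, h.coord_apply_swap _ hij, mul_assoc w,
    swap_mul_self, mul_one, coord_cellVec _ hw, coord_cellVec _ hw, if_pos rfl, if_neg h1] at h2
  linear_combination h2

/-- The coefficient of `C_{ws}` in `s² C_w = C_w`, divided by the nonzero coefficient of the edge.
-/
theorem neg (h : HasCoeffs ρ a b) (hmin : IsMinimalAYPair K ρ) {w : Perm (Fin n)} (hw : w ∈ K)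
    {i j : Fin n} (hij : (j : ℕ) = i + 1) (hws : w * swap i j ∈ K) :
    a (w * swap i j) i j = -a w i j := by
  have hne : i ≠ j := fun e => by subst e; omega
  have h1 : w ≠ w * swap i j := fun e => hne (swap_eq_one_iff.1 (by simpa using e))
  have h2 := congrArg (coord F K (w * swap i j)) (rep_swap_swap ρ i j (cellVec F K w))
  rw [h.coord_apply_swap _ hij, h.coord_apply_swap _ hij, h.coord_apply_swap _ hij, mul_assoc w,
    swap_mul_self, mul_one, coord_cellVec _ hw, coord_cellVec _ hw, if_pos rfl, if_neg h1] at h2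
  exact mul_right_cancel₀ (h.ne_zero hmin hw hij hws) (by linear_combination h2)

/-- The coefficient of `C_{ws}` in `s t C_w = t s C_w`. -/
theorem comm (h : HasCoeffs ρ a b) (hmin : IsMinimalAYPair K ρ) {w : Perm (Fin n)} (hw : w ∈ K)
    {i j k l : Fin n} (hij : (j : ℕ) = i + 1) (hkl : (l : ℕ) = k + 1)
    (hst : swap i j * swap k l = swap k l * swap i j) (hne' : swap i j ≠ swap k l)
    (hws : w * swap i j ∈ K) : a (w * swap i j) k l = a w k l := by
  have hne : i ≠ j := fun e => by subst e; omega
  have hnk : k ≠ l := fun e => by subst e; omega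
  have h1 : w ≠ w * swap i j := fun e => hne (swap_eq_one_iff.1 (by simpa using e))
  have h4 : w ≠ w * swap k l := fun e => hnk (swap_eq_one_iff.1 (by simpa using e))
  have h3 : w ≠ w * swap i j * swap k l := fun e => hne' (by
    rw [mul_assoc, left_eq_mul, mul_eq_one_iff_eq_inv, swap_inv] at e
    exact e)
  have hs : ∀ v : Perm (Fin n), v * swap i j * swap i j = v := fun v => by
    rw [mul_assoc, swap_mul_self, mul_one]
  have h5 : w * swap i j * swap k l * swap i j = w * swap k l := by
    rw [mul_assoc w, hst, ← mul_assoc, hs]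
  have h2 := congrArg (fun g => coord F K (w * swap i j) (ρ g (cellVec F K w))) hst
  simp only [map_mul, Module.End.mul_apply, h.coord_apply_swap _ hij, h.coord_apply_swap _ hkl,
    coord_cellVec _ hw, hs, h5, if_neg h1, if_neg h3, if_neg h4, if_true] at h2
  exact mul_right_cancel₀ (h.ne_zero hmin hw hij hws) (by linear_combination -h2)

/-- These inequalities remove the spurious coordinates of `C_w` from the expansion of the braid
relation. -/
theorem _root_.AbstractYoung.braid_words {G : Type*} [Group G] (w : G) {s t : G} (hs : s * s = 1)
    (ht : t * t = 1) (ht1 : t ≠ 1) (hst : s ≠ t) (hbr : s * t * s = t * s * t) :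
    w ≠ w * s * t ∧ w ≠ w * t * s ∧ w ≠ w * s * t * s ∧ w ≠ w * s * t * s * t := by
  have h1 : s * t ≠ 1 := fun e => hst (by
    rw [mul_eq_one_iff_eq_inv] at e
    rw [e, eq_comm, ← mul_eq_one_iff_eq_inv, ht])
  refine ⟨fun e => h1 ?_, fun e => ?_, fun e => ?_, fun e => ?_⟩
  · rwa [mul_assoc, left_eq_mul] at e
  · rw [mul_assoc, left_eq_mul] at e
    exact h1 (by rw [← mul_left_inj s, mul_assoc, e, mul_one, one_mul])
  · rw [mul_assoc, mul_assoc, left_eq_mul] at e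
    apply ht1
    have : s * (s * (t * s)) * s = 1 := by rw [e, mul_one, hs]
    rwa [← mul_assoc, hs, one_mul, mul_assoc, hs, mul_one] at this
  · rw [mul_assoc, mul_assoc, mul_assoc, left_eq_mul] at e
    have e2 : s * t * s * t = 1 := by rw [← e]; group
    rw [hbr, mul_assoc, ht, mul_one] at e2
    exact h1 (by rw [← mul_left_inj s, mul_assoc, e2, mul_one, one_mul])

section Braid

variable {i j k l : Fin n}

/-- The coefficient of `C_{ws}` in the braid relation applied to `C_w`; `neg` eliminates the
diagonal entry of `s` at `ws`. -/
theorem braid (h : HasCoeffs ρ a b) (hmin : IsMinimalAYPair K ρ) {w : Perm (Fin n)} (hw : w ∈ K)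
    (hij : (j : ℕ) = i + 1) (hkl : (l : ℕ) = k + 1)
    (hst : swap i j * swap k l * swap i j = swap k l * swap i j * swap k l)
    (hne' : swap i j ≠ swap k l) (hws : w * swap i j ∈ K) :
    a w i j * a w k l = a (w * swap i j) k l * (a w i j + a w k l) := by
  have hne : i ≠ j := fun e => by subst e; omega
  have hnk : k ≠ l := fun e => by subst e; omega
  have h1 : w ≠ w * swap i j := fun e => hne (swap_eq_one_iff.1 (by simpa using e))
  have h4 : w ≠ w * swap k l := fun e => hnk (swap_eq_one_iff.1 (by simpa using e))
  have hs : ∀ v : Perm (Fin n), v * swap i j * swap i j = v := fun v => by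
    rw [mul_assoc, swap_mul_self, mul_one]
  have ht : ∀ v : Perm (Fin n), v * swap k l * swap k l = v := fun v => by
    rw [mul_assoc, swap_mul_self, mul_one]
  have h3 : w ≠ w * swap i j * swap k l := fun e => hne' (by
    rw [mul_assoc, left_eq_mul, mul_eq_one_iff_eq_inv, swap_inv] at e
    exact e)
  obtain ⟨n1, n2, n3, n4⟩ := braid_words w (swap_mul_self i j) (swap_mul_self k l)
    (fun e => hnk (swap_eq_one_iff.1 e)) hne' hst
  have h2 := congrArg (fun g => coord F K (w * swap i j) (ρ g (cellVec F K w))) hst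
  simp only [map_mul, Module.End.mul_apply, h.coord_apply_swap _ hij, h.coord_apply_swap _ hkl,
    coord_cellVec _ hw, hs, ht, if_neg h1, if_neg h4, if_neg n1, if_neg n2, if_neg n3, if_neg n4,
    if_true] at h2
  have h6 := h.neg hmin hw hij hws
  exact mul_right_cancel₀ (h.ne_zero hmin hw hij hws)
    (by linear_combination h2 - a (w * swap i j) k l * b w i j * h6)

/-- The coefficient of `C_{wst}` in the braid relation applied to `C_w`: a single path contributes
on each side. -/
theorem opposite (h : HasCoeffs ρ a b) (hmin : IsMinimalAYPair K ρ) {w : Perm (Fin n)} (hw : w ∈ K)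
    (hij : (j : ℕ) = i + 1) (hkl : (l : ℕ) = k + 1)
    (hst : swap i j * swap k l * swap i j = swap k l * swap i j * swap k l)
    (hne' : swap i j ≠ swap k l) (hws : w * swap i j ∈ K) (hwst : w * swap i j * swap k l ∈ K) :
    a (w * swap i j * swap k l) i j = a w k l := by
  have hne : i ≠ j := fun e => by subst e; omega
  have hnk : k ≠ l := fun e => by subst e; omega
  have h1 : w ≠ w * swap i j := fun e => hne (swap_eq_one_iff.1 (by simpa using e))
  have h4 : w ≠ w * swap k l := fun e => hnk (swap_eq_one_iff.1 (by simpa using e))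
  have hs : ∀ v : Perm (Fin n), v * swap i j * swap i j = v := fun v => by
    rw [mul_assoc, swap_mul_self, mul_one]
  have ht : ∀ v : Perm (Fin n), v * swap k l * swap k l = v := fun v => by
    rw [mul_assoc, swap_mul_self, mul_one]
  obtain ⟨n1, n2, n3, n4⟩ := braid_words w (swap_mul_self i j) (swap_mul_self k l)
    (fun e => hnk (swap_eq_one_iff.1 e)) hne' hst
  have h5 : w * swap i j * swap k l * swap i j * swap k l * swap i j = w * swap k l := by
    have : w * swap i j * swap k l * swap i j * swap k l * swap i j =
      w * (swap i j * swap k l * swap i j) * swap k l * swap i j := by group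
    rw [this, hst]
    simp only [← mul_assoc, hs, ht]
  have h2 := congrArg (fun g => coord F K (w * swap i j * swap k l) (ρ g (cellVec F K w))) hst
  simp only [map_mul, Module.End.mul_apply, h.coord_apply_swap _ hij, h.coord_apply_swap _ hkl,
    coord_cellVec _ hw, hs, ht, h5, if_neg h1, if_neg h4, if_neg n1, if_neg n3, if_neg n4, if_true] at h2
  refine mul_right_cancel₀ (mul_ne_zero (h.ne_zero hmin hw hij hws)
    (h.ne_zero hmin hws hkl hwst)) ?_
  linear_combination h2

/-- Both transpositions act on the line of `C_w` by scalars of square one, which the braid relation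
makes equal. -/
theorem eq_of_notMem (h : HasCoeffs ρ a b) {w : Perm (Fin n)} (hw : w ∈ K)
    (hij : (j : ℕ) = i + 1) (hkl : (l : ℕ) = k + 1)
    (hst : swap i j * swap k l * swap i j = swap k l * swap i j * swap k l)
    (hws : w * swap i j ∉ K) (hwt : w * swap k l ∉ K) : a w i j = a w k l := by
  have h2 := congrArg (fun g => coord F K w (ρ g (cellVec F K w))) hst
  simp only [map_mul, Module.End.mul_apply, h.apply_of_notMem hw hij hws,
    h.apply_of_notMem hw hkl hwt, map_smul, smul_eq_mul, h.coord_self hw] at h2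
  have h3 := h.sq hw hij
  have h4 := h.sq hw hkl
  rw [h.eq_zero w hw i j hws, mul_zero, add_zero] at h3
  rw [h.eq_zero w hw k l hwt, mul_zero, add_zero] at h4
  linear_combination -h2 - a w i j * h4 + a w k l * h3

end Braid

end HasCoeffs

end Connected

end AbstractYoung

namespace AbstractYoung

open Equiv

/-! ### Cells with diagonal coefficients -/

section YoungCell

/-- The combinatorial data left of a minimal abstract Young pair, translated so as to contain the
identity: a set `M` of permutations and the diagonal coefficients `a` of adjacent transpositions. -/
structure IsYoungCell {F : Type*} [Field F] {n : ℕ} (M : Set (Perm (Fin n)))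
    (a : Perm (Fin n) → Fin n → Fin n → F) : Prop where
  one_mem : 1 ∈ M
  mem_of_inverted : ∀ {w}, w ∈ M → ∀ {w'}, w' ∈ M → ∀ {i j : Fin n}, (j : ℕ) = i + 1 →
    w'⁻¹ (w j) < w'⁻¹ (w i) → w * swap i j ∈ M
  neg : ∀ {w}, w ∈ M → ∀ {i j : Fin n}, (j : ℕ) = i + 1 → w * swap i j ∈ M →
    a (w * swap i j) i j = -a w i j
  sq_ne : ∀ {w}, w ∈ M → ∀ {i j : Fin n}, (j : ℕ) = i + 1 → w * swap i j ∈ M → a w i j ^ 2 ≠ 1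
  sq : ∀ {w}, w ∈ M → ∀ {i j : Fin n}, (j : ℕ) = i + 1 → w * swap i j ∉ M → a w i j ^ 2 = 1
  comm : ∀ {w}, w ∈ M → ∀ {i j k l : Fin n}, (j : ℕ) = i + 1 → (l : ℕ) = k + 1 →
    (j < k ∨ l < i) → w * swap i j ∈ M → a (w * swap i j) k l = a w k l
  braid : ∀ {w}, w ∈ M → ∀ {i j k l : Fin n}, (j : ℕ) = i + 1 → (l : ℕ) = k + 1 →
    (j = k ∨ l = i) → w * swap i j ∈ M →
    a w i j * a w k l = a (w * swap i j) k l * (a w i j + a w k l)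
  opposite : ∀ {w}, w ∈ M → ∀ {i j k l : Fin n}, (j : ℕ) = i + 1 → (l : ℕ) = k + 1 →
    (j = k ∨ l = i) → w * swap i j ∈ M → w * swap i j * swap k l ∈ M →
    a (w * swap i j * swap k l) i j = a w k l
  eq_of_notMem : ∀ {w}, w ∈ M → ∀ {i j k : Fin n}, (j : ℕ) = i + 1 → (k : ℕ) = j + 1 →
    w * swap i j ∉ M → w * swap j k ∉ M → a w i j = a w j k

/-- Left translation by `u⁻¹` moves the base point to the identity. Of the off-diagonal coefficients
only their vanishing is kept, in the form of membership in `M`. -/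
theorem HasCoeffs.isYoungCell {F : Type*} [Field F] {n : ℕ} {K : Finset (Perm (Fin n))}
    {ρ : Representation F (Perm (Fin n)) (K →₀ F)} {a b : Perm (Fin n) → Fin n → Fin n → F}
    (h : HasCoeffs ρ a b) (hmin : IsMinimalAYPair K ρ) {u : Perm (Fin n)} (hu : u ∈ K) :
    IsYoungCell {w | u * w ∈ K} (fun w => a (u * w)) := by
  have hbraid : ∀ {i j k l : Fin n}, (j : ℕ) = i + 1 → (l : ℕ) = k + 1 → (j = k ∨ l = i) →
      swap i j * swap k l * swap i j = swap k l * swap i j * swap k l ∧ swap i j ≠ swap k l := by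
    have h0 : ∀ {i j k : Fin n}, (j : ℕ) = i + 1 → (k : ℕ) = j + 1 →
        swap i j * swap j k * swap i j = swap j k * swap i j * swap j k ∧
          swap i j ≠ swap j k := by
      intro i j k hij hjk
      have h1 : i ≠ j := fun e => by subst e; omega
      have h2 : j ≠ k := fun e => by subst e; omega
      have h3 : i ≠ k := fun e => by subst e; omega
      refine ⟨swap_braid h1 h2 h3, fun e => h1 ?_⟩
      have := congrArg (fun g : Perm (Fin n) => g i) e
      simp only [swap_apply_left, swap_apply_of_ne_of_ne h1 h3] at this
      exact this.symm
    rintro i j k l hij hkl (rfl | rfl)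
    · exact h0 hij hkl
    · exact ⟨(h0 hkl hij).1.symm, (h0 hkl hij).2.symm⟩
  constructor
  · simpa using hu
  · intro w hw w' hw' i j hij hinv
    by_contra hn
    refine h.ne_zero_of_inverted hmin (w := u * w) (w' := u * w') hw hw' hij ?_
      (h.eq_zero _ hw _ _ (by rwa [mul_assoc]))
    simpa using hinv
  · intro w hw i j hij hws
    rw [← mul_assoc]
    exact h.neg hmin hw hij (by rwa [mul_assoc])
  · intro w hw i j hij hws hsq
    have hws' : u * w * swap i j ∈ K := by rwa [mul_assoc]
    have h1 := h.sq hw hij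
    rw [hsq, add_eq_left] at h1
    refine (mul_ne_zero (h.ne_zero hmin hws' hij ?_) (h.ne_zero hmin hw hij hws')) h1
    rwa [mul_assoc, swap_mul_self, mul_one]
  · intro w hw i j hij hws
    have h1 := h.sq hw hij
    rwa [h.eq_zero _ hw _ _ (by rwa [mul_assoc]), mul_zero, add_zero] at h1
  · intro w hw i j k l hij hkl hd hws
    rw [← mul_assoc]
    have h1 : i ≠ k := fun e => by subst e; rw [Fin.lt_def, Fin.lt_def] at hd; omega
    have h2 : i ≠ l := fun e => by subst e; rw [Fin.lt_def, Fin.lt_def] at hd; omega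
    have h3 : j ≠ k := fun e => by subst e; rw [Fin.lt_def, Fin.lt_def] at hd; omega
    have h4 : j ≠ l := fun e => h1 (Fin.ext (by subst e; omega))
    have h5 : i ≠ j := fun e => by subst e; omega
    refine h.comm hmin hw hij hkl (swap_mul_swap_comm_of_disjoint h1 h2 h3 h4) (fun e => h5 ?_)
      (by rwa [mul_assoc])
    have := congrArg (fun g : Perm (Fin n) => g i) e
    simp only [swap_apply_left, swap_apply_of_ne_of_ne h1 h2] at this
    exact this.symm
  · intro w hw i j k l hij hkl hd hws
    rw [← mul_assoc]
    exact h.braid hmin hw hij hkl (hbraid hij hkl hd).1 (hbraid hij hkl hd).2 (by rwa [mul_assoc])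
  · intro w hw i j k l hij hkl hd hws hwst
    rw [← mul_assoc, ← mul_assoc]
    exact h.opposite hmin hw hij hkl (hbraid hij hkl hd).1 (hbraid hij hkl hd).2
      (by rwa [mul_assoc]) (by rwa [mul_assoc, mul_assoc, ← mul_assoc w])
  · intro w hw i j k hij hjk hws hwt
    exact h.eq_of_notMem hw hij hjk (hbraid hij hjk (Or.inl rfl)).1 (by rwa [mul_assoc])
      (by rwa [mul_assoc])

end YoungCell

end AbstractYoung

namespace AbstractYoung

open Equiv

/-! ### The diagonal coefficients are inverse differences -/

section FixAbove

variable {n : ℕ}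

/-- `w` fixes all letters from `m` on. -/
def FixesAbove (m : ℕ) (w : Perm (Fin n)) : Prop := ∀ k : Fin n, m ≤ k → w k = k

namespace FixesAbove

variable {m : ℕ} {w w' : Perm (Fin n)}

theorem inv (h : FixesAbove m w) : FixesAbove m w⁻¹ := fun k hk => by
  rw [Perm.inv_eq_iff_eq, h k hk]

theorem mul (h : FixesAbove m w) (h' : FixesAbove m w') : FixesAbove m (w * w') := fun k hk => by
  rw [Perm.mul_apply, h' k hk, h k hk]

theorem swap {i j : Fin n} (hi : (i : ℕ) < m) (hj : (j : ℕ) < m) : FixesAbove m (swap i j) :=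
  fun k hk => swap_apply_of_ne_of_ne (fun e => by subst e; omega) (fun e => by subst e; omega)

theorem lt (h : FixesAbove m w) {k : Fin n} (hk : (k : ℕ) < m) : (w k : ℕ) < m := by
  by_contra hn
  have h1 := h (w k) (not_lt.1 hn)
  have h2 := w.injective h1
  rw [h2] at hn
  exact hn hk

end FixesAbove

end FixAbove

section Values

variable {F : Type*} [Field F] {n : ℕ}

/-- `α` is the inverse of `val y - val x` if `x` and `y` are in the same class, and `0` if not. -/
def IsInvDiff (cl : Fin n → ℕ) (val : Fin n → F) (x y : Fin n) (α : F) : Prop :=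
  (cl x = cl y ∧ α * (val y - val x) = 1) ∨ (cl x ≠ cl y ∧ α = 0)

namespace IsInvDiff

variable {cl : Fin n → ℕ} {val : Fin n → F} {x y z : Fin n} {α β γ : F}

theorem neg (h : IsInvDiff cl val x y α) : IsInvDiff cl val y x (-α) := by
  rcases h with ⟨h1, h2⟩ | ⟨h1, h2⟩
  · exact Or.inl ⟨h1.symm, by linear_combination h2⟩
  · exact Or.inr ⟨Ne.symm h1, by rw [h2, neg_zero]⟩

/-- The braid relation determines the difference of `x` and `z` from those to `y`. -/
theorem trans (h1 : IsInvDiff cl val x y α) (h2 : IsInvDiff cl val y z β) (hα : α ≠ 0)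
    (h : β * α = γ * (β + α)) : IsInvDiff cl val x z γ := by
  rcases h1 with ⟨c1, e1⟩ | ⟨_, e1⟩
  · rcases h2 with ⟨c2, e2⟩ | ⟨c2, e2⟩
    · refine Or.inl ⟨c1.trans c2, ?_⟩
      have hβ : β ≠ 0 := fun e => by rw [e, zero_mul] at e2; exact zero_ne_one e2
      refine mul_left_cancel₀ (mul_ne_zero hβ hα) ?_
      linear_combination β * γ * e1 + α * γ * e2 - h
    · refine Or.inr ⟨fun c => c2 (c1.symm.trans c), ?_⟩
      rw [e2, zero_mul, zero_add, eq_comm] at h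
      exact (mul_eq_zero.1 h).resolve_right hα
  · exact absurd e1 hα

end IsInvDiff

namespace IsYoungCell

variable {M : Set (Perm (Fin n))} {a : Perm (Fin n) → Fin n → Fin n → F}

theorem mul_swap_mem_of_gt (h : IsYoungCell M a) {w : Perm (Fin n)} (hw : w ∈ M) {i j : Fin n}
    (hij : (j : ℕ) = i + 1) (hd : w j < w i) : w * swap i j ∈ M :=
  h.mem_of_inverted hw h.one_mem hij (by simpa using hd)

/-- A word different from `w'` has neighbours that `w'` orders the other way, and exchanging them
stays in `M`. So every word of `M` can be sorted into `w'` inside `M`. -/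
theorem path_induction (h : IsYoungCell M a) {w' : Perm (Fin n)} (hw' : w' ∈ M)
    {motive : Perm (Fin n) → Prop} (base : motive w')
    (step : ∀ w ∈ M, ∀ i j : Fin n, (j : ℕ) = i + 1 → w'⁻¹ (w j) < w'⁻¹ (w i) →
      w * swap i j ∈ M → motive (w * swap i j) → motive w) : ∀ w ∈ M, motive w := by
  have key : ∀ u : Perm (Fin n), w' * u ∈ M → motive (w' * u) := by
    intro u
    refine descent_induction u (fun _ => by rwa [mul_one]) ?_
    intro u i j hij hd ih hu
    have h1 : w'⁻¹ ((w' * u) j) < w'⁻¹ ((w' * u) i) := by simpa using hd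
    have h2 := h.mem_of_inverted hu hw' hij h1
    refine step _ hu i j hij h1 h2 ?_
    rw [mul_assoc] at h2 ⊢
    exact ih h2
  intro w hw
  have := key (w'⁻¹ * w) (by rwa [mul_inv_cancel_left])
  rwa [mul_inv_cancel_left] at this

/-- The two words are joined by exchanges strictly left of `p`; these commute with the exchange of
`p` and `q` and do not affect its coefficient. -/
theorem last_coeff_eq (h : IsYoungCell M a) {m : ℕ} {p q : Fin n} (hq : (q : ℕ) = m)
    (hpq : (q : ℕ) = p + 1) {w w' : Perm (Fin n)} (hw : w ∈ M) (hw' : w' ∈ M)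
    (hf : FixesAbove m w) (hf' : FixesAbove m w') (hp : w p = w' p) : a w p q = a w' p q := by
  revert hf hp
  refine h.path_induction hw' (motive := fun w => FixesAbove m w → w p = w' p →
    a w p q = a w' p q) (fun _ _ => rfl) ?_ w hw
  intro w hw i j hij hinv hws ih hf hp
  have hlt : i < j := by rw [Fin.lt_def]; omega
  -- The words agree from position `p` on, so neighbours in opposite orders lie before `p`.
  have hjp : j < p := by
    by_contra hn
    rw [Fin.lt_def] at *
    have hj : w'⁻¹ (w j) = j := by
      rcases eq_or_lt_of_le (not_lt.1 hn) with e | hl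
      · have : p = j := Fin.ext e
        rw [Perm.inv_eq_iff_eq, ← this, hp]
      · rw [hf j (by omega), hf'.inv j (by omega)]
    rw [hj] at hinv
    by_cases him : (i : ℕ) < m
    · have := (hf'.inv.mul hf).lt him
      rw [Perm.mul_apply] at this
      omega
    · rw [hf i (by omega), hf'.inv i (by omega)] at hinv
      omega
  rw [Fin.lt_def] at hjp hlt
  rw [← h.comm hw hij hpq (Or.inl hjp) hws]
  refine ih (hf.mul (FixesAbove.swap (by omega) (by omega))) ?_
  rw [Perm.mul_apply, swap_apply_of_ne_of_ne (fun e => by subst e; omega)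
    (fun e => by subst e; omega), hp]

/-- In `w'` the letter at `p` comes after all other letters below `m`. So in `w` it may be moved to
the right past each of them by `mem_of_inverted`. -/
theorem exists_swap_last (h : IsYoungCell M a) {m : ℕ} {p : Fin n} (hpm : m = p + 1)
    {w' : Perm (Fin n)} (hw' : w' ∈ M) (hf' : FixesAbove m w') (d : ℕ) :
    ∀ (w : Perm (Fin n)) (q : Fin n), w ∈ M → FixesAbove m w → w q = w' p →
      (p : ℕ) = q + d + 1 → ∃ (v : Perm (Fin n)) (r : Fin n), v ∈ M ∧ FixesAbove m v ∧
        v p = w p ∧ v r = w' p ∧ (p : ℕ) = r + 1 ∧ v * swap r p ∈ M := by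
  induction d with
  | zero =>
    intro w q hw hf hq hd
    refine ⟨w, q, hw, hf, rfl, hq, hd, h.mem_of_inverted hw hw' hd ?_⟩
    have h1 := (hf'.inv.mul hf).lt (k := p) (by omega)
    rw [Perm.mul_apply] at h1
    rw [hq]
    have h2 : w'⁻¹ (w' p) = p := by rw [Perm.inv_eq_iff_eq]
    rw [h2, Fin.lt_def]
    refine lt_of_le_of_ne (by omega) (fun e => ?_)
    have e' := Fin.ext e
    rw [Perm.inv_eq_iff_eq, ← hq] at e'
    have := w.injective e'
    subst this
    omega
  | succ d ih =>
    intro w q hw hf hq hd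
    have hlt : (q : ℕ) + 1 < n := by have := p.2; omega
    have hr : ((⟨q + 1, hlt⟩ : Fin n) : ℕ) = q + 1 := rfl
    have hne : (⟨q + 1, hlt⟩ : Fin n) ≠ q := fun e => by
      have := congrArg Fin.val e
      simp at this
    have hin : w * swap q ⟨q + 1, hlt⟩ ∈ M := by
      refine h.mem_of_inverted hw hw' hr ?_
      have h1 := (hf'.inv.mul hf).lt (k := ⟨q + 1, hlt⟩) (by rw [hr]; omega)
      rw [Perm.mul_apply] at h1
      rw [hq]
      have h2 : w'⁻¹ (w' p) = p := by rw [Perm.inv_eq_iff_eq]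
      rw [h2, Fin.lt_def]
      refine lt_of_le_of_ne (by omega) (fun e => ?_)
      have e' := Fin.ext e
      rw [Perm.inv_eq_iff_eq, ← hq] at e'
      exact hne (w.injective e')
    obtain ⟨v, r, h1, h2, h3, h4⟩ := ih (w * swap q ⟨q + 1, hlt⟩) ⟨q + 1, hlt⟩ hin
      (hf.mul (FixesAbove.swap (by omega) (by rw [hr]; omega)))
      (by rw [Perm.mul_apply, swap_apply_right, hq]) (by rw [hr]; omega)
    refine ⟨v, r, h1, h2, ?_, h4⟩
    rw [h3, Perm.mul_apply, swap_apply_of_ne_of_ne (fun e => by subst e; omega)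
      (fun e => by have := congrArg Fin.val e; rw [hr] at this; omega)]

/-- A class and a value for a new letter, from the words in which it comes last. -/
theorem exists_last_value (h : IsYoungCell M a) {m : ℕ} {p q : Fin n} (hq : (q : ℕ) = m)
    (hpq : (q : ℕ) = p + 1) {cl : Fin n → ℕ} {val : Fin n → F}
    (hg : ∀ w ∈ M, FixesAbove m w → ∀ i j : Fin n, (j : ℕ) = i + 1 → (j : ℕ) < m →
      IsInvDiff cl val (w i) (w j) (a w i j)) :
    ∃ (C : ℕ) (v : F), ∀ w ∈ M, FixesAbove m w →
      (cl (w p) = C ∧ a w p q * (v - val (w p)) = 1) ∨ (cl (w p) ≠ C ∧ a w p q = 0) := by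
  -- One word with a nonzero last coefficient determines the value of the new letter; the braid
  -- relation carries the formula to all other words.
  by_cases hall : ∃ w₀ ∈ M, FixesAbove m w₀ ∧ a w₀ p q ≠ 0
  · obtain ⟨w₀, hw₀, hf₀, h0⟩ := hall
    refine ⟨cl (w₀ p), val (w₀ p) + (a w₀ p q)⁻¹, fun w hw hf => ?_⟩
    by_cases he : w p = w₀ p
    · refine Or.inl ⟨by rw [he], ?_⟩
      rw [he, h.last_coeff_eq hq hpq hw hw₀ hf hf₀ he, add_sub_cancel_left, mul_inv_cancel₀ h0]
    · have hr : ((w⁻¹ (w₀ p) : Fin n) : ℕ) < p := by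
        have h1 := (hf.inv.mul hf₀).lt (k := p) (by omega)
        rw [Perm.mul_apply] at h1
        refine lt_of_le_of_ne (by omega) (fun e => ?_)
        have e' := Fin.ext e
        rw [Perm.inv_eq_iff_eq] at e'
        exact he e'.symm
      obtain ⟨v, r, hv, hfv, hvp, hvr, hrp, hvs⟩ := h.exists_swap_last (p := p) (by omega) hw₀ hf₀
        (p - (w⁻¹ (w₀ p) : Fin n) - 1) w (w⁻¹ (w₀ p)) hw hf (by simp) (by omega)
      have hα := h.last_coeff_eq hq hpq hv hw hfv hf hvp
      have hβ := h.last_coeff_eq hq hpq hvs hw₀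
        (hfv.mul (FixesAbove.swap (by omega) (by omega))) hf₀
        (by rw [Perm.mul_apply, swap_apply_right, hvr])
      have hbr := h.braid hv hrp hpq (Or.inl rfl) hvs
      have hgv := hg v hv hfv r p hrp (by omega)
      rw [hα, hβ] at hbr
      rw [hvr, hvp] at hgv
      rcases hgv with ⟨c1, e1⟩ | ⟨c1, e1⟩
      · refine Or.inl ⟨c1.symm, ?_⟩
        have he0 : a v r p ≠ 0 := fun e => by rw [e, zero_mul] at e1; exact zero_ne_one e1
        refine mul_left_cancel₀ (mul_ne_zero he0 h0) ?_
        have hinv : a w₀ p q * (a w₀ p q)⁻¹ = 1 := mul_inv_cancel₀ h0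
        linear_combination hbr + a v r p * a w p q * hinv - a w₀ p q * a w p q * e1
      · refine Or.inr ⟨Ne.symm c1, ?_⟩
        rw [e1, zero_mul, zero_add, eq_comm] at hbr
        exact (mul_eq_zero.1 hbr).resolve_left h0
  · push Not at hall
    -- All last coefficients vanish, so the new letter gets a class of its own, with a label larger
    -- than any in use.
    refine ⟨∑ x, cl x + 1, 0, fun w hw hf => Or.inr ⟨?_, hall w hw hf⟩⟩
    have := Finset.single_le_sum (f := cl) (fun _ _ => Nat.zero_le _) (Finset.mem_univ (w p))
    omega

/-- The formula for the coefficients spreads as the last letter moves to the left. -/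
theorem isInvDiff_of_last (h : IsYoungCell M a) {m : ℕ} {L : Fin n} (hL : (L : ℕ) = m)
    {cl : Fin n → ℕ} {val : Fin n → F}
    (hg : ∀ w ∈ M, FixesAbove m w → ∀ i j : Fin n, (j : ℕ) = i + 1 → (j : ℕ) < m + 1 →
      IsInvDiff cl val (w i) (w j) (a w i j)) (d : ℕ) :
    ∀ w ∈ M, FixesAbove (m + 1) w → ∀ p : Fin n, w p = L → (p : ℕ) + d = m →
      ∀ i j : Fin n, (j : ℕ) = i + 1 → (j : ℕ) < m + 1 →
        IsInvDiff cl val (w i) (w j) (a w i j) := by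
  induction d using Nat.strong_induction_on with
  | _ d ih =>
    intro w hw hf p hp hd i j hij hj
    rcases Nat.eq_zero_or_pos d with h0 | h0
    · have hpL : p = L := Fin.ext (by omega)
      rw [hpL] at hp
      refine hg w hw (fun k hk => ?_) i j hij hj
      rcases eq_or_lt_of_le hk with e | hl
      · have : k = L := Fin.ext (by omega)
        rw [this, hp]
      · exact hf k hl
    · have hlt : (p : ℕ) + 1 < n := by have := L.2; omega
      obtain ⟨p₁, hp₁⟩ : ∃ p₁ : Fin n, (p₁ : ℕ) = p + 1 := ⟨⟨p + 1, hlt⟩, rfl⟩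
      have hpp : p ≠ p₁ := fun e => by subst e; omega
      have hltL : ∀ {v : Perm (Fin n)} {r s : Fin n}, FixesAbove (m + 1) v → v r = L → r ≠ s →
          (s : ℕ) < m + 1 → v s < v r := by
        intro v r s hfv hr hrs hs
        have h1 := hfv.lt hs
        rw [hr, Fin.lt_def]
        refine lt_of_le_of_ne (by omega) (fun e => hrs (v.injective ?_))
        rw [hr, Fin.ext e]
      obtain ⟨v, hvdef⟩ : ∃ v, v = w * swap p p₁ := ⟨_, rfl⟩
      have hwv : w = v * swap p p₁ := by rw [hvdef, mul_assoc, swap_mul_self, mul_one]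
      have hv : v ∈ M := by
        rw [hvdef]
        exact h.mul_swap_mem_of_gt hw hp₁ (hltL hf hp hpp (by omega))
      have hws : v * swap p p₁ ∈ M := hwv ▸ hw
      have hfv : FixesAbove (m + 1) v := by
        rw [hvdef]
        exact hf.mul (FixesAbove.swap (by omega) (by omega))
      have hvp₁ : v p₁ = L := by rw [hvdef, Perm.mul_apply, swap_apply_right, hp]
      have ihv := ih (d - 1) (by omega) v hv hfv p₁ hvp₁ (by omega)
      have hwp : w p = v p₁ := by rw [hp, hvp₁]
      have hwp₁ : w p₁ = v p := by rw [hwv, Perm.mul_apply, swap_apply_right]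
      have hwk : ∀ k, k ≠ p → k ≠ p₁ → w k = v k := fun k h1 h2 => by
        rw [hwv, Perm.mul_apply, swap_apply_of_ne_of_ne h1 h2]
      -- Here `v` is `w` with `L` one place further right. The pair `(i, j)` is the exchanged one,
      -- ends at `p`, starts at `p₁`, or is disjoint from both.
      by_cases c1 : i = p
      · have hjp : j = p₁ := Fin.ext (by subst c1; omega)
        rw [c1, hjp, hwp, hwp₁]
        have := h.neg hv hp₁ hws
        rw [← hwv] at this
        rw [this]
        exact (ihv p p₁ hp₁ (by omega)).neg
      · by_cases c2 : j = p
        · have hip₁ : i ≠ p₁ := fun e => by subst e c2; omega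
          rw [c2] at hij ⊢
          rw [hwk i c1 hip₁, hwp]
          -- If this exchange is allowed, opposite edges of the hexagon have equal coefficients. If
          -- not, the coefficient squares to one, so it is nonzero and the braid relation determines
          -- the missing one.
          by_cases hvt : v * swap i p ∈ M
          · have hback : v * swap i p * swap i p = v := by rw [mul_assoc, swap_mul_self, mul_one]
            have hopp := h.opposite hvt hij hp₁ (Or.inl rfl) (by rwa [hback])
              (by rwa [hback])
            rw [hback, ← hwv] at hopp
            rw [hopp]
            have hvtp₁ : (v * swap i p) p₁ = v p₁ := by
              rw [Perm.mul_apply, swap_apply_of_ne_of_ne hip₁.symm hpp.symm]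
            have := ih (d - 1) (by omega) _ hvt
              (hfv.mul (FixesAbove.swap (by omega) (by omega))) p₁ (by rw [hvtp₁, hvp₁])
              (by omega) p p₁ hp₁ (by omega)
            rwa [hvtp₁, Perm.mul_apply, swap_apply_right] at this
          · have hsq := h.sq hv hij hvt
            have hbr := h.braid hv hp₁ hij (Or.inr rfl) hws
            rw [← hwv] at hbr
            refine (ihv i p hij (by omega)).trans (ihv p p₁ hp₁ (by omega)) ?_ hbr
            rintro e
            rw [e, zero_pow two_ne_zero] at hsq
            exact zero_ne_one hsq
        · by_cases c3 : i = p₁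
          · rw [c3] at hij ⊢
            have hjp : j ≠ p := fun e => by subst e; omega
            have hjp₁ : j ≠ p₁ := fun e => by subst e; omega
            -- `L` is the largest letter in these positions, so it can move a second place to the
            -- right, where the opposite edge is known by induction.
            have hv' := h.mul_swap_mem_of_gt hv hij (hltL hfv hvp₁ hjp₁.symm (by omega))
            have hback : v * swap p₁ j * swap p₁ j = v := by
              rw [mul_assoc, swap_mul_self, mul_one]
            have hopp := h.opposite hv' hij hp₁ (Or.inr rfl) (by rwa [hback]) (by rwa [hback])
            rw [hback, ← hwv] at hopp
            rw [hopp, hwp₁, hwk j hjp hjp₁]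
            have := ih (d - 2) (by omega) _ hv'
              (hfv.mul (FixesAbove.swap (by omega) (by omega))) j
              (by rw [Perm.mul_apply, swap_apply_right, hvp₁]) (by omega) p p₁ hp₁ (by omega)
            rwa [Perm.mul_apply, Perm.mul_apply, swap_apply_left,
              swap_apply_of_ne_of_ne hpp (Ne.symm hjp)] at this
          · have c4 : j ≠ p₁ := fun e => c1 (Fin.ext (by subst e; omega))
            rw [hwk i c1 c3, hwk j c2 c4]
            have := h.comm hv hp₁ hij (by
              rw [Fin.lt_def, Fin.lt_def]
              have e1 : (i : ℕ) ≠ p := fun e => c1 (Fin.ext e)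
              have e2 : (j : ℕ) ≠ p := fun e => c2 (Fin.ext e)
              have e3 : (i : ℕ) ≠ p₁ := fun e => c3 (Fin.ext e)
              omega) hws
            rw [← hwv] at this
            rw [this]
            exact ihv i j hij hj

/-- Letters are added one at a time: `exists_last_value` extends the formula to words ending in the
new letter, and `isInvDiff_of_last` to all others. -/
theorem exists_values_aux (h : IsYoungCell M a) (m : ℕ) (hm : m ≤ n) :
    ∃ (cl : Fin n → ℕ) (val : Fin n → F), ∀ w ∈ M, FixesAbove m w →
      ∀ i j : Fin n, (j : ℕ) = i + 1 → (j : ℕ) < m →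
        IsInvDiff cl val (w i) (w j) (a w i j) := by
  induction m with
  | zero => exact ⟨fun _ => 0, fun _ => 0, fun w _ _ i j _ hj => absurd hj (Nat.not_lt_zero _)⟩
  | succ m ih =>
    rcases Nat.eq_zero_or_pos m with h0 | h0
    · subst h0
      exact ⟨fun _ => 0, fun _ => 0, fun w _ _ i j hij hj => by omega⟩
    · obtain ⟨cl, val, hg⟩ := ih (by omega)
      obtain ⟨L, hL⟩ : ∃ L : Fin n, (L : ℕ) = m := ⟨⟨m, hm⟩, rfl⟩
      obtain ⟨p, hp⟩ : ∃ p : Fin n, (L : ℕ) = p + 1 :=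
        ⟨⟨m - 1, by omega⟩, by change (L : ℕ) = m - 1 + 1; omega⟩
      obtain ⟨C, v, hCv⟩ := h.exists_last_value hL hp hg
      refine ⟨Function.update cl L C, Function.update val L v, ?_⟩
      have hbase : ∀ w ∈ M, FixesAbove m w → ∀ i j : Fin n, (j : ℕ) = i + 1 → (j : ℕ) < m + 1 →
          IsInvDiff (Function.update cl L C) (Function.update val L v) (w i) (w j)
            (a w i j) := by
        intro w hw hf i j hij hj
        have hi : w i ≠ L := fun e => by
          have := hf.lt (k := i) (by omega)
          rw [e] at this
          omega
        rcases Nat.lt_succ_iff_lt_or_eq.1 hj with hj | hj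
        · have hj' : w j ≠ L := fun e => by
            have := hf.lt hj
            rw [e] at this
            omega
          have := hg w hw hf i j hij hj
          simpa only [IsInvDiff, Function.update_of_ne hi, Function.update_of_ne hj'] using this
        · have hjL : j = L := Fin.ext (by omega)
          have hip : i = p := Fin.ext (by omega)
          have hwj : w j = L := by rw [hjL, hf L hL.ge]
          have := hCv w hw hf
          rw [← hip, ← hjL] at this
          rw [hwj]
          simpa only [IsInvDiff, Function.update_of_ne hi, Function.update_self] using this
      intro w hw hf i j hij hj
      have hpos := hf.inv.lt (k := L) (by omega)
      exact h.isInvDiff_of_last hL hbase (m - (w⁻¹ L : Fin n)) w hw hf (w⁻¹ L) (by simp) (by omega)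
        i j hij hj

theorem exists_values (h : IsYoungCell M a) :
    ∃ (cl : Fin n → ℕ) (val : Fin n → F), ∀ w ∈ M, ∀ i j : Fin n, (j : ℕ) = i + 1 →
      IsInvDiff cl val (w i) (w j) (a w i j) := by
  obtain ⟨cl, val, hg⟩ := h.exists_values_aux n le_rfl
  exact ⟨cl, val, fun w hw i j hij =>
    hg w hw (fun k hk => absurd k.2 (not_lt.2 hk)) i j hij j.2⟩

end IsYoungCell

end Values

end AbstractYoung

namespace AbstractYoung

open Equiv

/-! ### Integral contents -/

section Contents

variable {F : Type*} [Field F] [CharZero F] {n : ℕ}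

/-- Values in `F` may be replaced by natural numbers without changing which coefficients are
`1` or `-1`. -/
theorem exists_nat_values (cl : Fin n → ℕ) (val : Fin n → F) :
    ∃ c : Fin n → ℕ, (∀ x, 1 ≤ c x) ∧ ∀ x y α, IsInvDiff cl val x y α →
      c x ≠ c y ∧ (c y = c x + 1 ↔ α = 1) ∧ (c x = c y + 1 ↔ α = -1) := by
  -- Letters form blocks of one class with integral differences. Differences inside a block are
  -- kept, and the blocks are placed far apart.
  let S : Setoid (Fin n) :=
    { r := fun x y => cl x = cl y ∧ ∃ k : ℤ, val y - val x = k
      iseqv := by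
        refine ⟨fun x => ⟨rfl, 0, by simp⟩, ?_, ?_⟩
        · rintro x y ⟨h1, k, hk⟩
          exact ⟨h1.symm, -k, by push_cast; linear_combination -hk⟩
        · rintro x y z ⟨h1, k, hk⟩ ⟨h2, l, hl⟩
          exact ⟨h1.trans h2, k + l, by push_cast; linear_combination hk + hl⟩ }
  let rep : Fin n → Fin n := fun x => (Quotient.mk S x).out
  have hrep : ∀ x, S (rep x) x := fun x => Quotient.mk_out x
  have hrep_eq : ∀ x y, rep x = rep y ↔ S x y := by
    intro x y
    refine ⟨fun e => ?_, fun e => ?_⟩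
    · have h1 := hrep x
      rw [e] at h1
      exact S.trans (S.symm h1) (hrep y)
    · change (Quotient.mk S x).out = (Quotient.mk S y).out
      rw [Quotient.sound e]
  choose d hd using fun x => (hrep x).2
  obtain ⟨D, hD⟩ : ∃ D : ℕ, ∀ x, |d x| ≤ D := by
    refine ⟨∑ x, (d x).natAbs, fun x => ?_⟩
    have := Finset.single_le_sum (f := fun x => (d x).natAbs) (fun _ _ => Nat.zero_le _)
      (Finset.mem_univ x)
    rw [abs_le]
    omega
  have hD' : ∀ x, -(D : ℤ) ≤ d x ∧ d x ≤ D := fun x => abs_le.1 (hD x)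
  -- The spacing `2 * D + 2` exceeds the maximal spread `2 * D` of a block by two, so values of
  -- different blocks are neither equal nor adjacent. The `+ 1` makes all values positive.
  have hpos : ∀ x, 1 ≤ (2 * D + 2 : ℤ) * ((rep x : ℕ) + 1) + d x := by
    intro x
    have h1 := (hD' x).1
    have h2 : (0 : ℤ) ≤ (2 * D + 2 : ℤ) * ((rep x : ℕ) : ℤ) := by positivity
    linarith
  let c : Fin n → ℕ := fun x => ((2 * D + 2 : ℤ) * ((rep x : ℕ) + 1) + d x).toNat
  have hc : ∀ x, (c x : ℤ) = (2 * D + 2 : ℤ) * ((rep x : ℕ) + 1) + d x := fun x =>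
    Int.toNat_of_nonneg (by linarith [hpos x])
  have hsame : ∀ x y, S x y → ((c y : F) - (c x : F)) = val y - val x := by
    intro x y h
    have h1 := hc x
    have h2 := hc y
    rw [(hrep_eq x y).2 h] at h1
    have h3 : (c y : ℤ) - (c x : ℤ) = d y - d x := by linarith
    have h4 : ((c y : ℤ) : F) - ((c x : ℤ) : F) = (d y : F) - (d x : F) := by
      exact_mod_cast congrArg (Int.cast (R := F)) h3
    rw [Int.cast_natCast, Int.cast_natCast] at h4
    rw [h4, ← hd, ← hd, (hrep_eq x y).2 h]
    ring
  have hfar : ∀ x y, ¬ S x y → c x ≠ c y ∧ c y ≠ c x + 1 ∧ c x ≠ c y + 1 := by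
    have key : ∀ x y, (rep x : ℕ) < rep y → c x + 1 < c y := by
      intro x y hxy
      have h1 := hc x
      have h2 := hc y
      have h3 := (hD' x).2
      have h4 := (hD' y).1
      have h5 : (2 * D + 2 : ℤ) * ((rep x : ℕ) + 1 : ℤ) ≤ (2 * D + 2 : ℤ) * ((rep y : ℕ) : ℤ) :=
        mul_le_mul_of_nonneg_left (by exact_mod_cast hxy) (by positivity)
      have h6 : (c x : ℤ) + 1 < c y := by
        rw [h1, h2]
        linarith
      exact_mod_cast h6
    intro x y h
    have hne : (rep x : ℕ) ≠ rep y := fun e => h ((hrep_eq x y).1 (Fin.ext e))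
    rcases lt_or_gt_of_ne hne with hl | hl
    · have := key x y hl
      omega
    · have := key y x hl
      omega
  refine ⟨c, fun x => by have := hpos x; rw [← hc] at this; exact_mod_cast this, ?_⟩
  rintro x y α (⟨h1, h2⟩ | ⟨h1, rfl⟩)
  · by_cases hS : S x y
    · rw [← hsame x y hS] at h2
      refine ⟨fun e => ?_, ⟨fun e => ?_, fun e => ?_⟩, fun e => ?_, fun e => ?_⟩
      · rw [e, sub_self, mul_zero] at h2
        exact zero_ne_one h2
      · rw [e] at h2
        push_cast at h2
        linear_combination h2
      · have : (c y : F) = ((c x + 1 : ℕ) : F) := by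
          push_cast
          rw [e] at h2
          linear_combination h2
        exact_mod_cast this
      · rw [e] at h2
        push_cast at h2
        linear_combination -h2
      · have : (c x : F) = ((c y + 1 : ℕ) : F) := by
          push_cast
          rw [e] at h2
          linear_combination h2
        exact_mod_cast this
    -- In one class but different blocks, a coefficient `±1` would make the difference integral.
    · have hf := hfar x y hS
      refine ⟨hf.1, iff_of_false hf.2.1 ?_, iff_of_false hf.2.2 ?_⟩
      · rintro rfl
        exact hS ⟨h1, 1, by push_cast; linear_combination h2⟩
      · rintro rfl
        exact hS ⟨h1, -1, by push_cast; linear_combination -h2⟩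
  · have hf := hfar x y (fun hS => h1 hS.1)
    exact ⟨hf.1, iff_of_false hf.2.1 zero_ne_one,
      iff_of_false hf.2.2 (fun e => one_ne_zero (neg_eq_zero.1 e.symm))⟩

/-- Contents of the letters such that `M` consists of the words reachable by exchanging neighbours
with contents which are neither equal nor adjacent. -/
structure IsContentSystem (M : Set (Perm (Fin n))) (c : Fin n → ℕ) : Prop where
  one_mem : 1 ∈ M
  ne : ∀ {w}, w ∈ M → ∀ {i j : Fin n}, (j : ℕ) = i + 1 → c (w i) ≠ c (w j)
  ne_two : ∀ {w}, w ∈ M → ∀ {i j k : Fin n}, (j : ℕ) = i + 1 → (k : ℕ) = j + 1 →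
    c (w i) ≠ c (w k)
  mem_iff : ∀ {w}, w ∈ M → ∀ {i j : Fin n}, (j : ℕ) = i + 1 →
    (w * swap i j ∈ M ↔ c (w j) ≠ c (w i) + 1 ∧ c (w i) ≠ c (w j) + 1)
  mem_of_gt : ∀ {w}, w ∈ M → ∀ {i j : Fin n}, (j : ℕ) = i + 1 → w j < w i → w * swap i j ∈ M

/-- A step leaves `M` exactly when its coefficient squares to one, that is, when the contents are
adjacent. -/
theorem IsYoungCell.exists_contents {M : Set (Perm (Fin n))}
    {a : Perm (Fin n) → Fin n → Fin n → F} (h : IsYoungCell M a) :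
    ∃ c : Fin n → ℕ, (∀ x, 1 ≤ c x) ∧ IsContentSystem M c ∧
      ∀ w ∈ M, ∀ i j : Fin n, (j : ℕ) = i + 1 →
        (c (w j) = c (w i) + 1 → a w i j = 1) ∧ (c (w i) = c (w j) + 1 → a w i j = -1) := by
  obtain ⟨cl, val, hval⟩ := h.exists_values
  obtain ⟨c, hpos, hc⟩ := exists_nat_values cl val
  have key := fun w hw i j hij => hc _ _ _ (hval w hw i j hij)
  have hmem : ∀ {w}, w ∈ M → ∀ {i j : Fin n}, (j : ℕ) = i + 1 →
      (w * swap i j ∈ M ↔ c (w j) ≠ c (w i) + 1 ∧ c (w i) ≠ c (w j) + 1) := by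
    intro w hw i j hij
    rw [Ne, Ne, (key w hw i j hij).2.1, (key w hw i j hij).2.2, ← not_or, ← sq_eq_one_iff]
    exact ⟨h.sq_ne hw hij, fun hn => by_contra fun hm => hn (h.sq hw hij hm)⟩
  refine ⟨c, hpos, ⟨h.one_mem, fun hw i j hij => (key _ hw i j hij).1, ?_, hmem,
    fun hw i j hij hd => h.mul_swap_mem_of_gt hw hij hd⟩, fun w hw i j hij =>
    ⟨(key w hw i j hij).2.1.1, (key w hw i j hij).2.2.1⟩⟩
  intro w hw i j k hij hjk he
  have hki : k ≠ i := fun e => by subst e; omega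
  have hkj : k ≠ j := fun e => by subst e; omega
  by_cases hs : w * swap i j ∈ M
  · have := (key _ hs j k hjk).1
    rw [Perm.mul_apply, Perm.mul_apply, swap_apply_right, swap_apply_of_ne_of_ne hki hkj] at this
    exact this he
  -- With equal contents at `i` and `k`, both steps leave `M` and their coefficients are `1` and
  -- `-1` in some order, contrary to `eq_of_notMem`.
  · have ht : w * swap j k ∉ M := by
      rw [hmem hw hij] at hs
      rw [hmem hw hjk]
      omega
    have h1 := h.eq_of_notMem hw hij hjk hs ht
    rw [hmem hw hij, not_and_or, not_not, not_not] at hs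
    rcases hs with hs | hs
    · have h2 := (key w hw i j hij).2.1.1 hs
      have h3 := (key w hw j k hjk).2.2.1 (by omega)
      rw [h2, h3] at h1
      norm_num at h1
    · have h2 := (key w hw i j hij).2.2.1 hs
      have h3 := (key w hw j k hjk).2.1.1 (by omega)
      rw [h2, h3] at h1
      norm_num at h1

end Contents

/-! ### Interlacing of the contents -/

section ContentSystem

variable {n : ℕ} {M : Set (Perm (Fin n))} {c : Fin n → ℕ}

namespace IsContentSystem

/-- Induction on the distance: letters of equal content are drawn together by allowed exchanges
until both ends are blocked, and then their inner neighbours have adjacent contents. -/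
theorem exists_between_aux (h : IsContentSystem M c) (d : ℕ) :
    ∀ w ∈ M, ∀ p q : Fin n, (q : ℕ) = p + d → p < q → c (w p) = c (w q) →
      (∃ r, p < r ∧ r < q ∧ c (w r) = c (w p) + 1) ∧
      (∃ r, p < r ∧ r < q ∧ c (w p) = c (w r) + 1) := by
  induction d using Nat.strong_induction_on with
  | _ d ih =>
    intro w hw p q hd hpq he
    have hpq' := Fin.lt_def.1 hpq
    have hd1 : d ≠ 1 := fun e => h.ne hw (by omega) he
    obtain ⟨p₁, hp₁⟩ : ∃ p₁ : Fin n, (p₁ : ℕ) = p + 1 := ⟨⟨p + 1, by omega⟩, rfl⟩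
    obtain ⟨q₁, hq₁⟩ : ∃ q₁ : Fin n, (q : ℕ) = q₁ + 1 :=
      ⟨⟨q - 1, by omega⟩, by change (q : ℕ) = q - 1 + 1; omega⟩
    have hpp : p₁ ≠ p := fun e => by subst e; omega
    have hqq : q₁ ≠ q := fun e => by subst e; omega
    have hpq₁ : p₁ ≠ q := fun e => by subst e; omega
    have hqp₁ : q₁ ≠ p := fun e => by subst e; omega
    by_cases hmid : ∃ r, p < r ∧ r < q ∧ c (w r) = c (w p)
    · obtain ⟨r, h1, h2, h3⟩ := hmid
      obtain ⟨⟨s, hs⟩, ⟨s', hs'⟩⟩ := ih (r - p) (by rw [Fin.lt_def] at *; omega) w hw p r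
        (by rw [Fin.lt_def] at *; omega) h1 h3.symm
      exact ⟨⟨s, hs.1, hs.2.1.trans h2, hs.2.2⟩, ⟨s', hs'.1, hs'.2.1.trans h2, hs'.2.2⟩⟩
    push Not at hmid
    by_cases hp : w * swap p p₁ ∈ M
    · have e1 : ∀ r, p₁ < r → (w * swap p p₁) r = w r := fun r hr => by
        rw [Perm.mul_apply, swap_apply_of_ne_of_ne (fun e => by subst e; rw [Fin.lt_def] at hr; omega)
          hr.ne']
      have e2 : (w * swap p p₁) p₁ = w p := by rw [Perm.mul_apply, swap_apply_right]
      have hl : p₁ < q := by rw [Fin.lt_def]; omega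
      have hpl : p < p₁ := by rw [Fin.lt_def]; omega
      obtain ⟨⟨s, hs, hs1, hs2⟩, ⟨s', hs', hs1', hs2'⟩⟩ := ih (d - 1) (by omega) _ hp p₁ q (by omega)
        hl (by rw [e2, e1 q hl, he])
      rw [e2, e1 _ hs] at hs2
      rw [e2, e1 _ hs'] at hs2'
      exact ⟨⟨s, hpl.trans hs, hs1, hs2⟩, ⟨s', hpl.trans hs', hs1', hs2'⟩⟩
    by_cases hq : w * swap q₁ q ∈ M
    · have e1 : ∀ r, r < q₁ → (w * swap q₁ q) r = w r := fun r hr => by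
        rw [Perm.mul_apply, swap_apply_of_ne_of_ne hr.ne
          (fun e => by subst e; rw [Fin.lt_def] at hr; omega)]
      have e2 : (w * swap q₁ q) q₁ = w q := by rw [Perm.mul_apply, swap_apply_left]
      have hl : p < q₁ := by rw [Fin.lt_def]; omega
      have hpl : q₁ < q := by rw [Fin.lt_def]; omega
      obtain ⟨⟨s, hs, hs1, hs2⟩, ⟨s', hs', hs1', hs2'⟩⟩ := ih (d - 1) (by omega) _ hq p q₁ (by omega)
        hl (by rw [e2, e1 p hl, he])
      rw [e1 _ hl, e1 _ hs1] at hs2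
      rw [e1 _ hl, e1 _ hs1'] at hs2'
      exact ⟨⟨s, hs, hs1.trans hpl, hs2⟩, ⟨s', hs', hs1'.trans hpl, hs2'⟩⟩
    rw [h.mem_iff hw hp₁] at hp
    rw [h.mem_iff hw hq₁] at hq
    have hlp : p < p₁ := by rw [Fin.lt_def]; omega
    have hlp' : p₁ < q := by rw [Fin.lt_def]; omega
    have hlq : p < q₁ := by rw [Fin.lt_def]; omega
    have hlq' : q₁ < q := by rw [Fin.lt_def]; omega
    -- Inner neighbours of equal content cannot coincide, by `ne_two`, and otherwise induction puts
    -- a letter of content `c (w p)` between them, against `hmid`. So one lies above and the other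
    -- below.
    by_cases hsame : c (w p₁) = c (w q₁)
    · exfalso
      by_cases hpq₂ : p₁ = q₁
      · exact h.ne_two hw hp₁ (by rw [hpq₂]; exact hq₁) he
      · have hne : (p₁ : ℕ) ≠ q₁ := fun e => hpq₂ (Fin.ext e)
        obtain ⟨⟨s, hs, hs1, hs2⟩, ⟨s', hs', hs1', hs2'⟩⟩ := ih (d - 2) (by omega) w hw p₁ q₁
          (by omega) (by rw [Fin.lt_def]; omega) hsame
        have k1 := hmid s (hlp.trans hs) (hs1.trans hlq')
        have k2 := hmid s' (hlp.trans hs') (hs1'.trans hlq')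
        omega
    · by_cases hup : c (w p₁) = c (w p) + 1
      · exact ⟨⟨p₁, hlp, hlp', hup⟩, ⟨q₁, hlq, hlq', by omega⟩⟩
      · exact ⟨⟨q₁, hlq, hlq', by omega⟩, ⟨p₁, hlp, hlp', by omega⟩⟩

theorem exists_between (h : IsContentSystem M c) {p q : Fin n} (hpq : p < q) (he : c p = c q) :
    (∃ r, p < r ∧ r < q ∧ c r = c p + 1) ∧ (∃ r, p < r ∧ r < q ∧ c p = c r + 1) :=
  h.exists_between_aux (q - p) 1 h.one_mem p q (by rw [Fin.lt_def] at hpq; omega) hpq he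

/-- Both sets are closed under descents, and whether undoing a descent stays inside depends only on
the contents of the two letters. -/
theorem mem_iff_mem_cell {F : Type*} [Field F] [CharZero F] (h : IsContentSystem M c)
    (w : Perm (Fin n)) : w ∈ M ↔ w ∈ cell (fun k => ((c k : ℤ) : F)) 1 := by
  have hcast : ∀ x y : Fin n, (((c y : ℤ) : F) - ((c x : ℤ) : F) = 1 ∨
      ((c y : ℤ) : F) - ((c x : ℤ) : F) = -1) ↔ (c y = c x + 1 ∨ c x = c y + 1) := by
    intro x y
    rw [SkewTableau.cast_sub_eq_one, SkewTableau.cast_sub_eq_neg_one]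
    omega
  constructor
  · refine descent_induction w (fun _ => one_mem_cell _) ?_
    intro u i j hij hd ih hu
    have hus := h.mem_of_gt hu hij hd
    have hc := (h.mem_iff hu hij).1 hus
    have hmem := mul_swap_mem_cell (ih hus) hij (i := i) (j := j)
    have hback : u * swap i j * swap i j = u := by rw [mul_assoc, swap_mul_self, mul_one]
    rw [hback, Perm.mul_apply, Perm.mul_apply, swap_apply_left, swap_apply_right] at hmem
    have := mt (hcast (u j) (u i)).1 (by omega)
    rw [not_or] at this
    exact hmem this.1 this.2
  · refine descent_induction w (fun _ => h.one_mem) ?_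
    intro u i j hij hd ih hu
    have hus := mul_swap_mem_cell_of_descent hu hij hd
    have hc := of_mul_swap_mem_cell hu hij hus
    rw [← not_or, hcast] at hc
    have hback : u * swap i j * swap i j = u := by rw [mul_assoc, swap_mul_self, mul_one]
    have hmem := h.mem_iff (ih hus) hij
    rw [hback, Perm.mul_apply, Perm.mul_apply, swap_apply_left, swap_apply_right] at hmem
    exact hmem.2 (by omega)

end IsContentSystem

end ContentSystem

end AbstractYoung

namespace AbstractYoung

open Equiv SkewTableau

/-! ### The skew shape of a sequence of contents -/

section Shape

variable {n : ℕ} (c : Fin n → ℕ)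

/-- The content `m + 1` occurs, and no `m` occurs before it. -/
def StartsUp (m : ℕ) : Prop := ∃ j : Fin n, c j = m + 1 ∧ ∀ i, i ≤ j → c i ≠ m

open Classical in
/-- The row in which the diagonal of content `m` starts. -/
noncomputable def diagStart (m : ℕ) : ℕ :=
  ((Finset.range (∑ j, c j)).filter (fun k => m ≤ k ∧ StartsUp c k)).card

/-- The row of the first box on the diagonal of content `m` left free by the letters below `k`. -/
noncomputable def diagRow (k m : ℕ) : ℕ :=
  diagStart c m + (Finset.univ.filter (fun j : Fin n => (j : ℕ) < k ∧ c j = m)).card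

variable {c}

theorem StartsUp.lt {m : ℕ} (h : StartsUp c m) : m < ∑ j, c j := by
  obtain ⟨j, hj, _⟩ := h
  have := Finset.single_le_sum (f := c) (fun _ _ => Nat.zero_le _) (Finset.mem_univ j)
  omega

open Classical in
-- `diagStart` counts the contents from `m` on at which the inner boundary steps down, so
-- neighbouring diagonals differ by at most one such step.
theorem diagStart_eq (m : ℕ) :
    diagStart c m = diagStart c (m + 1) + if StartsUp c m then 1 else 0 := by
  unfold diagStart
  have h1 : (Finset.range (∑ j, c j)).filter (fun k => m ≤ k ∧ StartsUp c k) =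
      (Finset.range (∑ j, c j)).filter (fun k => m + 1 ≤ k ∧ StartsUp c k) ∪
        (if StartsUp c m then {m} else ∅) := by
    ext k
    split_ifs with h
    · simp only [Finset.mem_filter, Finset.mem_range, Finset.mem_union, Finset.mem_singleton]
      constructor
      · rintro ⟨h1, h2, h3⟩
        by_cases hk : k = m
        · exact Or.inr hk
        · exact Or.inl ⟨h1, by omega, h3⟩
      · rintro (⟨h1, h2, h3⟩ | rfl)
        · exact ⟨h1, by omega, h3⟩
        · exact ⟨h.lt, le_rfl, h⟩
    · simp only [Finset.mem_filter, Finset.union_empty]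
      constructor
      · rintro ⟨h1, h2, h3⟩
        refine ⟨h1, ?_, h3⟩
        by_contra hk
        have : k = m := by omega
        exact h (this ▸ h3)
      · rintro ⟨h1, h2, h3⟩
        exact ⟨h1, by omega, h3⟩
  rw [h1, Finset.card_union_of_disjoint]
  · split_ifs <;> simp
  · split_ifs
    · rw [Finset.disjoint_singleton_right, Finset.mem_filter]
      rintro ⟨_, h, _⟩
      omega
    · exact Finset.disjoint_empty_right _

theorem diagRow_succ (k : Fin n) (m : ℕ) :
    diagRow c (k + 1) m = diagRow c k m + if c k = m then 1 else 0 := by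
  unfold diagRow
  rw [add_assoc]
  congr 1
  have h1 : Finset.univ.filter (fun j : Fin n => (j : ℕ) < k + 1 ∧ c j = m) =
      Finset.univ.filter (fun j : Fin n => (j : ℕ) < k ∧ c j = m) ∪
        (if c k = m then {k} else ∅) := by
    ext j
    have hjk : j = k ↔ (j : ℕ) = k := Fin.ext_iff
    split_ifs with h
    · simp only [Finset.mem_filter, Finset.mem_univ, true_and, Finset.mem_union,
        Finset.mem_singleton]
      constructor
      · rintro ⟨h1, h2⟩
        by_cases e : j = k
        · exact Or.inr e
        · exact Or.inl ⟨by omega, h2⟩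
      · rintro (⟨h1, h2⟩ | rfl)
        · exact ⟨by omega, h2⟩
        · exact ⟨by omega, h⟩
    · simp only [Finset.mem_filter, Finset.mem_univ, true_and, Finset.union_empty]
      constructor
      · rintro ⟨h1, h2⟩
        refine ⟨?_, h2⟩
        by_contra e
        have : j = k := hjk.2 (by omega)
        exact h (this ▸ h2)
      · rintro ⟨h1, h2⟩
        exact ⟨by omega, h2⟩
  rw [h1, Finset.card_union_of_disjoint]
  · split_ifs <;> simp
  · split_ifs
    · rw [Finset.disjoint_singleton_right, Finset.mem_filter]
      rintro ⟨_, h, _⟩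
      omega
    · exact Finset.disjoint_empty_right _

theorem diagRow_zero (m : ℕ) : diagRow c 0 m = diagStart c m := by
  simp [diagRow]

theorem diagRow_mono {k l : ℕ} (h : k ≤ l) (m : ℕ) : diagRow c k m ≤ diagRow c l m := by
  refine Nat.add_le_add_left (Finset.card_le_card (fun j hj => ?_)) _
  rw [Finset.mem_filter] at *
  exact ⟨hj.1, by omega, hj.2.2⟩

theorem diagRow_lt {k : Fin n} {l : ℕ} (h : (k : ℕ) < l) : diagRow c k (c k) < diagRow c l (c k) := by
  have h1 := diagRow_succ (c := c) k (c k)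
  rw [if_pos rfl] at h1
  have := diagRow_mono (c := c) (k := k + 1) (l := l) h (c k)
  omega

/-- Between two letters of the same content there are letters of both adjacent contents. -/
def IsInterlaced (c : Fin n → ℕ) : Prop := ∀ p q : Fin n, p < q → c p = c q →
  (∃ r, p < r ∧ r < q ∧ c r = c p + 1) ∧ (∃ r, p < r ∧ r < q ∧ c p = c r + 1)

/-- The ends of the diagonals always bound a Young diagram. -/
theorem IsInterlaced.diagRow_aux (hc : IsInterlaced c) (m k : ℕ) (hk : k ≤ n) :
    (diagRow c k (m + 1) ≤ diagRow c k m ∧ diagRow c k m ≤ diagRow c k (m + 1) + 1) ∧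
    (∀ l : Fin n, k ≤ l → c l = m + 1 →
      (∀ j : Fin n, k ≤ j → j < l → c j ≠ m ∧ c j ≠ m + 1) →
        diagRow c k m = diagRow c k (m + 1) + 1) ∧
    (∀ l : Fin n, k ≤ l → c l = m →
      (∀ j : Fin n, k ≤ j → j < l → c j ≠ m ∧ c j ≠ m + 1) →
        diagRow c k m = diagRow c k (m + 1)) := by
  classical
  induction k with
  | zero =>
    rw [diagRow_zero, diagRow_zero, diagStart_eq m]
    refine ⟨by split_ifs <;> omega, fun l _ hl h => ?_, fun l _ hl h => ?_⟩
    · rw [if_pos]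
      refine ⟨l, hl, fun i hi => ?_⟩
      rcases eq_or_lt_of_le hi with rfl | hi
      · omega
      · exact (h i (Nat.zero_le _) hi).1
    · rw [if_neg, add_zero]
      rintro ⟨j, hj, hj'⟩
      rcases lt_or_ge j l with hjl | hjl
      · exact (h j (Nat.zero_le _) hjl).2 hj
      · exact hj' l hjl hl
  | succ k ih =>
    obtain ⟨ih1, ih2, ih3⟩ := ih (by omega)
    obtain ⟨p, hp⟩ : ∃ p : Fin n, (p : ℕ) = k := ⟨⟨k, hk⟩, rfl⟩
    have e1 := diagRow_succ (c := c) p m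
    have e2 := diagRow_succ (c := c) p (m + 1)
    rw [hp] at e1 e2
    -- A letter of content `m` or `m + 1` switches the difference of the two rows between `0` and
    -- `1`, and by interlacing the next letter with either content has the other one.
    by_cases c1 : c p = m
    · have h0 := ih3 p hp.ge c1 (fun j h1 h2 => by rw [Fin.lt_def] at h2; omega)
      rw [if_pos c1] at e1
      rw [if_neg (by omega)] at e2
      refine ⟨by omega, fun _ _ _ _ => by omega, fun l hl hcl h => ?_⟩
      obtain ⟨⟨r, hr1, hr2, hr3⟩, _⟩ := hc p l (by rw [Fin.lt_def]; omega) (by omega)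
      exact absurd (by omega) (h r (by rw [Fin.lt_def] at hr1; omega) hr2).2
    · by_cases c2 : c p = m + 1
      · have h0 := ih2 p hp.ge c2 (fun j h1 h2 => by rw [Fin.lt_def] at h2; omega)
        rw [if_neg c1] at e1
        rw [if_pos c2] at e2
        refine ⟨by omega, fun l hl hcl h => ?_, fun _ _ _ _ => by omega⟩
        obtain ⟨_, ⟨r, hr1, hr2, hr3⟩⟩ := hc p l (by rw [Fin.lt_def]; omega) (by omega)
        exact absurd (by omega) (h r (by rw [Fin.lt_def] at hr1; omega) hr2).1
      · rw [if_neg c1, add_zero] at e1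
        rw [if_neg c2, add_zero] at e2
        rw [e1, e2]
        have hext : ∀ l : Fin n, (∀ j : Fin n, k + 1 ≤ j → j < l → c j ≠ m ∧ c j ≠ m + 1) →
            ∀ j : Fin n, k ≤ j → j < l → c j ≠ m ∧ c j ≠ m + 1 := by
          intro l h j hj hjl
          by_cases e : (j : ℕ) = k
          · have : j = p := Fin.ext (by omega)
            rw [this]
            exact ⟨c1, c2⟩
          · exact h j (by omega) hjl
        exact ⟨ih1, fun l hl hcl h => ih2 l (by omega) hcl (hext l h),
          fun l hl hcl h => ih3 l (by omega) hcl (hext l h)⟩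

theorem IsInterlaced.diagRow_le (hc : IsInterlaced c) {k : ℕ} (hk : k ≤ n) (m : ℕ) :
    diagRow c k (m + 1) ≤ diagRow c k m ∧ diagRow c k m ≤ diagRow c k (m + 1) + 1 :=
  (hc.diagRow_aux m k hk).1

theorem diagRow_eq_zero {k m : ℕ} (hm : ∑ j, c j < m) : diagRow c k m = 0 := by
  classical
  unfold diagRow diagStart
  rw [Nat.add_eq_zero_iff, Finset.card_eq_zero, Finset.card_eq_zero, Finset.filter_eq_empty_iff,
    Finset.filter_eq_empty_iff]
  constructor
  · intro x hx h
    rw [Finset.mem_range] at hx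
    omega
  · rintro j _ ⟨_, h⟩
    have := Finset.single_le_sum (f := c) (fun _ _ => Nat.zero_le _) (Finset.mem_univ j)
    omega

theorem diagRow_le_bound (k m : ℕ) : diagRow c k m ≤ ∑ j, c j + n := by
  classical
  unfold diagRow diagStart
  refine Nat.add_le_add ?_ ?_
  · exact (Finset.card_filter_le _ _).trans (Finset.card_range _).le
  · exact (Finset.card_filter_le _ _).trans (by simp)

/-- The Young diagram bounded by the ends of the diagonals; its boxes on or below the main diagonal
depend on the diagonal of content `0` only. -/
noncomputable def diagShape (hc : IsInterlaced c) (k : ℕ) (hk : k ≤ n) : YoungDiagram where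
  cells := (Finset.range (2 * (∑ j, c j + n) + 1) ×ˢ Finset.range (2 * (∑ j, c j + n) + 1)).filter
    (fun x => x.1 < diagRow c k (x.2 - x.1))
  isLowerSet := by
    have hanti : ∀ {m m' : ℕ}, m ≤ m' → diagRow c k m' ≤ diagRow c k m := fun h =>
      antitone_nat_of_succ_le (fun m => (hc.diagRow_le hk m).1) h
    -- Moving up `d` rows passes at most `d` diagonals, over which the bound drops by at most `d`.
    have hstep : ∀ d m, diagRow c k m ≤ diagRow c k (m + d) + d := by
      intro d
      induction d with
      | zero => exact fun m => le_rfl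
      | succ d ih =>
        intro m
        have h1 := ih m
        have h2 := (hc.diagRow_le hk (m + d)).2
        rw [add_assoc] at h2
        omega
    rintro ⟨i, j⟩ ⟨i', j'⟩ ⟨hi, hj⟩ hx
    simp only [Finset.coe_filter, Finset.mem_product, Finset.mem_range, Set.mem_ofPred_eq] at *
    refine ⟨by omega, ?_⟩
    have h1 : diagRow c k (j - i) ≤ diagRow c k (j' - i) := hanti (by omega)
    have h2 := hstep (i - i') (j' - i)
    have h3 : diagRow c k (j' - i + (i - i')) ≤ diagRow c k (j' - i') := hanti (by omega)
    omega

theorem mem_diagShape (hc : IsInterlaced c) {k : ℕ} (hk : k ≤ n) {x : ℕ × ℕ} :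
    x ∈ (diagShape hc k hk).cells ↔ x.1 < diagRow c k (x.2 - x.1) := by
  simp only [diagShape, Finset.mem_filter, Finset.mem_product, Finset.mem_range,
    and_iff_right_iff_imp]
  -- The bounds on the rows and on the contents of nonempty diagonals keep the box inside the
  -- ambient square.
  intro h
  have h1 := diagRow_le_bound (c := c) k (x.2 - x.1)
  have h2 : ¬ ∑ j, c j < x.2 - x.1 := fun h2 => by
    rw [diagRow_eq_zero h2] at h
    omega
  omega

/-- A discrete intermediate value argument: the row on diagonal `m` advances by one exactly when a
letter of content `m` is added. -/
theorem exists_diagRow_eq {m i : ℕ} : ∀ k : ℕ, k ≤ n → diagRow c 0 m ≤ i → i < diagRow c k m →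
    ∃ l : Fin n, (l : ℕ) < k ∧ c l = m ∧ diagRow c l m = i := by
  intro k
  induction k with
  | zero => intro _ h1 h2; omega
  | succ k ih =>
    intro hk h1 h2
    by_cases h3 : i < diagRow c k m
    · obtain ⟨l, hl, h⟩ := ih (by omega) h1 h3
      exact ⟨l, by omega, h⟩
    · obtain ⟨p, hp⟩ : ∃ p : Fin n, (p : ℕ) = k := ⟨⟨k, hk⟩, rfl⟩
      have h4 := diagRow_succ (c := c) p m
      rw [hp] at h4
      by_cases h5 : c p = m
      · rw [if_pos h5] at h4
        exact ⟨p, by omega, h5, by rw [hp]; omega⟩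
      · rw [if_neg h5] at h4
        omega

/-- An interlaced sequence of positive contents is the content vector of a standard tableau of
skew shape. -/
theorem exists_isStandard_content (hc : IsInterlaced c) (hpos : ∀ k, 1 ≤ c k) :
    ∃ (lam mu : YoungDiagram) (_ : mu ≤ lam) (Q : SkewTableau lam mu n), IsStandard Q ∧
      ∀ k, content Q k = c k := by
  let lam := diagShape hc n le_rfl
  let mu := diagShape hc 0 (Nat.zero_le n)
  have hmem : ∀ x : ℕ × ℕ, x ∈ skewCells lam mu ↔
      x.1 < diagRow c n (x.2 - x.1) ∧ diagRow c 0 (x.2 - x.1) ≤ x.1 := by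
    intro x
    rw [skewCells, Finset.mem_sdiff, mem_diagShape, mem_diagShape, not_lt]
  -- Each letter takes the first free box of its diagonal.
  have hbox : ∀ k : Fin n, (diagRow c k (c k), diagRow c k (c k) + c k) ∈ skewCells lam mu := by
    intro k
    rw [hmem]
    simp only [add_tsub_cancel_left]
    exact ⟨diagRow_lt k.2, diagRow_mono (Nat.zero_le _) _⟩
  let box : Fin n → skewCells lam mu := fun k => ⟨_, hbox k⟩
  have hinj : Function.Injective box := by
    intro k l h
    have h0 : (diagRow c k (c k), diagRow c k (c k) + c k) =
      (diagRow c l (c l), diagRow c l (c l) + c l) := congrArg Subtype.val h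
    rw [Prod.mk.injEq] at h0
    have h1 : c k = c l := by omega
    rcases lt_trichotomy (k : ℕ) l with hl | hl | hl
    · have := diagRow_lt (c := c) hl
      rw [← h1] at h0
      omega
    · exact Fin.ext hl
    · have := diagRow_lt (c := c) hl
      rw [h1] at h0
      omega
  have hsurj : Function.Surjective box := by
    rintro ⟨⟨i, j⟩, hx⟩
    have hx' := (hmem _).1 hx
    simp only at hx'
    obtain ⟨l, _, h1, h2⟩ := exists_diagRow_eq n le_rfl hx'.2 hx'.1
    -- Positivity of the content makes the truncated difference `j - i` the true one.
    have := hpos l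
    refine ⟨l, Subtype.ext (Prod.ext ?_ ?_)⟩
    · change diagRow c l (c l) = i
      rw [h1, h2]
    · change diagRow c l (c l) + c l = j
      rw [h1, h2]
      omega
  let Q : SkewTableau lam mu n := (Equiv.ofBijective box ⟨hinj, hsurj⟩).symm
  have hrow : ∀ k, row Q k = diagRow c k (c k) := fun k => rfl
  have hcol : ∀ k, col Q k = diagRow c k (c k) + c k := fun k => rfl
  refine ⟨lam, mu, ?_, Q, isStandard_of_adjacent ?_ ?_, fun k => ?_⟩
  · intro x hx
    rw [← YoungDiagram.mem_cells, mem_diagShape] at hx ⊢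
    exact hx.trans_le (diagRow_mono (Nat.zero_le _) _)
  · intro k l hr hcl
    rw [hrow, hrow] at hr
    rw [hcol, hcol] at hcl
    have hcc : c l = c k + 1 := by omega
    by_contra hn
    have hlk : (l : ℕ) < k := by
      refine lt_of_le_of_ne (not_lt.1 hn) (fun e => ?_)
      rw [Fin.ext e] at hcc
      omega
    have h1 := diagRow_lt (c := c) hlk
    have h2 := (hc.diagRow_le k.2.le (c k)).1
    rw [hcc] at h1 hr
    omega
  · intro k l hcl hr
    rw [hrow, hrow] at hr
    rw [hcol, hcol] at hcl
    have hcc : c k = c l + 1 := by omega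
    by_contra hn
    have hlk : (l : ℕ) < k := by
      refine lt_of_le_of_ne (not_lt.1 hn) (fun e => ?_)
      rw [Fin.ext e] at hcc
      omega
    have h1 := diagRow_lt (c := c) hlk
    have h2 := (hc.diagRow_le k.2.le (c l)).2
    rw [hcc] at hr
    omega
  · rw [content, hrow, hcol]
    push_cast
    ring

end Shape

/-! ### Classification of minimal pairs -/

section Classification

variable {F : Type*} [Field F] [CharZero F] {n : ℕ}

/-- The representation of a minimal abstract Young pair is a skew Specht module. -/
theorem IsMinimalAYPair.exists_equiv_skewSpecht {K : Finset (Perm (Fin n))}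
    {ρ : Representation F (Perm (Fin n)) (K →₀ F)} (hmin : IsMinimalAYPair K ρ) :
    ∃ lam mu : YoungDiagram, mu ≤ lam ∧ (skewCells lam mu).card = n ∧
      Nonempty (ρ.Equiv (skewSpecht F n lam mu)) := by
  obtain ⟨a, b, hab⟩ := hmin.1.exists_hasCoeffs
  obtain ⟨u, hu⟩ := hmin.2.1
  obtain ⟨c, hpos, hcs, hca⟩ := (hab.isYoungCell hmin hu).exists_contents
  obtain ⟨lam, mu, hle, Q, hQ, hcQ⟩ :=
    exists_isStandard_content (c := c) (fun p q hpq he => hcs.exists_between hpq he) hpos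
  have hcard := card_skewCells_of_tableau Q
  refine ⟨lam, mu, hle, hcard, ?_⟩
  have hK : ∀ w, u * w ∈ K ↔ IsStandard (Q.trans w⁻¹ : SkewTableau lam mu n) := fun w =>
    (hcs.mem_iff_mem_cell (F := F) w).trans
      (mem_cell_iff hQ (fun i j _ => by rw [hcQ, hcQ]) w)
  refine (isSeminormal_of_cell u hK (fun w hw i j hij => ?_)).nonempty_equiv_skewSpecht hcard
  have h1 := hca w hw i j hij
  refine ⟨_, _, hab.apply _ hw i j hij, fun h => h1.1 ?_, fun h => h1.2 ?_,
    hab.ne_zero hmin hw hij⟩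
  · rw [hcQ, hcQ] at h
    omega
  · rw [hcQ, hcQ] at h
    omega

end Classification

end AbstractYoung

namespace AbstractYoung

open Equiv SkewTableau

/-! ### Irreducibility for straight shapes -/

section JucysMurphy

variable {F : Type*} [Field F] {n : ℕ} {V : Type*} [AddCommGroup V] [Module F V]

/-- The operator of the Jucys-Murphy element of the letter `k`. -/
noncomputable def jucysMurphy (ρ : Representation F (Perm (Fin n)) V) (k : Fin n) :
    Module.End F V := ∑ l ∈ Finset.univ.filter (fun l => l < k), ρ (swap l k)

theorem jucysMurphy_mem {ρ : Representation F (Perm (Fin n)) V} {D : Submodule F V}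
    (hD : ∀ g, ∀ x ∈ D, ρ g x ∈ D) (k : Fin n) {x : V} (hx : x ∈ D) : jucysMurphy ρ k x ∈ D := by
  rw [jucysMurphy, LinearMap.sum_apply]
  exact D.sum_mem fun l _ => hD _ x hx

/-- Conjugation by `swap i j` turns `swap l i` into `swap l j` for `l < i`; the extra term is `swap
i j` itself. -/
theorem jucysMurphy_succ (ρ : Representation F (Perm (Fin n)) V) {i j : Fin n}
    (hij : (j : ℕ) = i + 1) (x : V) : jucysMurphy ρ j x =
      ρ (swap i j) (jucysMurphy ρ i (ρ (swap i j) x)) + ρ (swap i j) x := by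
  classical
  have h1 : Finset.univ.filter (fun l : Fin n => l < j) =
      insert i (Finset.univ.filter (fun l : Fin n => l < i)) := by
    ext l
    simp only [Finset.mem_filter, Finset.mem_univ, true_and, Finset.mem_insert, Fin.lt_def,
      Fin.ext_iff]
    omega
  rw [jucysMurphy, h1, Finset.sum_insert (by simp), LinearMap.add_apply, add_comm]
  congr 1
  rw [jucysMurphy, LinearMap.sum_apply, LinearMap.sum_apply, map_sum]
  refine Finset.sum_congr rfl (fun l hl => ?_)
  have hli : l < i := (Finset.mem_filter.1 hl).2
  have hlj : l ≠ j := fun e => by subst e; rw [Fin.lt_def] at hli; omega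
  have h2 : swap l j = swap i j * swap l i * swap i j := by
    have := conj_swap (swap i j) l i
    rw [swap_inv, swap_apply_of_ne_of_ne hli.ne hlj, swap_apply_left] at this
    exact this.symm
  rw [h2, map_mul, map_mul, Module.End.mul_apply, Module.End.mul_apply]

end JucysMurphy

/-! ### Contents as Jucys-Murphy eigenvalues -/

section Irreducible

variable {F : Type*} [Field F] {n : ℕ} {K : Finset (Perm (Fin n))} {f : Fin n → F}
  {bUp bDown : Perm (Fin n) → F} {ρ : Representation F (Perm (Fin n)) (K →₀ F)}

namespace IsFunctionalRep

/-- The recursion for the Jucys-Murphy elements matches the diagonal coefficient `(f (w j) - f (w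
i))⁻¹`; `h0` provides the start, the first element being an empty sum. -/
theorem jucysMurphy_cellVec (hK : IsContentCell K f) (hb : IsNormalization K f bUp bDown)
    (hρ : IsFunctionalRep K f bUp bDown ρ)
    (h0 : ∀ w ∈ K, ∀ k : Fin n, (k : ℕ) = 0 → f (w k) = 0) (m : ℕ) :
    ∀ k : Fin n, (k : ℕ) = m → ∀ w ∈ K,
      jucysMurphy ρ k (cellVec F K w) = f (w k) • cellVec F K w := by
  induction m with
  | zero =>
    intro k hk w hw
    rw [h0 w hw k hk, zero_smul, jucysMurphy, Finset.filter_eq_empty_iff.2, Finset.sum_empty,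
      LinearMap.zero_apply]
    intro l _ hl
    rw [Fin.lt_def] at hl
    omega
  | succ m ih =>
    intro j hj w hw
    obtain ⟨i, hi⟩ : ∃ i : Fin n, (i : ℕ) = m := ⟨⟨m, by omega⟩, rfl⟩
    have hij : (j : ℕ) = i + 1 := by omega
    obtain ⟨b, _, hs⟩ := hρ.exists_coeff hK hb hw hij
    have h1 := ih i hi w hw
    have h2 : jucysMurphy ρ i (b • cellVec F K (w * swap i j)) =
        f (w j) • b • cellVec F K (w * swap i j) := by
      by_cases hws : w * swap i j ∈ K
      · rw [map_smul, ih i hi _ hws, Perm.mul_apply, swap_apply_left, smul_comm]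
      · rw [cellVec_of_notMem hws, smul_zero, map_zero, smul_zero]
    have hd := sub_ne_zero.2 (hK.ne w hw i j hij).symm
    have h3 : jucysMurphy ρ i (ρ (swap i j) (cellVec F K w)) =
        f (w j) • ρ (swap i j) (cellVec F K w) - cellVec F K w := by
      rw [hs, map_add, map_smul, h1, h2]
      have h4 : (f (w j) - f (w i))⁻¹ * (f (w j) - f (w i)) = 1 := inv_mul_cancel₀ hd
      have h5 : (f (w j) - f (w i))⁻¹ • f (w i) • cellVec F K w =
          f (w j) • (f (w j) - f (w i))⁻¹ • cellVec F K w - cellVec F K w := by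
        rw [smul_smul, smul_smul, eq_sub_iff_add_eq]
        nth_rewrite 2 [← one_smul F (cellVec F K w)]
        rw [← add_smul]
        congr 1
        linear_combination -h4
      rw [h5, smul_add]
      abel
    rw [jucysMurphy_succ ρ hij, h3, map_sub, map_smul, sub_add_cancel, HasCoeffs.rep_swap_swap]

/-- If the contents separate the elements of `K`, then the representation is irreducible. -/
theorem eq_top_of_invariant (hK : IsContentCell K f) (hb : IsNormalization K f bUp bDown)
    (hρ : IsFunctionalRep K f bUp bDown ρ) (hmin : IsMinimalAYPair K ρ)
    (h0 : ∀ w ∈ K, ∀ k : Fin n, (k : ℕ) = 0 → f (w k) = 0)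
    (hsep : ∀ w ∈ K, ∀ w' ∈ K, (∀ k, f (w k) = f (w' k)) → w = w')
    {D : Submodule F (K →₀ F)} (hD : ∀ g, ∀ x ∈ D, ρ g x ∈ D) (hne : D ≠ ⊥) : D = ⊤ := by
  classical
  have hjm : ∀ (k : Fin n) (x : K →₀ F) (w : K), jucysMurphy ρ k x w = f (w.1 k) * x w := by
    intro k x w
    have : Finsupp.lapply w ∘ₗ jucysMurphy ρ k = f (w.1 k) • Finsupp.lapply (R := F) w := by
      refine cellVec_ext (fun v hv => ?_)
      rw [LinearMap.comp_apply, hρ.jucysMurphy_cellVec hK hb h0 _ k rfl v hv, map_smul,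
        LinearMap.smul_apply, Finsupp.lapply_apply]
      have := cellVec_apply (F := F) (h := v) w.2
      rw [Subtype.coe_eta] at this
      rw [this, smul_eq_mul, smul_eq_mul]
      split_ifs with e
      · rw [e]
      · rw [mul_zero, mul_zero]
    exact LinearMap.congr_fun this x
  -- Subtracting from a Jucys-Murphy operator one of its eigenvalues on the support removes a word
  -- from the support and keeps another. So `D` contains a basis vector.
  have hsingle : ∀ m : ℕ, ∀ x ∈ D, x ≠ 0 → x.support.card = m → ∃ w ∈ K, cellVec F K w ∈ D := by
    intro m
    induction m using Nat.strong_induction_on with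
    | _ m ih =>
      intro x hx hx0 hm
      obtain ⟨w, hw⟩ := Finsupp.support_nonempty_iff.2 hx0
      by_cases hone : ∀ w' ∈ x.support, w' = w
      · refine ⟨w.1, w.2, ?_⟩
        have h1 : x = x w • cellVec F K w.1 := by
          ext v
          rw [cellVec_of_mem w.2, Finsupp.smul_apply, Subtype.coe_eta, Finsupp.single_apply,
            smul_eq_mul]
          split_ifs with e
          · rw [e, mul_one]
          · rw [mul_zero]
            by_contra hv
            exact e (hone v (Finsupp.mem_support_iff.2 hv)).symm
        rw [h1] at hx
        have h2 := D.smul_mem (x w)⁻¹ hx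
        rwa [smul_smul, inv_mul_cancel₀ (Finsupp.mem_support_iff.1 hw), one_smul] at h2
      · push Not at hone
        obtain ⟨w', hw', hne'⟩ := hone
        obtain ⟨k, hk⟩ : ∃ k, f (w'.1 k) ≠ f (w.1 k) := by
          by_contra hcon
          push Not at hcon
          exact hne' (Subtype.ext (hsep _ w'.2 _ w.2 hcon))
        have hy : ∀ v, (jucysMurphy ρ k x - f (w.1 k) • x) v = (f (v.1 k) - f (w.1 k)) * x v := by
          intro v
          rw [Finsupp.sub_apply, hjm, Finsupp.smul_apply, smul_eq_mul]
          ring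
        refine ih _ ?_ _ (D.sub_mem (jucysMurphy_mem hD k hx) (D.smul_mem (f (w.1 k)) hx)) ?_ rfl
        · rw [← hm]
          refine Finset.card_lt_card ⟨fun v hv => ?_, fun hsub => ?_⟩
          · rw [Finsupp.mem_support_iff, hy] at hv
            exact Finsupp.mem_support_iff.2 (right_ne_zero_of_mul hv)
          · have := hsub hw
            rw [Finsupp.mem_support_iff, hy, sub_self, zero_mul] at this
            exact this rfl
        · intro e
          have := hy w'
          rw [e, Finsupp.zero_apply, eq_comm] at this
          exact mul_ne_zero (sub_ne_zero.2 hk) (Finsupp.mem_support_iff.1 hw') this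
  obtain ⟨x, hx, hx0⟩ := Submodule.exists_mem_ne_zero_of_ne_bot hne
  obtain ⟨w, hw, hwD⟩ := hsingle _ x hx hx0 rfl
  -- The words whose basis vectors lie in `D` are closed under edges, and minimality turns them into
  -- all of `K`.
  let K' := K.filter (fun v => cellVec F K v ∈ D)
  have hK' : ∀ {v}, v ∈ K' ↔ v ∈ K ∧ cellVec F K v ∈ D := Finset.mem_filter
  have hinv : ∀ i j : Fin n, (j : ℕ) = i + 1 → ∀ x ∈ coordSubspace F K K',
      ρ (swap i j) x ∈ coordSubspace F K K' := by
    intro i j hij x hx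
    have hle : coordSubspace F K K' ≤ (coordSubspace F K K').comap (ρ (swap i j)) := by
      conv_lhs => unfold coordSubspace
      rw [Submodule.span_le]
      rintro _ ⟨v, hv, rfl⟩
      obtain ⟨hvK, hvD⟩ := hK'.1 (Finset.mem_coe.1 hv)
      change ρ (swap i j) (cellVec F K v) ∈ coordSubspace F K K'
      obtain ⟨b, hb0, hs⟩ := hρ.exists_coeff hK hb hvK hij
      rw [hs]
      refine add_mem (Submodule.smul_mem _ _ (Submodule.subset_span ⟨v, hv, rfl⟩)) ?_
      by_cases hvs : v * swap i j ∈ K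
      · refine Submodule.smul_mem _ _ (Submodule.subset_span ⟨v * swap i j, ?_, rfl⟩)
        refine Finset.mem_coe.2 (hK'.2 ⟨hvs, ?_⟩)
        have h1 := D.sub_mem (hD (swap i j) _ hvD) (D.smul_mem (f (v j) - f (v i))⁻¹ hvD)
        rw [hs, add_sub_cancel_left] at h1
        have h2 := D.smul_mem b⁻¹ h1
        rwa [smul_smul, inv_mul_cancel₀ (hb0 hvs), one_smul] at h2
      · rw [cellVec_of_notMem hvs, smul_zero]
        exact zero_mem _
    exact hle hx
  have hall : ∀ g : Perm (Fin n), ∀ x ∈ coordSubspace F K K', ρ g x ∈ coordSubspace F K K' := by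
    intro g
    refine simple_induction g (fun x hx => by simpa using hx) ?_
    intro u i j hij ih x hx
    rw [map_mul, Module.End.mul_apply]
    exact ih _ (hinv i j hij x hx)
  have hKK : K' = K := by
    by_contra hne'
    exact hmin.2.2 K' ⟨w, hK'.2 ⟨hw, hwD⟩⟩
      (lt_of_le_of_ne (Finset.filter_subset _ _) hne') hall
  rw [eq_top_iff, ← (Finsupp.basisSingleOne (R := F) (ι := K)).span_eq, Submodule.span_le]
  rintro _ ⟨v, rfl⟩
  have hv : v.1 ∈ K' := by
    rw [hKK]
    exact v.2
  have := (hK'.1 hv).2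
  rwa [cellVec_of_mem v.2] at this

end IsFunctionalRep

end Irreducible

/-! ### Straight shapes -/

section Straight

variable {lam mu : YoungDiagram} {n : ℕ}

namespace SkewTableau

/-- A standard tableau of given shape is determined by its content vector. -/
theorem IsStandard.ext_content {T T' : SkewTableau lam mu n} (hT : IsStandard T)
    (hT' : IsStandard T') (h : ∀ k, content T k = content T' k) : T = T' := by
  have key : ∀ (m : ℕ) (k : Fin n), (k : ℕ) = m → row T k = row T' k ∧ col T k = col T' k := by
    intro m
    induction m using Nat.strong_induction_on with
    | _ m ih =>
      intro k hk
      have hc := h k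
      unfold content at hc
      -- Of two different boxes of `k` on one diagonal, the upper one holds a smaller letter in the
      -- other tableau; by induction that letter has the same box in both.
      rcases lt_trichotomy (row T k) (row T' k) with hr | hr | hr
      · exfalso
        obtain ⟨l, hlr, hlc⟩ := exists_letter T' (box_mem T k)
        have hl : l < k := hT'.lt_of_box_le (by omega) (by omega) (fun e => by subst e; omega)
        have := ih l (by rw [Fin.lt_def] at hl; omega) l rfl
        exact hl.ne (box_injective (T := T) (by omega) (by omega))
      · omega
      · exfalso
        obtain ⟨l, hlr, hlc⟩ := exists_letter T (box_mem T' k)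
        have hl : l < k := hT.lt_of_box_le (by omega) (by omega) (fun e => by subst e; omega)
        have := ih l (by rw [Fin.lt_def] at hl; omega) l rfl
        exact hl.ne (box_injective (T := T') (by omega) (by omega))
  exact ext_of_box (fun k => (key k k rfl).1) (fun k => (key k k rfl).2)

theorem IsStandard.content_zero {T : SkewTableau lam ⊥ n} (hT : IsStandard T) {k : Fin n}
    (hk : (k : ℕ) = 0) : content T k = 0 := by
  have h1 : (0, 0) ∈ skewCells lam ⊥ := by
    have h2 := box_mem T k
    simp only [skewCells, YoungDiagram.cells_bot, Finset.sdiff_empty] at h2 ⊢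
    exact lam.isLowerSet (Prod.mk_le_mk.2 ⟨Nat.zero_le _, Nat.zero_le _⟩) h2
  obtain ⟨l, hlr, hlc⟩ := exists_letter T h1
  have hlk : l = k := by
    by_contra hne
    have := hT.lt_of_box_le (k := l) (l := k) (by omega) (by omega) hne
    rw [Fin.lt_def] at this
    omega
  rw [← hlk]
  unfold content
  omega

end SkewTableau

variable {F : Type*} [Field F] [CharZero F]

/-- For a straight shape the Specht module is the representation of a minimal abstract Young pair
without invariant subspaces. -/
theorem exists_irreducible_pair {Q : SkewTableau lam ⊥ n} (hQ : IsStandard Q) :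
    ∃ (K : Finset (Perm (Fin n))) (ρ : Representation F (Perm (Fin n)) (K →₀ F)),
      IsMinimalAYPair K ρ ∧ Nonempty (ρ.Equiv (skewSpecht F n lam ⊥)) ∧
      ∀ D : Submodule F (K →₀ F), (∀ g, ∀ x ∈ D, ρ g x ∈ D) → D ≠ ⊥ → D = ⊤ := by
  have hb : IsNormalization (cell (fun i => (content Q i : F)) 1) (fun i => (content Q i : F))
      (fun _ => 1) (fun t => (1 - (pairing (fun i => (content Q i : F)) t)⁻¹) *
        (1 - (-(pairing (fun i => (content Q i : F)) t)⁻¹))) := fun t _ => one_mul _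
  have hf : SameDerived (content Q) (content Q) := fun _ _ _ => rfl
  obtain ⟨ρ, hρ, _, hmin, he⟩ := content_rep hQ hf hb
  refine ⟨_, ρ, hmin, he, fun D hD hne =>
    hρ.eq_top_of_invariant (isContentCell hQ hf) hb hmin ?_ ?_ hD hne⟩
  · intro w hw k hk
    have := ((mem_cell_iff hQ hf w).1 hw).content_zero hk
    rw [content_trans_inv] at this
    simp only [this, Int.cast_zero]
  · intro w hw w' hw' h
    have := ((mem_cell_iff hQ hf w).1 hw).ext_content ((mem_cell_iff hQ hf w').1 hw') (fun k => by
      rw [content_trans_inv, content_trans_inv]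
      exact_mod_cast h k)
    ext k
    have h1 := congrArg (fun T : SkewTableau lam ⊥ n => T.symm k) this
    have h2 : Q.symm (w k) = Q.symm (w' k) := h1
    rw [Q.symm.injective h2]

end Straight

end AbstractYoung

namespace AbstractYoung

open Equiv SkewTableau

/-! ### Irreducible representations -/

section Alternating

variable {F : Type*} [Field F] {n : ℕ} {V : Type*} [AddCommGroup V] [Module F V]
  {ρ : Representation F (Perm (Fin n)) V} {κ : Fin n → Fin n} {x : V}

/-- `x` is negated by the transpositions of letters of equal colour. -/
def IsAlternating (ρ : Representation F (Perm (Fin n)) V) (κ : Fin n → Fin n) (x : V) : Prop :=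
  ∀ i j, i ≠ j → κ i = κ j → ρ (swap i j) x = -x

/-- Multiplying by the transposition of `k` and `g k`, which have the same colour, shrinks the
support. -/
theorem IsAlternating.rep_eq (hx : IsAlternating ρ κ x) (g : Perm (Fin n))
    (hg : ∀ k, κ (g k) = κ k) : ρ g x = sgn F g • x := by
  induction hm : g.support.card using Nat.strong_induction_on generalizing g with
  | _ m ih =>
    by_cases h1 : g = 1
    · rw [h1, map_one, sgn_one, one_smul, Module.End.one_apply]
    · obtain ⟨k, hk⟩ : ∃ k, g k ≠ k := by
        by_contra hcon
        push Not at hcon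
        exact h1 (Equiv.ext hcon)
      have h2 := ih _ (hm ▸ Perm.card_support_swap_mul hk) (swap k (g k) * g) (fun l => by
        rw [Perm.mul_apply, ← hg l]
        rcases eq_or_ne (g l) k with e | e
        · rw [e, swap_apply_left, hg]
        · rcases eq_or_ne (g l) (g k) with e' | e'
          · rw [e', swap_apply_right, hg]
          · rw [swap_apply_of_ne_of_ne e e']) rfl
      have h3 : ρ g x = ρ (swap k (g k)) (ρ (swap k (g k) * g) x) := by
        rw [← Module.End.mul_apply, ← map_mul, ← mul_assoc, swap_mul_self, one_mul]
      have h4 : sgn F g = -sgn F (swap k (g k) * g) := by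
        rw [sgn_mul, sgn_swap hk.symm]
        ring
      rw [h3, h2, map_smul, hx _ _ hk.symm (hg k).symm, h4, smul_neg, neg_smul]

/-- The number of letters of colour `c`. -/
def classSize (κ : Fin n → Fin n) (c : Fin n) : ℕ := (Finset.univ.filter (fun k => κ k = c)).card

theorem toLex_lt_toLex {s s' : Fin n → ℕ} {c : Fin n} (h : ∀ d, d < c → s d ≤ s' d)
    (hc : s c < s' c) : toLex s < toLex s' := by
  obtain ⟨d, hd, hmin⟩ := Finset.exists_min_image (Finset.univ.filter (fun d => s d ≠ s' d)) id
    ⟨c, Finset.mem_filter.2 ⟨Finset.mem_univ _, hc.ne⟩⟩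
  have hne := (Finset.mem_filter.1 hd).2
  have hdc : d ≤ c := hmin c (Finset.mem_filter.2 ⟨Finset.mem_univ _, hc.ne⟩)
  refine ⟨d, fun j hj => ?_, ?_⟩
  · by_contra hcon
    exact absurd (hmin j (Finset.mem_filter.2 ⟨Finset.mem_univ _, hcon⟩)) (not_le.2 hj)
  · change s d < s' d
    rcases hdc.eq_or_lt with e | e
    · rw [e]
      exact hc
    · exact lt_of_le_of_ne (h d e) hne

/-- A colouring with a nonzero alternating vector and with lexicographically maximal sizes. -/
structure IsMaximalColouring (ρ : Representation F (Perm (Fin n)) V) (κ : Fin n → Fin n) :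
    Prop where
  exists_ne_zero : ∃ x, x ≠ 0 ∧ IsAlternating ρ κ x
  eq_zero : ∀ κ' y, toLex (classSize κ) < toLex (classSize κ') → IsAlternating ρ κ' y → y = 0

/-- Colouring all letters differently imposes no condition, so there is something to maximize over.
-/
theorem exists_isMaximalColouring [Nontrivial V] (ρ : Representation F (Perm (Fin n)) V) :
    ∃ κ, IsMaximalColouring ρ κ := by
  classical
  obtain ⟨x, hx⟩ := exists_ne (0 : V)
  obtain ⟨κ, hκ, hmax⟩ := Finset.exists_max_image
    (Finset.univ.filter (fun κ : Fin n → Fin n => ∃ x, x ≠ 0 ∧ IsAlternating ρ κ x))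
    (fun κ => toLex (classSize κ))
    ⟨id, Finset.mem_filter.2 ⟨Finset.mem_univ _, x, hx, fun i j hne he => absurd he hne⟩⟩
  refine ⟨κ, (Finset.mem_filter.1 hκ).2, fun κ' y hlt hy => ?_⟩
  by_contra hne
  exact absurd (hmax κ' (Finset.mem_filter.2 ⟨Finset.mem_univ _, y, hne, hy⟩)) (not_le.2 hlt)

/-- Renaming colours does not affect alternation, so the lexicographically largest sizes are sorted.
-/
theorem IsMaximalColouring.antitone (h : IsMaximalColouring ρ κ) : Antitone (classSize κ) := by
  intro c d hcd
  by_contra hlt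
  rw [not_le] at hlt
  obtain ⟨x, hx, halt⟩ := h.exists_ne_zero
  have hsize : ∀ e, classSize (swap c d ∘ κ) e = classSize κ (swap c d e) := by
    intro e
    unfold classSize
    congr 1
    ext k
    simp only [Finset.mem_filter, Finset.mem_univ, true_and, Function.comp_apply]
    constructor
    · rintro rfl
      rw [swap_apply_self]
    · intro e'
      rw [e', swap_apply_self]
  refine hx (h.eq_zero (swap c d ∘ κ) x (toLex_lt_toLex (c := c) (fun e he => ?_) ?_)
    (fun i j hne he => halt i j hne ((swap c d).injective he)))
  · rw [hsize, swap_apply_of_ne_of_ne he.ne (he.trans_le hcd).ne]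
  · rwa [hsize, swap_apply_left]

/-- A colouring with decreasing sizes gives the columns of a tableau of straight shape. -/
theorem exists_tableau_of_antitone (hκ : Antitone (classSize κ)) :
    ∃ (lam : YoungDiagram) (T : SkewTableau lam ⊥ n), ∀ k, col T k = κ k := by
  classical
  have he : ∀ c, Nonempty ({k // κ k = c} ≃ Fin (classSize κ c)) := fun c =>
    ⟨Fintype.equivFinOfCardEq (by rw [Fintype.card_subtype]; rfl)⟩
  obtain ⟨e⟩ : Nonempty (∀ c, {k // κ k = c} ≃ Fin (classSize κ c)) :=
    ⟨fun c => Classical.choice (he c)⟩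
  let lam : YoungDiagram :=
    { cells := (Finset.range n ×ˢ Finset.range n).filter
        (fun x => ∃ h : x.2 < n, x.1 < classSize κ ⟨x.2, h⟩)
      isLowerSet := by
        rintro ⟨i, j⟩ ⟨i', j'⟩ ⟨hi, hj⟩ hx
        simp only [Finset.coe_filter, Finset.mem_product, Finset.mem_range,
          Set.mem_ofPred_eq] at *
        obtain ⟨⟨h1, h2⟩, h3, h4⟩ := hx
        have h5 : classSize κ ⟨j, h3⟩ ≤ classSize κ ⟨j', by omega⟩ := hκ (Fin.mk_le_mk.2 hj)
        exact ⟨⟨by omega, by omega⟩, by omega, by omega⟩ }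
  have hmem : ∀ x : ℕ × ℕ, x ∈ skewCells lam ⊥ ↔ ∃ h : x.2 < n, x.1 < classSize κ ⟨x.2, h⟩ := by
    intro x
    simp only [skewCells, YoungDiagram.cells_bot, Finset.sdiff_empty, lam, Finset.mem_filter,
      Finset.mem_product, Finset.mem_range, and_iff_right_iff_imp]
    rintro ⟨h1, h2⟩
    refine ⟨h2.trans_le ?_, h1⟩
    refine (Finset.card_filter_le _ _).trans ?_
    rw [Finset.card_univ, Fintype.card_fin]
  let r : Fin n → ℕ := fun k => e (κ k) ⟨k, rfl⟩
  have hr : ∀ k c (h : κ k = c), r k = e c ⟨k, h⟩ := by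
    rintro k c rfl
    rfl
  let box : Fin n → skewCells lam ⊥ := fun k => ⟨(r k, κ k), (hmem _).2
    ⟨(κ k).2, (e (κ k) ⟨k, rfl⟩).2⟩⟩
  have hinj : Function.Injective box := by
    intro k l h
    have h0 : (r k, (κ k : ℕ)) = (r l, (κ l : ℕ)) := congrArg Subtype.val h
    rw [Prod.mk.injEq] at h0
    have h1 := h0.1
    rw [hr k _ rfl, hr l (κ k) (Fin.ext h0.2.symm)] at h1
    exact congrArg Subtype.val ((e (κ k)).injective (Fin.ext h1))
  have hsurj : Function.Surjective box := by
    rintro ⟨⟨i, j⟩, hx⟩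
    obtain ⟨h1, h2⟩ := (hmem _).1 hx
    let k := (e ⟨j, h1⟩).symm ⟨i, h2⟩
    refine ⟨k.1, Subtype.ext (Prod.ext ?_ ?_)⟩
    · change r k.1 = i
      rw [hr k.1 ⟨j, h1⟩ k.2]
      simp [k]
    · change (κ k.1 : ℕ) = j
      rw [k.2]
  exact ⟨lam, (Equiv.ofBijective box ⟨hinj, hsurj⟩).symm, fun k => rfl⟩

/-- A vector alternating for a maximal colouring satisfies the Garnir relations. -/
theorem IsMaximalColouring.garnir (h : IsMaximalColouring ρ κ) (hx : IsAlternating ρ κ x)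
    {lam : YoungDiagram} {T : SkewTableau lam ⊥ n} (hT : ∀ k, col T k = κ k) {r c : ℕ}
    (hrc : (r, c) ∈ skewCells lam ⊥) (hrc' : (r, c + 1) ∈ skewCells lam ⊥) :
    ∑ g ∈ permsOf (garnirSet T r c), sgn F g • ρ g x = 0 := by
  classical
  set G := garnirSet T r c with hG
  obtain ⟨p, hpr, hpc⟩ := exists_letter T hrc
  obtain ⟨C, hC⟩ : ∃ C : Fin n, (C : ℕ) = c := ⟨κ p, by rw [← hT, hpc]⟩
  have hGC : ∀ k, k ∈ G ↔ (κ k = C ∧ r ≤ row T k) ∨ ((κ k : ℕ) = c + 1 ∧ row T k ≤ r) := by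
    intro k
    rw [hG, mem_garnirSet, hT, Fin.ext_iff, hC]
  -- Letters of colour `C` outside the belt need a spare colour. If there are any, `C` is used
  -- twice, so `κ` is not surjective and some colour is free.
  obtain ⟨e, he⟩ : ∃ e, (∀ k, κ k ≠ e) ∨ ∀ k, κ k = C → k ∈ G := by
    by_cases hall : ∀ k, κ k = C → k ∈ G
    · exact ⟨C, Or.inr hall⟩
    · push Not at hall
      obtain ⟨k, hk, hkG⟩ := hall
      have hnot : ¬ Function.Injective κ := by
        intro hinj
        have hkp : k = p := hinj (by rw [hk, Fin.ext_iff, hC, ← hT, hpc])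
        rw [hkp] at hk hkG
        exact hkG ((hGC p).2 (Or.inl ⟨hk, hpr.ge⟩))
      rw [Finite.injective_iff_surjective] at hnot
      unfold Function.Surjective at hnot
      push Not at hnot
      obtain ⟨e, he⟩ := hnot
      exact ⟨e, Or.inl he⟩
  -- The whole belt receives colour `C`. The antisymmetrized vector alternates for this colouring,
  -- whose sizes are larger, so it must vanish.
  let κ' : Fin n → Fin n := fun k => if k ∈ G then C else if κ k = C then e else κ k
  have hκG : ∀ k, k ∈ G → κ' k = C := fun k hk => if_pos hk
  have hκC : ∀ k, k ∉ G → κ k = C → κ' k = e := fun k hk hc => by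
    simp only [κ', if_neg hk, if_pos hc]
  have hκ : ∀ k, k ∉ G → κ k ≠ C → κ' k = κ k := fun k hk hc => by
    simp only [κ', if_neg hk, if_neg hc]
  have hsame : ∀ i j, i ∉ G → j ∉ G → κ' i = κ' j → κ i = κ j := by
    intro i j hi hj hij
    by_cases h1 : κ i = C <;> by_cases h2 : κ j = C
    · rw [h1, h2]
    · rw [hκC i hi h1, hκ j hj h2] at hij
      rcases he with he | he
      · exact absurd hij.symm (he j)
      · exact absurd (he i h1) hi
    · rw [hκ i hi h1, hκC j hj h2] at hij
      rcases he with he | he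
      · exact absurd hij (he i)
      · exact absurd (he j h2) hj
    · rwa [hκ i hi h1, hκ j hj h2] at hij
  have hout : ∀ j, j ∉ G → κ' j ≠ C := by
    intro j hj hjC
    by_cases h2 : κ j = C
    · rw [hκC j hj h2] at hjC
      rcases he with he | he
      · exact he j (h2.trans hjC.symm)
      · exact hj (he j h2)
    · rw [hκ j hj h2] at hjC
      exact h2 hjC
  refine h.eq_zero κ' _ (toLex_lt_toLex (c := C) (fun d hd => ?_) ?_) (fun i j hne hij => ?_)
  · refine Finset.card_le_card (fun k hk => ?_)
    rw [Finset.mem_filter] at hk ⊢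
    have hkG : k ∉ G := fun hkG => by
      have := (hGC k).1 hkG
      rw [hk.2, Fin.ext_iff] at this
      rw [Fin.lt_def] at hd
      omega
    refine ⟨hk.1, ?_⟩
    rw [hκ k hkG (by rw [hk.2]; exact hd.ne), hk.2]
  · let A₀ := Finset.univ.filter (fun k => κ k = C ∧ row T k < r)
    let A := Finset.univ.filter (fun k => κ k = C ∧ r ≤ row T k)
    let B := Finset.univ.filter (fun k => (κ k : ℕ) = c + 1 ∧ row T k ≤ r)
    -- Class `C` loses at most `r` letters, those above row `r`, and gains the `r + 1` letters of
    -- the next column down to row `r`; a straight shape contains all these boxes.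
    have h1 : classSize κ C ≤ A₀.card + A.card := by
      refine (Finset.card_le_card (fun k hk => ?_)).trans (Finset.card_union_le A₀ A)
      simp only [A₀, A, Finset.mem_union, Finset.mem_filter, Finset.mem_univ, true_and] at hk ⊢
      rcases lt_or_ge (row T k) r with h1 | h1
      · exact Or.inl ⟨hk, h1⟩
      · exact Or.inr ⟨hk, h1⟩
    have h2 : A₀.card ≤ r := by
      rw [← Finset.card_range r]
      refine Finset.card_le_card_of_injOn (row T) (fun k hk => ?_) (fun k hk l hl hkl => ?_)
      · exact Finset.mem_coe.2 (Finset.mem_range.2 (Finset.mem_filter.1 hk).2.2)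
      · have hk' := (Finset.mem_filter.1 hk).2.1
        have hl' := (Finset.mem_filter.1 hl).2.1
        exact box_injective hkl (by rw [hT, hT, hk', hl'])
    have h3 : r + 1 ≤ B.card := by
      rw [← Finset.card_range (r + 1)]
      refine Finset.card_le_card_of_surjOn (row T) (fun i hi => ?_)
      have hi' : i < r + 1 := Finset.mem_range.1 hi
      have hbox : (i, c + 1) ∈ skewCells lam ⊥ := by
        rw [mem_skewCells] at hrc' ⊢
        exact ⟨lam.isLowerSet (Prod.mk_le_mk.2 ⟨by omega, le_rfl⟩) hrc'.1,
          YoungDiagram.notMem_bot _⟩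
      obtain ⟨k, hkr, hkc⟩ := exists_letter T hbox
      exact ⟨k, Finset.mem_coe.2 (Finset.mem_filter.2 ⟨Finset.mem_univ _, by rw [← hT, hkc],
        by omega⟩), hkr⟩
    have h4 : A.card + B.card ≤ classSize κ' C := by
      rw [← Finset.card_union_of_disjoint]
      · refine Finset.card_le_card (fun k hk => ?_)
        refine Finset.mem_filter.2 ⟨Finset.mem_univ _, hκG k ((hGC k).2 ?_)⟩
        rcases Finset.mem_union.1 hk with hk | hk
        · exact Or.inl (Finset.mem_filter.1 hk).2
        · exact Or.inr (Finset.mem_filter.1 hk).2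
      · rw [Finset.disjoint_left]
        intro k hk hk'
        have e1 := (Finset.mem_filter.1 hk).2.1
        have e2 := (Finset.mem_filter.1 hk').2.1
        rw [e1] at e2
        omega
    omega
  · by_cases hi : i ∈ G
    · by_cases hj : j ∈ G
      · exact rep_swap_antisymmetrizer ρ x hi hj hne
      · exact absurd (hij.symm.trans (hκG i hi)) (hout j hj)
    · by_cases hj : j ∈ G
      · exact absurd (hij.trans (hκG j hj)) (hout i hi)
      -- A transposition of letters outside the belt commutes with the belt permutations.
      · rw [map_sum, ← Finset.sum_neg_distrib]
        refine Finset.sum_congr rfl (fun g hg => ?_)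
        have h1 := conj_swap g i j
        rw [mem_permsOf.1 hg i hi, mem_permsOf.1 hg j hj] at h1
        have h2 : swap i j * g = g * swap i j := (mul_inv_eq_iff_eq_mul.1 h1).symm
        rw [map_smul, ← Module.End.mul_apply, ← map_mul, h2, map_mul, Module.End.mul_apply,
          hx i j hne (hsame i j hi hj hij), map_neg, smul_neg]

end Alternating

/-! ### Realization of irreducible representations -/

section Irreducible

variable {F : Type*} [Field F] {n : ℕ} {V : Type*} [AddCommGroup V] [Module F V]
  {ρ : Representation F (Perm (Fin n)) V}

theorem eq_top_of_isIrreducible (hρ : ρ.IsIrreducible) {D : Submodule F V}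
    (hD : ∀ g, ∀ x ∈ D, ρ g x ∈ D) {x : V} (hx : x ∈ D) (hx0 : x ≠ 0) : D = ⊤ := by
  rcases hρ.eq_bot_or_eq_top ⟨D, hD⟩ with h | h
  · have h1 : D = ⊥ := congrArg Subrepresentation.toSubmodule h
    rw [h1] at hx
    exact absurd ((Submodule.mem_bot F).1 hx) hx0
  · exact congrArg Subrepresentation.toSubmodule h

theorem nontrivial_of_isIrreducible (hρ : ρ.IsIrreducible) : Nontrivial V := by
  by_contra h
  rw [not_nontrivial_iff_subsingleton] at h
  have := hρ.toNontrivial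
  obtain ⟨A, B, hAB⟩ := this
  refine hAB (Subrepresentation.toSubmodule_injective (Submodule.ext fun x => ?_))
  rw [Subsingleton.elim x 0]
  exact iff_of_true (zero_mem _) (zero_mem _)

/-- Every irreducible representation is the representation of a minimal abstract Young pair. -/
theorem isMinimalAYRep_of_isIrreducible [CharZero F] (hρ : ρ.IsIrreducible) : IsMinimalAYRep ρ := by
  have := nontrivial_of_isIrreducible hρ
  obtain ⟨κ, hκ⟩ := exists_isMaximalColouring ρ
  obtain ⟨x, hx0, hx⟩ := hκ.exists_ne_zero
  obtain ⟨lam, T, hT⟩ := exists_tableau_of_antitone hκ.antitone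
  obtain ⟨L, hL, hxL⟩ := exists_linearMap_of_relations (ρ := ρ) (T₀ := T) (x := x)
    (isColumnAlternating_translate fun g hg => hx.rep_eq g (fun k => Fin.ext (by
      rw [← hT, ← hT, mem_columnGroup.1 hg])))
    (satisfiesGarnir_translate fun r c hr hc => hκ.garnir hx hT hr hc)
  obtain ⟨Q, hQ⟩ := exists_columnReading (card_skewCells_of_tableau T)
  obtain ⟨K, σ, hmin, ⟨e⟩, hirr⟩ :=
    exists_irreducible_pair (F := F) (isStandard_of_columnReading hQ)
  -- Schur's lemma by hand: the range of this intertwiner contains `x ≠ 0`, so it is onto and its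
  -- kernel is proper; both sides have no proper nonzero invariant subspace.
  let M : (K →₀ F) →ₗ[F] V := L ∘ₗ e.toLinearMap
  have he : ∀ g v, e (σ g v) = skewSpecht F n lam ⊥ g (e v) := fun g v =>
    LinearMap.congr_fun (e.isIntertwining' g) v
  have hM : ∀ g, M ∘ₗ σ g = ρ g ∘ₗ M := by
    intro g
    ext1 v
    ext
    change L (e (σ g _)) = ρ g (L (e _))
    rw [he]
    exact LinearMap.congr_fun (hL g) _
  have hxM : x ∈ LinearMap.range M := by
    obtain ⟨y, rfl⟩ := hxL
    obtain ⟨z, rfl⟩ := e.toLinearEquiv.surjective y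
    exact ⟨z, rfl⟩
  have hsurj : LinearMap.range M = ⊤ := by
    refine eq_top_of_isIrreducible hρ ?_ hxM hx0
    rintro g _ ⟨y, rfl⟩
    exact ⟨σ g y, LinearMap.congr_fun (hM g) y⟩
  have hinj : LinearMap.ker M = ⊥ := by
    by_contra hne
    have h1 := hirr (LinearMap.ker M) (fun g y hy => by
      rw [LinearMap.mem_ker] at hy ⊢
      exact (LinearMap.congr_fun (hM g) y).trans
        (by rw [LinearMap.comp_apply, hy, map_zero])) hne
    obtain ⟨z, rfl⟩ := hxM
    exact hx0 (LinearMap.mem_ker.1 (h1 ▸ Submodule.mem_top : z ∈ LinearMap.ker M))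
  exact ⟨K, σ, hmin, ⟨(Representation.Equiv.mk (LinearEquiv.ofBijective M
    ⟨LinearMap.ker_eq_bot.1 hinj, LinearMap.range_eq_top.1 hsurj⟩) hM).symm⟩⟩

end Irreducible

end AbstractYoung

theorem corollary4p12 {F : Type*} [Field F] [CharZero F] (n : ℕ) :
    -- the minimal AY representations are, up to isomorphism, exactly the skew Specht modules
    (∀ (V : Type*) [AddCommGroup V] [Module F V]
      (ρ : Representation F (Equiv.Perm (Fin n)) V),
      AbstractYoung.IsMinimalAYRep ρ ↔
        ∃ lam mu : YoungDiagram, mu ≤ lam ∧ (AbstractYoung.skewCells lam mu).card = n ∧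
          Nonempty (ρ.Equiv (AbstractYoung.skewSpecht F n lam mu))) ∧
    -- the representation attached to a content vector
    (∀ lam mu : YoungDiagram, mu ≤ lam → ∀ Q₀ : AbstractYoung.SkewTableau lam mu n,
      AbstractYoung.SkewTableau.IsStandard Q₀ →
      ∀ f : Fin n → ℤ,
        AbstractYoung.SameDerived f (AbstractYoung.SkewTableau.content Q₀) →
        AbstractYoung.IsGeneric
          (AbstractYoung.cell (fun i => (f i : F)) 1) (fun i => (f i : F)) ∧
        ∀ bUp bDown : Equiv.Perm (Fin n) → F,
          AbstractYoung.IsNormalization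
            (AbstractYoung.cell (fun i => (f i : F)) 1) (fun i => (f i : F)) bUp bDown →
          ∃ ρ : Representation F (Equiv.Perm (Fin n))
              (AbstractYoung.cell (fun i => (f i : F)) 1 →₀ F),
            AbstractYoung.IsFunctionalRep
              (AbstractYoung.cell (fun i => (f i : F)) 1) (fun i => (f i : F)) bUp bDown ρ ∧
            (∀ σ, AbstractYoung.IsFunctionalRep
              (AbstractYoung.cell (fun i => (f i : F)) 1) (fun i => (f i : F)) bUp bDown σ →
              σ = ρ) ∧
            AbstractYoung.IsMinimalAYPair (AbstractYoung.cell (fun i => (f i : F)) 1) ρ ∧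
            Nonempty (ρ.Equiv (AbstractYoung.skewSpecht F n lam mu))) ∧
    -- every irreducible representation is a minimal AY representation
    (∀ (V : Type*) [AddCommGroup V] [Module F V]
      (ρ : Representation F (Equiv.Perm (Fin n)) V),
      ρ.IsIrreducible → AbstractYoung.IsMinimalAYRep ρ) := by
  refine ⟨fun V _ _ ρ => ⟨?_, ?_⟩, ?_,
    fun V _ _ ρ hρ => AbstractYoung.isMinimalAYRep_of_isIrreducible hρ⟩
  · rintro ⟨K, σ, hσ, ⟨e⟩⟩
    obtain ⟨lam, mu, hle, hcard, ⟨e'⟩⟩ := hσ.exists_equiv_skewSpecht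
    exact ⟨lam, mu, hle, hcard, ⟨e.trans e'⟩⟩
  · rintro ⟨lam, mu, _, hcard, h⟩
    exact AbstractYoung.isMinimalAYRep_of_equiv_skewSpecht hcard h
  · intro lam mu _ Q hQ f hf
    exact ⟨AbstractYoung.isGeneric_of_isContentCell
      (AbstractYoung.SkewTableau.isContentCell hQ hf),
      fun bUp bDown hb => AbstractYoung.content_rep hQ hf hb⟩
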